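/- **Conventions.** Let $x=(x_1,\dots,x_n)$, $y=(y_1,\dots,y_m)$. A *potential* in variables $z_1,\dots,z_k$ with positive rational weights $|z_i|$ is a polynomial $V\in\mathbb{C}[z]$ that is quasi-homogeneous of weight $2$, lies in $\mathfrak{m}^2$, where $\mathfrak m=\langle z_1,\dots,z_k\rangle$, and has finite-dimensional Jacobi ring $\mathbb{C}[z]/\langle\partial_{z_1}V,\dots,\partial_{z_k}V\rangle$. A *graded rank $N$ matrix factorisation* of $V_1(x)-V_2(y)$ is a matrix $Q=\begin{pmatrix}0&E\\J&0\end{pmatrix}\in M_{2N}(\mathbb{C}[x,y])$ with $Q^2=(V_1(x)-V_2(y))\,\mathbf 1_{2N}$ for which there are $g_1,\dots,g_{2N}\in\mathbb{Q}$ such that each entry $Q_{rs}$ is quasi-homogeneous of weight $g_s-g_r+1$. With $\sigma=\mathrm{diag}(\mathbf 1_N,-\mathbf 1_N)$, $\mathrm{str}(M)=\mathrm{tr}(\sigma M)$ and $\mathrm{res}$ the Grothendieck residue at the origin, its quantum dimensions are $$q_L(Q)=(-1)^{\binom{m+1}{2}}\,\mathrm{res}_x\!\left[\frac{\mathrm{str}(\partial_{x_1}Q\cdots\partial_{x_n}Q\,\partial_{y_1}Q\cdots\partial_{y_m}Q)}{\partial_{x_1}V_1\cdots\partial_{x_n}V_1}\right]\in\mathbb{C}[y],\qquad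 q_R(Q)=(-1)^{\binom{n+1}{2}}\,\mathrm{res}_y\!\left[\frac{\mathrm{str}(\partial_{x_1}Q\cdots\partial_{x_n}Q\,\partial_{y_1}Q\cdots\partial_{y_m}Q)}{\partial_{y_1}V_2\cdots\partial_{y_m}V_2}\right]\in\mathbb{C}[x].$$ $Q$ is an *orbifold equivalence* between the potentials $V_1(x)$ and $V_2(y)$ if it is a graded matrix factorisation of $V_1(x)-V_2(y)$ and $q_L(Q)$, $q_R(Q)$ are invertible. We write $V_1\sim_{oeq}V_2$ if, for suitable weights for which both are potentials, there is an orbifold equivalence between them none of whose entries has a non-zero constant term. **Lemma 4.2.** Let $Q(x,y)$ be an orbifold equivalence between $V_1(x)$ and $V_2(y)$, and let $y\mapsto y'=\varphi(y)$ be an invertible (polynomial automorphism) change of variables which is weight-preserving, i.e. each $y'_j=\varphi_j(y)$ is quasi-homogeneous of weight $|y_j|$. Let $A=(A_{jk})$, where $A_{jk}$ is the coefficient of $y_k$ in $\varphi_j(y)$. Assume that the weights $|y_1|,\dots,|y_m|$ are pairwise different or that $V_2\in\mathfrak{m}^3$. Then $\det(A)\neq0$, and: * $Q$ and $V_2$ rewritten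 in the new coordinates $y'$: $Q'(x,y')=Q(x,\varphi^{-1}(y'))$ is an orbifold equivalence between $V_1(x)$ and $V_2'(y')=V_2(\varphi^{-1}(y'))$ (same weights), and $$q_R(Q')=\det(A)\,q_R(Q),\qquad q_L(Q')=\det(A)^{-1}\,q_L(Q).$$ * Equivalently (exchanging $\varphi$ and $\varphi^{-1}$), $Q''(x,y)=Q(x,\varphi(y))$ is an orbifold equivalence between $V_1(x)$ and $V_2(\varphi(y))$, and $q_R(Q'')=\det(A)^{-1}q_R(Q)$, $q_L(Q'')=\det(A)\,q_L(Q)$. In both cases, if no entry of $Q$ has a non-zero constant term, the same holds for the transformed matrix. **Moreover**, the following orbifold equivalences hold. 1. Auto-equivalences. Any two of the polynomials listed for the same singularity are orbifold equivalent: * $U_{12}$: $y_1^4+y_2^3+y_3^3$, $\ y_1^4+y_2^3+y_2y_3^2$, $\ y_1^4+y_2^2y_3+y_2y_3^2$; * $Q_{12}$: $y_1^5+y_1y_2^2+y_3^3$, $\ y_1^3y_2+y_1y_2^2+y_3^3$; * $W_{12}$: $y_1^5+y_2^4+y_3^2$, $\ y_1^5+y_2^2y_3+y_3^2$; * $W_{13}$: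 $y_1^4y_2+y_2^4+y_3^2$, $\ y_1^4y_2+y_2^2y_3+y_3^2$; * $Z_{13}$: $y_1^6+y_1y_2^3+y_3^2$, $\ y_1^3y_3+y_1y_2^3+y_3^2$; * $E_{14}$: $y_1^8+y_2^2+y_3^3$, $\ y_1^4y_2+y_2^2+y_3^3$; * $Q_{17}^T$: $x_1^3x_2+x_2^5x_3+x_3^2$, $\ y_1^3y_2+y_2^{10}+y_3^2$. 2. For every $n\ge2$: * ($A$–$D^T$) $x_1^{2n}+x_2^2\ \sim_{oeq}\ y_1^ny_2+y_2^2$; * ($L$–$D$) $x_1^nx_2+x_1x_2^2\ \sim_{oeq}\ y_1^{2n-1}+y_1y_2^2$; * ($C$–$D$) $x_1^2x_2+x_2^nx_3+x_3^2\ \sim_{oeq}\ y_1^{2n}+y_1y_2^2+y_3^2$. 3. Marginal deformations: * $x_1^9+x_2^3\ \sim_{oeq}\ y_1^6y_2+y_2^3+\mu_2\,y_1^3y_2^2$ if $\mu_2=\pm\sqrt3$; * $x_1^3x_2+x_2^7+\mu_1x_1x_2^5\ \sim_{oeq}\ y_1y_2^5+y_1^3y_2+\mu_2\,y_1^2y_2^3$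 if $\mu_2^2\neq4$ and $\mu_1=\mu\,(\tfrac13\mu_2^2-1)$ for some $\mu\in\mathbb{C}$ with $\mu^3\,\mu_2^2\,(\tfrac29\mu_2^2-1)^2=-9$. 4. Elliptic curves. For $\lambda\in\mathbb{C}$ put $V_\lambda=-x_2^2x_3+x_1(x_1-x_3)(x_1-\lambda x_3)$, and for $e_1,e_2,e_3\in\mathbb{C}$ put $V_e=-y_2^2y_3+(y_1-e_1y_3)(y_1-e_2y_3)(y_1-e_3y_3)$. * If $e_1,e_2,e_3$ are pairwise different and $\lambda=(e_3-e_1)/(e_2-e_1)$, then $V_\lambda\sim_{oeq}V_e$. * If $\lambda\ne0,1$ and $\lambda'\in\{\lambda,\,1-\lambda,\,1/\lambda,\,1/(1-\lambda),\,(\lambda-1)/\lambda,\,\lambda/(\lambda-1)\}$, then $V_{\lambda'}\sim_{oeq}V_\lambda$. -/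

import Mathlib

open MvPolynomial

noncomputable section

namespace LG

/-! ### Grothendieck residues -/

/-- Data witnessing that the common zero locus of `f₁, …, fₙ` is (scheme-theoretically) supported
at the origin: exponents `νᵢ + 1 ≥ 1` and a matrix `C` with `zᵢ ^ (νᵢ + 1) = ∑ⱼ Cᵢⱼ fⱼ`. -/
structure ResidueData {R : Type*} [CommRing R] {n : ℕ} (f : Fin n → MvPolynomial (Fin n) R) where
  ν : Fin n →₀ ℕ
  C : Matrix (Fin n) (Fin n) (MvPolynomial (Fin n) R)
  eq : ∀ i, (X i : MvPolynomial (Fin n) R) ^ (ν i + 1) = ∑ j, C i j * f j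

/-- The residue of `det(C) g / (z₁ ^ (ν₁ + 1) ⋯ zₙ ^ (νₙ + 1))`, that is the coefficient of
`z₁ ^ ν₁ ⋯ zₙ ^ νₙ` in `det(C) g`. -/
def ResidueData.eval {R : Type*} [CommRing R] {n : ℕ} {f : Fin n → MvPolynomial (Fin n) R}
    (D : ResidueData f) (g : MvPolynomial (Fin n) R) : R :=
  coeff D.ν (D.C.det * g)

open Classical in
/-- The Grothendieck residue `res_z [ g / (f₁ ⋯ fₙ) ]` at the origin, over a coefficient ring `R`
(the parameters), computed through the transformation law
`res [g / (f₁ ⋯ fₙ)] = res [det(C) g / (z₁ ^ (ν₁ + 1) ⋯ zₙ ^ (νₙ + 1))]`.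
The result does not depend on the chosen `ν` and `C` (see `residue_eq_eval`).
The value is `0` (junk) if no such data exist. -/
def residue {R : Type*} [CommRing R] {n : ℕ} (f : Fin n → MvPolynomial (Fin n) R)
    (g : MvPolynomial (Fin n) R) : R :=
  if h : Nonempty (ResidueData f) then h.some.eval g else 0

/-- A polynomial in the ideal generated by `zₖ ^ (aₖ + 1)`, `k ∈ S`, has no monomial `z ^ e` with
`eₖ ≤ aₖ` for all `k ∈ S`. -/
lemma coeff_eq_zero_of_mem {R : Type*} [CommRing R] {n : ℕ} {a e : Fin n →₀ ℕ} {S : Set (Fin n)}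
    (he : ∀ k ∈ S, e k ≤ a k) {p : MvPolynomial (Fin n) R}
    (hp : p ∈ Ideal.span ((fun k => (X k : MvPolynomial (Fin n) R) ^ (a k + 1)) '' S)) :
    coeff e p = 0 := by
  have key : ∀ k ∈ S, ∀ q : MvPolynomial (Fin n) R, coeff e (q * X k ^ (a k + 1)) = 0 := by
    intro k hk q
    rw [X_pow_eq_monomial, coeff_mul_monomial', if_neg]
    intro hle
    have h1 := hle k
    have h2 := he k hk
    simp at h1
    omega
  induction hp using Submodule.span_induction with
  | mem x hx =>
    obtain ⟨k, hk, rfl⟩ := hx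
    simpa using key k hk 1
  | zero => simp
  | add x y _ _ hx hy => rw [coeff_add, hx, hy, add_zero]
  | smul r x hx _ =>
    have : r • x ∈ Ideal.span ((fun k => (X k : MvPolynomial (Fin n) R) ^ (a k + 1)) '' S) :=
      Ideal.mul_mem_left _ r hx
    clear hx
    generalize r • x = z at this
    rw [Ideal.span, Submodule.mem_span_image_iff_exists_fun] at this
    obtain ⟨t, ht, c, rfl⟩ := this
    rw [coeff_sum]
    exact Finset.sum_eq_zero fun k _ => key k (ht k.2) (c k)

/-- Changing one row of `C` does not change the residue. -/
lemma coeff_det_updateRow {R : Type*} [CommRing R] {n : ℕ} {f : Fin n → MvPolynomial (Fin n) R}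
    (a : Fin n →₀ ℕ) (M : Matrix (Fin n) (Fin n) (MvPolynomial (Fin n) R))
    (hM : ∀ i, (X i : MvPolynomial (Fin n) R) ^ (a i + 1) = ∑ j, M i j * f j)
    (i : Fin n) (u : Fin n → MvPolynomial (Fin n) R)
    (hu : (X i : MvPolynomial (Fin n) R) ^ (a i + 1) = ∑ j, u j * f j)
    (g : MvPolynomial (Fin n) R) :
    coeff a ((M.updateRow i u).det * g) = coeff a (M.det * g) := by
  set I := Ideal.span ((fun k => (X k : MvPolynomial (Fin n) R) ^ (a k + 1)) '' {k | k ≠ i})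
    with hI
  set v := u - M i with hv
  set L := M.updateRow i v with hL
  have hdet : (M.updateRow i u).det = L.det + M.det := by
    have h1 : u = v + M i := by simp [hv]
    conv_lhs => rw [h1, Matrix.det_updateRow_add, Matrix.updateRow_eq_self]
  have hrow : ∀ k, L.mulVec f k ∈ I := by
    intro k
    by_cases hk : k = i
    · subst hk
      have : L.mulVec f k = 0 := by
        simp only [Matrix.mulVec, dotProduct, hL, Matrix.updateRow_self, hv, Pi.sub_apply,
          sub_mul, Finset.sum_sub_distrib]
        rw [← hu, ← hM k, sub_self]
      rw [this]
      exact I.zero_mem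
    · have : L.mulVec f k = X k ^ (a k + 1) := by
        simp only [Matrix.mulVec, dotProduct, hL, Matrix.updateRow_ne hk]
        exact (hM k).symm
      rw [this]
      exact Ideal.subset_span ⟨k, hk, rfl⟩
  have hf : ∀ j, L.det * f j ∈ I := by
    intro j
    have h1 : (L.adjugate * L).mulVec f j = L.det * f j := by
      rw [Matrix.adjugate_mul, Matrix.smul_mulVec, Matrix.one_mulVec]
      simp
    rw [← h1, ← Matrix.mulVec_mulVec]
    simp only [Matrix.mulVec, dotProduct] at hrow ⊢
    exact I.sum_mem fun k _ => I.mul_mem_left _ (hrow k)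
  have hx : X i ^ (a i + 1) * (L.det * g) ∈ I := by
    have h1 : X i ^ (a i + 1) * (L.det * g) = ∑ j, (g * M i j) * (L.det * f j) := by
      rw [hM i, Finset.sum_mul]
      exact Finset.sum_congr rfl fun j _ => by ring
    rw [h1]
    exact I.sum_mem fun k _ => I.mul_mem_left _ (hf k)
  have h0 : coeff a (L.det * g) = 0 := by
    have h1 := coeff_eq_zero_of_mem (e := Finsupp.single i (a i + 1) + a) (a := a) (by
      intro k hk
      have hk' : i ≠ k := fun h => hk h.symm
      simp [hk']) hx
    rwa [X_pow_eq_monomial, coeff_monomial_mul, one_mul] at h1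
  rw [hdet, add_mul, coeff_add, h0, zero_add]

/-- Two matrices `C`, `D` for the same exponents give the same residue. -/
lemma coeff_det_eq {R : Type*} [CommRing R] {n : ℕ} {f : Fin n → MvPolynomial (Fin n) R}
    (a : Fin n →₀ ℕ) (M M' : Matrix (Fin n) (Fin n) (MvPolynomial (Fin n) R))
    (hM : ∀ i, (X i : MvPolynomial (Fin n) R) ^ (a i + 1) = ∑ j, M i j * f j)
    (hM' : ∀ i, (X i : MvPolynomial (Fin n) R) ^ (a i + 1) = ∑ j, M' i j * f j)
    (g : MvPolynomial (Fin n) R) : coeff a (M.det * g) = coeff a (M'.det * g) := by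
  classical
  suffices h : ∀ s : Finset (Fin n),
      coeff a ((Matrix.of fun i j => if i ∈ s then M i j else M' i j).det * g) =
        coeff a (M'.det * g) by
    have h1 := h Finset.univ
    simp only [Finset.mem_univ, if_true] at h1
    exact h1
  intro s
  induction s using Finset.induction_on with
  | empty =>
    simp only [Finset.notMem_empty, if_false]
    rfl
  | insert i s hi ih =>
    rw [← ih, ← coeff_det_updateRow (f := f) a
      (Matrix.of fun i j => if i ∈ s then M i j else M' i j) ?_ i (M i) (hM i) g]
    · congr 3
      ext1 k j
      by_cases hk : k = i
      · subst hk; simp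
      · simp [hk]
    · intro k
      by_cases hk : k ∈ s
      · simpa [hk] using hM k
      · simpa [hk] using hM' k

/-- The exponents can be raised. -/
lemma coeff_det_raise {R : Type*} [CommRing R] {n : ℕ} (a b : Fin n →₀ ℕ)
    (M : Matrix (Fin n) (Fin n) (MvPolynomial (Fin n) R)) (g : MvPolynomial (Fin n) R) :
    coeff (b + a) ((Matrix.diagonal (fun i => (X i : MvPolynomial (Fin n) R) ^ b i) * M).det * g) =
      coeff a (M.det * g) := by
  have h : (∏ i, (X i : MvPolynomial (Fin n) R) ^ b i) = monomial b 1 := by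
    rw [monomial_eq, C_1, one_mul, Finsupp.prod_fintype _ _ (fun i => pow_zero _)]
  rw [Matrix.det_mul, Matrix.det_diagonal, h, mul_assoc, coeff_monomial_mul, one_mul]

/-- The residue is independent of the choices. -/
theorem residue_eq_eval {R : Type*} [CommRing R] {n : ℕ} {f : Fin n → MvPolynomial (Fin n) R}
    (D : ResidueData f) (g : MvPolynomial (Fin n) R) : residue f g = D.eval g := by
  have h : Nonempty (ResidueData f) := ⟨D⟩
  rw [residue, dif_pos h]
  set E := h.some
  have aux : ∀ (F : ResidueData f) (b : Fin n →₀ ℕ) (i : Fin n),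
      (X i : MvPolynomial (Fin n) R) ^ ((b + F.ν) i + 1) =
        ∑ j, (Matrix.diagonal (fun i => (X i : MvPolynomial (Fin n) R) ^ b i) * F.C) i j * f j := by
    intro F b i
    simp only [Matrix.diagonal_mul, mul_assoc, ← Finset.mul_sum, ← F.eq, ← pow_add]
    simp [add_assoc]
  unfold ResidueData.eval
  rw [← coeff_det_raise E.ν D.ν, ← coeff_det_raise D.ν E.ν, add_comm E.ν D.ν]
  refine coeff_det_eq (f := f) _ _ _ (aux E D.ν) ?_ g
  rw [add_comm D.ν E.ν]
  exact aux D E.ν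

/-! ### Potentials -/

/-- `V` is a potential with respect to the weights `w`: the weights are positive rationals,
`V` is quasi-homogeneous of weight `2`, `V ∈ 𝔪²`, and the Jacobi ring of `V` is
finite-dimensional over `ℂ`. -/
structure IsPotential {n : ℕ} (w : Fin n → ℚ) (V : MvPolynomial (Fin n) ℂ) : Prop where
  weight_pos : ∀ i, 0 < w i
  homogeneous : IsWeightedHomogeneous w V 2
  mem_sq : V ∈ idealOfVars (Fin n) ℂ ^ 2
  finite_jac : Module.Finite ℂ
    (MvPolynomial (Fin n) ℂ ⧸ Ideal.span (Set.range fun i => pderiv i V))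

/-! ### Matrix factorisations of `V₁(x) - V₂(y)` -/

/-- Polynomials in the variables `x = (x₁, …, xₙ)` (left) and `y = (y₁, …, yₘ)` (right). -/
abbrev PolyXY (n m : ℕ) := MvPolynomial (Fin n ⊕ Fin m) ℂ

/-- `2N × 2N` matrices over `ℂ[x, y]`, in `N × N` blocks. -/
abbrev MatXY (n m N : ℕ) := Matrix (Fin N ⊕ Fin N) (Fin N ⊕ Fin N) (PolyXY n m)

/-- The `ℤ/2`-grading matrix `σ = diag(1, -1)`. -/
def sigma (n m N : ℕ) : MatXY n m N := Matrix.fromBlocks 1 0 0 (-1)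

/-- The supertrace `str(A) = tr(σ A)`. -/
def str {n m N : ℕ} (A : MatXY n m N) : PolyXY n m := (sigma n m N * A).trace

/-- `W(x, y) = V₁(x) - V₂(y)`. -/
def diffPot {n m : ℕ} (V₁ : MvPolynomial (Fin n) ℂ) (V₂ : MvPolynomial (Fin m) ℂ) : PolyXY n m :=
  rename Sum.inl V₁ - rename Sum.inr V₂

/-- `Q` is a graded rank `N` matrix factorisation of `V₁(x) - V₂(y)`: it is block off-diagonal,
`Q = (0, E; J, 0)`, it satisfies `Q² = (V₁(x) - V₂(y)) 1`, and there are rational `gᵣ` such that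
`U(λ) Q(λ ▷ z) U(λ)⁻¹ = λ Q(z)` for `U(λ) = diag(λ ^ gᵣ)`, that is, each entry `Qᵣₛ` is
quasi-homogeneous of weight `gₛ - gᵣ + 1`. -/
structure IsGradedMF {n m N : ℕ} (wx : Fin n → ℚ) (wy : Fin m → ℚ)
    (V₁ : MvPolynomial (Fin n) ℂ) (V₂ : MvPolynomial (Fin m) ℂ) (Q : MatXY n m N) : Prop where
  odd₁ : Q.toBlocks₁₁ = 0
  odd₂ : Q.toBlocks₂₂ = 0
  sq : Q * Q = diffPot V₁ V₂ • (1 : MatXY n m N)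
  graded : ∃ g : Fin N ⊕ Fin N → ℚ, ∀ r s,
    IsWeightedHomogeneous (Sum.elim wx wy) (Q r s) (g s - g r + 1)

/-- No entry of `Q` has a non-zero constant term. -/
def NoConstantEntries {n m N : ℕ} (Q : MatXY n m N) : Prop :=
  ∀ r s, constantCoeff (Q r s) = 0

/-! ### Quantum dimensions and orbifold equivalence -/

/-- The entrywise partial derivative of a matrix. -/
def matDeriv {n m N : ℕ} (i : Fin n ⊕ Fin m) (Q : MatXY n m N) : MatXY n m N :=
  Q.map (pderiv i)

/-- `str(∂_{x₁}Q ⋯ ∂_{xₙ}Q · ∂_{y₁}Q ⋯ ∂_{yₘ}Q)`. -/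
def strDeriv {n m N : ℕ} (Q : MatXY n m N) : PolyXY n m :=
  str ((List.ofFn fun i : Fin n => matDeriv (Sum.inl i) Q).prod *
    (List.ofFn fun j : Fin m => matDeriv (Sum.inr j) Q).prod)

/-- The left quantum dimension, a polynomial in `y`: the residue is taken in the variables `x`,
with denominators `∂_{x₁}V₁, …, ∂_{xₙ}V₁`. -/
def qL {n m N : ℕ} (V₁ : MvPolynomial (Fin n) ℂ) (Q : MatXY n m N) : MvPolynomial (Fin m) ℂ :=
  (-1) ^ (m + 1).choose 2 *
    residue (fun i => map (C : ℂ →+* MvPolynomial (Fin m) ℂ) (pderiv i V₁))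
      (sumAlgEquiv ℂ (Fin n) (Fin m) (strDeriv Q))

/-- The right quantum dimension, a polynomial in `x`: the residue is taken in the variables `y`,
with denominators `∂_{y₁}V₂, …, ∂_{yₘ}V₂`. -/
def qR {n m N : ℕ} (V₂ : MvPolynomial (Fin m) ℂ) (Q : MatXY n m N) : MvPolynomial (Fin n) ℂ :=
  (-1) ^ (n + 1).choose 2 *
    residue (fun j => map (C : ℂ →+* MvPolynomial (Fin n) ℂ) (pderiv j V₂))
      (sumAlgEquiv ℂ (Fin m) (Fin n) (rename Sum.swap (strDeriv Q)))

/-- `Q` is an orbifold equivalence between the potentials `V₁(x)` and `V₂(y)`: a graded matrix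
factorisation of `V₁(x) - V₂(y)` both of whose quantum dimensions are invertible. -/
structure IsOrbifoldEquivalence {n m N : ℕ} (wx : Fin n → ℚ) (wy : Fin m → ℚ)
    (V₁ : MvPolynomial (Fin n) ℂ) (V₂ : MvPolynomial (Fin m) ℂ) (Q : MatXY n m N) : Prop where
  pot₁ : IsPotential wx V₁
  pot₂ : IsPotential wy V₂
  mf : IsGradedMF wx wy V₁ V₂ Q
  unit_qL : IsUnit (qL V₁ Q)
  unit_qR : IsUnit (qR V₂ Q)

/-- Two polynomials are orbifold equivalent if, for some weights making them potentials, there is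
an orbifold equivalence (without constant entries) between them. -/
def OrbifoldEquivalent {n m : ℕ} (V₁ : MvPolynomial (Fin n) ℂ) (V₂ : MvPolynomial (Fin m) ℂ) :
    Prop :=
  ∃ (wx : Fin n → ℚ) (wy : Fin m → ℚ) (N : ℕ) (Q : MatXY n m N),
    IsOrbifoldEquivalence wx wy V₁ V₂ Q ∧ NoConstantEntries Q

/-! ### Changes of the variables `y` -/

/-- An invertible polynomial change of variables `y ↦ y'`, given by the automorphism `φ` of
`ℂ[y]` with `φ(yⱼ) = y'ⱼ`, is weight-preserving if each `y'ⱼ` is quasi-homogeneous of weight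
`|yⱼ|`. -/
def IsWeightPreserving {m : ℕ} (wy : Fin m → ℚ)
    (φ : MvPolynomial (Fin m) ℂ ≃ₐ[ℂ] MvPolynomial (Fin m) ℂ) : Prop :=
  ∀ j, IsWeightedHomogeneous wy (φ (X j)) (wy j)

/-- The matrix `A` of the linear part of `y'ⱼ = φ(yⱼ)`: `Aⱼₖ` is the coefficient of `yₖ` in
`y'ⱼ`. -/
def linearPart {m : ℕ} (φ : MvPolynomial (Fin m) ℂ ≃ₐ[ℂ] MvPolynomial (Fin m) ℂ) :
    Matrix (Fin m) (Fin m) ℂ :=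
  Matrix.of fun j k => coeff (Finsupp.single k 1) (φ (X j))

/-- The matrix `Q(x, φ(y₁), …, φ(yₘ))`, obtained by substituting `φ(yⱼ)` for `yⱼ` in all entries
of `Q(x, y)`. -/
def substY {n m N : ℕ} (φ : MvPolynomial (Fin m) ℂ ≃ₐ[ℂ] MvPolynomial (Fin m) ℂ)
    (Q : MatXY n m N) : MatXY n m N :=
  Q.map (aeval (Sum.elim (fun i => X (Sum.inl i)) (fun j => rename Sum.inr (φ (X j)))))

/-! ### Some quasi-homogeneous polynomials -/

/-- `U₁₂` as `y₁⁴ + y₂³ + y₃³`. -/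
def U12a : MvPolynomial (Fin 3) ℂ :=
  X 0 ^ 4 + X 1 ^ 3 + X 2 ^ 3

/-- `U₁₂` as `y₁⁴ + y₂³ + y₂ y₃²`. -/
def U12b : MvPolynomial (Fin 3) ℂ :=
  X 0 ^ 4 + X 1 ^ 3 + X 1 * X 2 ^ 2

/-- `U₁₂` as `y₁⁴ + y₂² y₃ + y₂ y₃²`. -/
def U12c : MvPolynomial (Fin 3) ℂ :=
  X 0 ^ 4 + X 1 ^ 2 * X 2 + X 1 * X 2 ^ 2

/-- `Q₁₂` as `y₁⁵ + y₁ y₂² + y₃³`. -/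
def Q12a : MvPolynomial (Fin 3) ℂ :=
  X 0 ^ 5 + X 0 * X 1 ^ 2 + X 2 ^ 3

/-- `Q₁₂` as `y₁³ y₂ + y₁ y₂² + y₃³`. -/
def Q12b : MvPolynomial (Fin 3) ℂ :=
  X 0 ^ 3 * X 1 + X 0 * X 1 ^ 2 + X 2 ^ 3

/-- `W₁₂` as `y₁⁵ + y₂⁴ + y₃²`. -/
def W12a : MvPolynomial (Fin 3) ℂ :=
  X 0 ^ 5 + X 1 ^ 4 + X 2 ^ 2

/-- `W₁₂` as `y₁⁵ + y₂² y₃ + y₃²`. -/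
def W12b : MvPolynomial (Fin 3) ℂ :=
  X 0 ^ 5 + X 1 ^ 2 * X 2 + X 2 ^ 2

/-- `W₁₃` as `y₁⁴ y₂ + y₂⁴ + y₃²`. -/
def W13a : MvPolynomial (Fin 3) ℂ :=
  X 0 ^ 4 * X 1 + X 1 ^ 4 + X 2 ^ 2

/-- `W₁₃` as `y₁⁴ y₂ + y₂² y₃ + y₃²`. -/
def W13b : MvPolynomial (Fin 3) ℂ :=
  X 0 ^ 4 * X 1 + X 1 ^ 2 * X 2 + X 2 ^ 2

/-- `Z₁₃` as `y₁⁶ + y₁ y₂³ + y₃²`. -/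
def Z13a : MvPolynomial (Fin 3) ℂ :=
  X 0 ^ 6 + X 0 * X 1 ^ 3 + X 2 ^ 2

/-- `Z₁₃` as `y₁³ y₃ + y₁ y₂³ + y₃²`. -/
def Z13b : MvPolynomial (Fin 3) ℂ :=
  X 0 ^ 3 * X 2 + X 0 * X 1 ^ 3 + X 2 ^ 2

/-- `E₁₄` as `y₁⁸ + y₂² + y₃³`. -/
def E14a : MvPolynomial (Fin 3) ℂ :=
  X 0 ^ 8 + X 1 ^ 2 + X 2 ^ 3

/-- `E₁₄` as `y₁⁴ y₂ + y₂² + y₃³`. -/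
def E14b : MvPolynomial (Fin 3) ℂ :=
  X 0 ^ 4 * X 1 + X 1 ^ 2 + X 2 ^ 3

/-- `Q₁₇ᵀ` as `x₁³ x₂ + x₂⁵ x₃ + x₃²`. -/
def Q17Ta : MvPolynomial (Fin 3) ℂ :=
  X 0 ^ 3 * X 1 + X 1 ^ 5 * X 2 + X 2 ^ 2

/-- `Q₁₇ᵀ` as `y₁³ y₂ + y₂¹⁰ + y₃²`. -/
def Q17Tb : MvPolynomial (Fin 3) ℂ :=
  X 0 ^ 3 * X 1 + X 1 ^ 10 + X 2 ^ 2

/-- `A₂ₙ₋₁`: `x₁²ⁿ + x₂²`. -/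
def singAOdd (n : ℕ) : MvPolynomial (Fin 2) ℂ :=
  X 0 ^ (2 * n) + X 1 ^ 2

/-- `Dᵀₙ₊₁`: `y₁ⁿ y₂ + y₂²`. -/
def singDT (n : ℕ) : MvPolynomial (Fin 2) ℂ :=
  X 0 ^ n * X 1 + X 1 ^ 2

/-- `Lₙ`: `x₁ⁿ x₂ + x₁ x₂²`. -/
def singL (n : ℕ) : MvPolynomial (Fin 2) ℂ :=
  X 0 ^ n * X 1 + X 0 * X 1 ^ 2

/-- `D₂ₙ` (for `n ≥ 1`): `y₁²ⁿ⁻¹ + y₁ y₂²`. -/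
def singDEven (n : ℕ) : MvPolynomial (Fin 2) ℂ :=
  X 0 ^ (2 * n - 1) + X 0 * X 1 ^ 2

/-- `Cₙ`: `x₁² x₂ + x₂ⁿ x₃ + x₃²`. -/
def singC (n : ℕ) : MvPolynomial (Fin 3) ℂ :=
  X 0 ^ 2 * X 1 + X 1 ^ n * X 2 + X 2 ^ 2

/-- `D₂ₙ₊₁`, stabilised by a square: `y₁²ⁿ + y₁ y₂² + y₃²`. -/
def singDOdd (n : ℕ) : MvPolynomial (Fin 3) ℂ :=
  X 0 ^ (2 * n) + X 0 * X 1 ^ 2 + X 2 ^ 2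

/-- `A₈ × A₂`: `x₁⁹ + x₂³`. -/
def singA8A2 : MvPolynomial (Fin 2) ℂ :=
  X 0 ^ 9 + X 1 ^ 3

/-- Deformed `Z₁₃ᵀ`: `y₁⁶ y₂ + y₂³ + μ y₁³ y₂²`. -/
def singZ13T (μ : ℂ) : MvPolynomial (Fin 2) ℂ :=
  X 0 ^ 6 * X 1 + X 1 ^ 3 + C μ * (X 0 ^ 3 * X 1 ^ 2)

/-- Deformed `E₁₉ᵀ`: `x₁³ x₂ + x₂⁷ + μ x₁ x₂⁵`. -/
def singE19T (μ : ℂ) : MvPolynomial (Fin 2) ℂ :=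
  X 0 ^ 3 * X 1 + X 1 ^ 7 + C μ * (X 0 * X 1 ^ 5)

/-- The deformed loop `y₁ y₂⁵ + y₁³ y₂ + μ y₁² y₂³`. -/
def loop35 (μ : ℂ) : MvPolynomial (Fin 2) ℂ :=
  X 0 * X 1 ^ 5 + X 0 ^ 3 * X 1 + C μ * (X 0 ^ 2 * X 1 ^ 3)

/-! ### Elliptic curves -/

/-- `V_λ = -x₂² x₃ + x₁ (x₁ - x₃) (x₁ - λ x₃)`. -/
def ellipticLegendre (l : ℂ) : MvPolynomial (Fin 3) ℂ :=
  -(X 1 ^ 2 * X 2) + X 0 * (X 0 - X 2) * (X 0 - C l * X 2)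

/-- `V_e = -y₂² y₃ + (y₁ - e₁ y₃) (y₁ - e₂ y₃) (y₁ - e₃ y₃)`. -/
def ellipticWeierstrass (e₁ e₂ e₃ : ℂ) : MvPolynomial (Fin 3) ℂ :=
  -(X 1 ^ 2 * X 2) + (X 0 - C e₁ * X 2) * (X 0 - C e₂ * X 2) * (X 0 - C e₃ * X 2)

end LG

end

/-!
# Changes of variables in orbifold equivalences

*Change of variables.* If `φ` is a graded automorphism with linear part `A`, the chain rule gives
`∂_{yⱼ} Q(x, φ(y)) = ∑ₖ Jⱼₖ (∂_{yₖ} Q)(x, φ(y))` with the Jacobian matrix `J`, whose determinant is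
the constant `det A`. Both quantum dimensions are constants, because they are homogeneous and
potentials related by an orbifold equivalence have equal central charges. So the remaining
variables, on which the residue does not operate, may be set to `0`. It remains to move the matrix
`J` out of the supertrace as its determinant, modulo the ideal `residueAnn` of polynomials all of
whose multiples have residue zero. This is multilinear algebra: a functional on words in
`d₁, …, dₘ` that vanishes on anticommutators of neighbours is alternating (`apply_prod_eq_det_mul`).
Differentiating `Q² = W` twice shows that the anticommutator of two first derivatives of `Q` is
`∂ⱼ∂ₖW` up to a graded commutator with `Q`, and such commutators have vanishing supertrace modulo
`residueAnn` (`trace_prod_eq_det_mul`).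

* For the right quantum dimension, the term `∂ⱼ∂ₖW` is harmless: the supertrace of a word in which
  one of the derivatives is missing is annihilated, up to the other denominators, by the
  denominator `∂_cV₂` belonging to the missing index `c` (`mem_residueAnn_of_syzygy`). The residue
  itself changes by `(det A)⁻²` on forms of top weight (`IsGradedAut.residue_apply`), which together
  with the factor `det A` from the supertrace gives `(det A)⁻¹`.
* For the left quantum dimension `y` is set to `0`, where `∂ⱼ∂ₖV₂` vanishes if `V₂ ∈ 𝔪³`. For
  pairwise different weights, `A` is diagonal and nothing has to be permuted.

*Equivalences.* A potential `V` is orbifold equivalent to `φ(V)` for each automorphism `φ` that is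
graded from one set of weights to another (`IsPotential.orbifoldEquivalent`). The equivalence is the
Koszul factorisation `∑ᵢ (xᵢ - φ(yᵢ)) θᵢ + bᵢ(x, φ(y)) θᵢ*` with Clifford generators `θᵢ`, `θᵢ*`
acting on a Fock space (`FockData`). Supertraces of words with fewer than all generators vanish, so
its quantum dimensions are residues of a Jacobian determinant. They are nonzero, because the
determinant of a matrix `B` with `∂ₗV = ∑ᵢ Bₗᵢ zᵢ` generates the socle of the Jacobi ring and has
residue `1` (`residue_det_mul_of_eq`). All listed equivalences are linear substitutions combined
with a completion of a square or a cube. That the polynomials are potentials follows from the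
Nullstellensatz (`isPotential_of_zeros`).
-/


noncomputable section

namespace LG

/-! ### Algebra of Grothendieck residues -/

section Residue

variable {R S : Type*} [CommRing R] [CommRing S] {n : ℕ}

/-- The image of residue data under a change of coefficients. -/
def ResidueData.map {f : Fin n → MvPolynomial (Fin n) R} (D : ResidueData f) (ψ : R →+* S) :
    ResidueData (fun i => MvPolynomial.map ψ (f i)) where
  ν := D.ν
  C := D.C.map (MvPolynomial.map ψ)
  eq i := by
    have := congrArg (MvPolynomial.map ψ) (D.eq i)
    simpa using this

lemma ResidueData.map_residue {f : Fin n → MvPolynomial (Fin n) R} (D : ResidueData f)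
    (ψ : R →+* S) (g : MvPolynomial (Fin n) R) :
    ψ (residue f g) = residue (fun i => MvPolynomial.map ψ (f i)) (MvPolynomial.map ψ g) := by
  rw [residue_eq_eval D, residue_eq_eval (D.map ψ)]
  simp only [ResidueData.eval, ResidueData.map]
  rw [← coeff_map, map_mul, RingHom.map_det]
  rfl

variable (f : Fin n → MvPolynomial (Fin n) R)

lemma residue_add (g h : MvPolynomial (Fin n) R) :
    residue f (g + h) = residue f g + residue f h := by
  unfold residue
  split_ifs
  · simp [ResidueData.eval, mul_add]
  · simp

lemma residue_zero : residue f 0 = 0 := by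
  unfold residue
  split_ifs <;> simp [ResidueData.eval]

lemma residue_C_mul (r : R) (g : MvPolynomial (Fin n) R) :
    residue f (C r * g) = r * residue f g := by
  unfold residue
  split_ifs
  · simp only [ResidueData.eval]
    rw [mul_left_comm, coeff_C_mul]
  · simp

/-- The ideal of all `u` such that `res [p u / f]` vanishes for every `p`. -/
def residueAnn : Ideal (MvPolynomial (Fin n) R) where
  carrier := {u | ∀ p, residue f (p * u) = 0}
  zero_mem' p := by simp [residue_zero]
  add_mem' {a b} ha hb p := by
    rw [mul_add, residue_add, ha p, hb p, add_zero]
  smul_mem' c x hx p := by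
    rw [smul_eq_mul, ← mul_assoc]
    exact hx _

variable {f}

lemma residue_eq_zero_of_mem {u : MvPolynomial (Fin n) R} (hu : u ∈ residueAnn f) :
    residue f u = 0 := by
  simpa using hu 1

lemma residue_eq_of_sub_mem {g h : MvPolynomial (Fin n) R} (hgh : g - h ∈ residueAnn f) :
    residue f g = residue f h := by
  have := residue_eq_zero_of_mem hgh
  rw [show g = (g - h) + h by ring, residue_add, this, zero_add]

/-- Residues kill the coefficients of all syzygies `∑ uⱼ fⱼ = 0`: adding the syzygy to a row of the
matrix `C` of the residue data gives residue data again. -/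
lemma mem_residueAnn_of_syzygy (D : ResidueData f) (u : Fin n → MvPolynomial (Fin n) R)
    (hu : ∑ j, u j * f j = 0) (c : Fin n) : u c ∈ residueAnn f := by
  have key : ∀ (i : Fin n) (q : MvPolynomial (Fin n) R),
      coeff D.ν ((D.C.updateRow i u).det * q) = 0 := by
    intro i q
    have h1 := coeff_det_updateRow D.ν D.C D.eq i (D.C i + u)
      (by simp only [Pi.add_apply, add_mul, Finset.sum_add_distrib, hu, add_zero]; exact D.eq i) q
    rw [Matrix.det_updateRow_add, Matrix.updateRow_eq_self, add_mul, coeff_add] at h1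
    simpa using h1
  intro p
  rw [residue_eq_eval D, ResidueData.eval]
  have h2 : D.C.det * (p * u c) = ∑ i, (D.C.updateRow i u).det * (D.C i c * p) := by
    have h3 : ∀ i, (D.C.updateRow i u).det = ∑ j, u j * D.C.adjugate j i := by
      intro i
      rw [Matrix.det_eq_sum_mul_adjugate_row _ i]
      refine Finset.sum_congr rfl fun j _ => ?_
      rw [Matrix.updateRow_self, Matrix.adjugate_apply, Matrix.adjugate_apply,
        Matrix.updateRow_idem]
    have h4 : ∀ j, ∑ i, D.C.adjugate j i * D.C i c = if j = c then D.C.det else 0 := by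
      intro j
      have := congrFun (congrFun D.C.adjugate_mul j) c
      rw [Matrix.mul_apply] at this
      rw [this, Matrix.smul_apply, Matrix.one_apply]
      simp
    calc D.C.det * (p * u c) = ∑ j, u j * p * (if j = c then D.C.det else 0) := by
          simp; ring
      _ = ∑ j, u j * p * ∑ i, D.C.adjugate j i * D.C i c := by simp_rw [h4]
      _ = ∑ i, ∑ j, u j * p * (D.C.adjugate j i * D.C i c) := by
          simp_rw [Finset.mul_sum]
          exact Finset.sum_comm
      _ = _ := by
          refine Finset.sum_congr rfl fun i _ => ?_
          rw [h3, Finset.sum_mul]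
          exact Finset.sum_congr rfl fun j _ => by ring
  rw [h2, coeff_sum]
  exact Finset.sum_eq_zero fun i _ => key i _

lemma mem_residueAnn_self (D : ResidueData f) (c : Fin n) : f c ∈ residueAnn f := by
  intro p
  rw [residue_eq_eval D, ResidueData.eval]
  apply coeff_eq_zero_of_mem (S := Set.univ) (a := D.ν) (fun k _ => le_rfl)
  have h1 : D.C.det * f c = ∑ i, D.C.adjugate c i * X i ^ (D.ν i + 1) := by
    have h2 : (D.C.adjugate * D.C).mulVec f c = D.C.det * f c := by
      rw [Matrix.adjugate_mul, Matrix.smul_mulVec, Matrix.one_mulVec]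
      simp
    rw [← h2, ← Matrix.mulVec_mulVec]
    simp only [Matrix.mulVec, dotProduct, D.eq]
  rw [mul_left_comm, h1]
  refine Ideal.mul_mem_left _ _ (Ideal.sum_mem _ fun i _ => Ideal.mul_mem_left _ _ ?_)
  exact Ideal.subset_span ⟨i, trivial, rfl⟩

/-- If `f_c u` is a combination of the other `f_a`, then residues kill `u`. -/
lemma mem_residueAnn_of_mul_mem (D : ResidueData f) {c : Fin n} {u : MvPolynomial (Fin n) R}
    (hu : f c * u ∈ Ideal.span (f '' {a | a ≠ c})) : u ∈ residueAnn f := by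
  rw [Ideal.span, Submodule.mem_span_image_iff_exists_fun] at hu
  classical
  obtain ⟨t, ht, b, hb⟩ := hu
  have htc : c ∉ t := fun h => ht h rfl
  have := mem_residueAnn_of_syzygy D
    (fun j => if h : j ∈ t then - b ⟨j, h⟩ else if j = c then u else 0) ?_ c
  · simpa [htc] using this
  · have h1 : ∀ j, (if h : j ∈ t then - b ⟨j, h⟩ else if j = c then u else 0) * f j
        = (if h : j ∈ t then - (b ⟨j, h⟩ * f j) else 0) + (if j = c then u * f c else 0) := by
      intro j
      by_cases hj : j ∈ t
      · have : j ≠ c := ht hj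
        simp [hj, this]
      · by_cases hc : j = c
        · subst hc; simp [hj]
        · simp [hj, hc]
    rw [Finset.sum_congr rfl fun j _ => h1 j, Finset.sum_add_distrib, Finset.sum_ite_eq',
      if_pos (Finset.mem_univ _), mul_comm u, ← hb]
    have h2 : ∑ j, (if h : j ∈ t then - (b ⟨j, h⟩ * f j) else 0) = ∑ j : t, - (b j * f j) := by
      rw [← Finset.sum_subset (Finset.subset_univ t), ← Finset.sum_coe_sort t]
      · refine Finset.sum_congr rfl fun j _ => ?_
        simp
      · intro j _ hj
        simp [hj]
    rw [h2]
    simp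

/-- Residue data for `M f` give residue data for `f`. -/
def ResidueData.ofMul {p : Fin n → MvPolynomial (Fin n) R}
    (D : ResidueData p) (M : Matrix (Fin n) (Fin n) (MvPolynomial (Fin n) R))
    (hM : ∀ i, p i = ∑ j, M i j * f j) : ResidueData f where
  ν := D.ν
  C := D.C * M
  eq i := by
    rw [D.eq i]
    simp only [hM, Matrix.mul_apply, Finset.mul_sum, Finset.sum_mul]
    rw [Finset.sum_comm]
    exact Finset.sum_congr rfl fun j _ => Finset.sum_congr rfl fun k _ => by ring

/-- The transformation law: if `p = M f`, then `res [h / f] = res [det(M) h / p]`. -/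
lemma residue_transform {p : Fin n → MvPolynomial (Fin n) R}
    (D : ResidueData p) (M : Matrix (Fin n) (Fin n) (MvPolynomial (Fin n) R))
    (hM : ∀ i, p i = ∑ j, M i j * f j) (h : MvPolynomial (Fin n) R) :
    residue f h = residue p (M.det * h) := by
  rw [residue_eq_eval (D.ofMul M hM), residue_eq_eval D]
  simp only [ResidueData.eval, ResidueData.ofMul, Matrix.det_mul, mul_assoc]

/-- If `f = M z` then `res [det(M) h / f] = h(0)`. -/
lemma residue_det_mul_of_eq (D : ResidueData f)
    (M : Matrix (Fin n) (Fin n) (MvPolynomial (Fin n) R))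
    (hM : ∀ i, f i = ∑ j, M i j * X j) (h : MvPolynomial (Fin n) R) :
    residue f (M.det * h) = constantCoeff h := by
  rw [← residue_transform D M hM]
  rw [residue_eq_eval (⟨0, 1, by intro i; simp [Matrix.one_apply]⟩ : ResidueData _)]
  simp [ResidueData.eval, constantCoeff_eq]

/-- If `z = N f` then `res [h / f] = det(N)(0) h(0)`. -/
lemma residue_of_X_eq (N : Matrix (Fin n) (Fin n) (MvPolynomial (Fin n) R))
    (hN : ∀ i, X i = ∑ j, N i j * f j) (h : MvPolynomial (Fin n) R) :
    residue f h = constantCoeff N.det * constantCoeff h := by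
  rw [residue_eq_eval (⟨0, N, by intro i; simp [hN]⟩ : ResidueData f)]
  simp only [ResidueData.eval]
  rw [← map_mul, constantCoeff_eq]

end Residue

/-! ### Weighted homogeneous polynomials -/

section Homogeneous

variable {σ τ : Type*} {w : σ → ℚ} {w' : τ → ℚ}

lemma _root_.MvPolynomial.IsWeightedHomogeneous.weight_congr {p : MvPolynomial σ ℂ} {a b : ℚ}
    (h : IsWeightedHomogeneous w p a) (hab : a = b) : IsWeightedHomogeneous w p b := hab ▸ h

lemma _root_.MvPolynomial.IsWeightedHomogeneous.pderiv_sub {p : MvPolynomial σ ℂ} {a : ℚ}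
    (h : IsWeightedHomogeneous w p a) (i : σ) :
    IsWeightedHomogeneous w (pderiv i p) (a - w i) :=
  IsWeightedHomogeneous.pderiv h (sub_add_cancel _ _)

lemma component_mul_right {f : MvPolynomial σ ℂ} {e : ℚ} (hf : IsWeightedHomogeneous w f e)
    (c : MvPolynomial σ ℂ) (a : ℚ) :
    weightedHomogeneousComponent w a (c * f) = weightedHomogeneousComponent w (a - e) c * f := by
  let := weightedGradedAlgebra ℂ w
  have h := DirectSum.coe_decompose_mul_add_of_right_mem (weightedHomogeneousSubmodule ℂ w)
    (i := a - e) (j := e) (a := c) (b := f) hf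
  rw [sub_add_cancel] at h
  exact ((weightedDecomposition.decompose'_apply ℂ w (c * f) a).symm.trans h).trans
    (congrArg (· * f) (weightedDecomposition.decompose'_apply ℂ w c (a - e)))

/-- Substituting homogeneous polynomials of the right weights preserves the weight. -/
lemma _root_.MvPolynomial.IsWeightedHomogeneous.aeval_weight {F : σ → MvPolynomial τ ℂ}
    (hF : ∀ i, IsWeightedHomogeneous w' (F i) (w i)) {p : MvPolynomial σ ℂ} {e : ℚ}
    (hp : IsWeightedHomogeneous w p e) : IsWeightedHomogeneous w' (aeval F p) e := by
  rw [aeval_def, eval₂_eq]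
  refine IsWeightedHomogeneous.sum _ _ _ fun d hd => ?_
  have h1 := (IsWeightedHomogeneous.prod d.support (fun i => F i ^ d i) (fun i => d i • w i)
    fun i _ => (hF i).pow _).C_mul (coeff d p)
  refine h1.weight_congr ?_
  rw [← hp (mem_support_iff.mp hd), Finsupp.weight_apply]
  rfl

lemma _root_.MvPolynomial.IsWeightedHomogeneous.rename_weight {ι : σ → τ} (hι : ∀ i, w' (ι i) = w i)
    {p : MvPolynomial σ ℂ} {e : ℚ} (hp : IsWeightedHomogeneous w p e) :
    IsWeightedHomogeneous w' (rename ι p) e := by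
  rw [show MvPolynomial.rename ι p = MvPolynomial.aeval (fun i => X (ι i)) p from
    DFunLike.congr_fun (by ext; simp) p]
  exact hp.aeval_weight fun i => hι i ▸ isWeightedHomogeneous_X ℂ w' (ι i)

lemma _root_.MvPolynomial.IsWeightedHomogeneous.weight_eq_zero {p : MvPolynomial σ ℂ} {e : ℚ}
    (hp : IsWeightedHomogeneous w p e) (h0 : constantCoeff p ≠ 0) : e = 0 := by
  rw [constantCoeff_eq] at h0
  rw [← hp h0, map_zero]

lemma _root_.MvPolynomial.IsWeightedHomogeneous.constantCoeff_eq_zero {p : MvPolynomial σ ℂ} {e : ℚ}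
    (hp : IsWeightedHomogeneous w p e) (he : e ≠ 0) : constantCoeff p = 0 :=
  not_not.mp fun h => he (hp.weight_eq_zero h)

lemma _root_.MvPolynomial.IsWeightedHomogeneous.eq_C [Finite σ] (hw : ∀ i, 0 < w i)
    {p : MvPolynomial σ ℂ} (hp : IsWeightedHomogeneous w p 0) : p = C (constantCoeff p) := by
  classical
  ext d
  rw [coeff_C, constantCoeff_eq]
  split_ifs with h
  · rw [h]
  · by_contra hd
    have h1 := hp hd
    rw [Finsupp.weight_apply, Finsupp.sum] at h1
    rw [Finset.sum_eq_zero_iff_of_nonneg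
      (fun i _ => nsmul_nonneg (hw i).le _)] at h1
    apply h
    ext i
    by_contra hi
    have h2 := h1 i (Finsupp.mem_support_iff.mpr (Ne.symm hi))
    rw [nsmul_eq_mul, mul_eq_zero, Nat.cast_eq_zero] at h2
    exact h2.elim (Ne.symm hi) (hw i).ne'

/-- If the total weight of a polynomial in `(x, y)` is `e`, the coefficient of `x ^ ν` has
weight `e - ∑ νᵢ wᵢ`. -/
lemma _root_.MvPolynomial.IsWeightedHomogeneous.coeff_sumAlgEquiv [Fintype σ] [Fintype τ]
    {p : MvPolynomial (σ ⊕ τ) ℂ} {e : ℚ}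
    (hp : IsWeightedHomogeneous (Sum.elim w w') p e) (ν : σ →₀ ℕ) :
    IsWeightedHomogeneous w' (coeff ν (sumAlgEquiv ℂ σ τ p)) (e - Finsupp.weight w ν) := by
  classical
  rw [p.as_sum, map_sum, coeff_sum]
  refine IsWeightedHomogeneous.sum _ _ _ fun d hd => ?_
  have hmon : sumAlgEquiv ℂ σ τ (monomial d (coeff d p)) =
      monomial (Finsupp.sumFinsuppEquivProdFinsupp d).1
        (monomial (Finsupp.sumFinsuppEquivProdFinsupp d).2 (coeff d p)) := by
    ext; simp [sumAlgEquiv, monomial, coeff]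
  rw [hmon, coeff_monomial]
  split_ifs with h
  · refine isWeightedHomogeneous_monomial _ _ _ ?_
    rw [← hp (mem_support_iff.mp hd), ← h]
    simp only [Finsupp.weight_apply]
    rw [Finsupp.sum_fintype _ _ (by simp), Finsupp.sum_fintype _ _ (by simp),
      Finsupp.sum_fintype _ _ (by simp), Fintype.sum_sum_type]
    simp
  · exact isWeightedHomogeneous_zero _ _ _

end Homogeneous

/-! ### Homogeneous residue data -/

section Data

variable {n : ℕ} {w : Fin n → ℚ}

/-- Homogeneous residue data: the entries of `C` have the weights forced by
`zᵢ ^ (νᵢ + 1) = ∑ⱼ Cᵢⱼ fⱼ`, where `fⱼ` has weight `eⱼ`. -/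
def ResidueData.IsHomogeneous (w e : Fin n → ℚ) {f : Fin n → MvPolynomial (Fin n) ℂ}
    (D : ResidueData f) : Prop :=
  ∀ i j, IsWeightedHomogeneous w (D.C i j) ((D.ν i + 1) * w i - e j)

lemma ResidueData.IsHomogeneous.det {e : Fin n → ℚ} {f : Fin n → MvPolynomial (Fin n) ℂ}
    {D : ResidueData f} (hD : D.IsHomogeneous w e) :
    IsWeightedHomogeneous w D.C.det (Finsupp.weight w D.ν + ∑ i, w i - ∑ i, e i) := by
  rw [Matrix.det_apply]
  refine IsWeightedHomogeneous.sum _ _ _ fun π _ => ?_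
  have h1 := IsWeightedHomogeneous.prod Finset.univ (fun i => D.C (π i) i) _
    fun i _ => hD (π i) i
  have h2 : ∑ i, ((D.ν (π i) + 1) * w (π i) - e i) =
      Finsupp.weight w D.ν + ∑ i, w i - ∑ i, e i := by
    rw [Finset.sum_sub_distrib, Equiv.sum_comp π (fun i => ((D.ν i : ℚ) + 1) * w i),
      Finsupp.weight_apply, Finsupp.sum_fintype _ _ (by simp)]
    simp [add_mul, Finset.sum_add_distrib]
  rw [h2] at h1
  rcases Int.units_eq_one_or (Equiv.Perm.sign π) with h | h <;> rw [h]
  · simpa using h1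
  · simpa using h1.neg

/-- Homogeneous functions with a finite-dimensional quotient have homogeneous residue data. -/
lemma exists_homogeneous_data (hw : ∀ i, 0 < w i) {e : Fin n → ℚ}
    {f : Fin n → MvPolynomial (Fin n) ℂ} (hf : ∀ j, IsWeightedHomogeneous w (f j) (e j))
    (hfin : Module.Finite ℂ (MvPolynomial (Fin n) ℂ ⧸ Ideal.span (Set.range f))) :
    ∃ D : ResidueData f, D.IsHomogeneous w e := by
  have key : ∀ i, ∃ (N : ℕ) (c : Fin n → MvPolynomial (Fin n) ℂ),
      X i ^ (N + 1) = ∑ j, c j * f j ∧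
      ∀ j, IsWeightedHomogeneous w (c j) ((N + 1) * w i - e j) := by
    intro i
    obtain ⟨p, hp, hp0⟩ := Algebra.IsIntegral.isIntegral (R := ℂ)
      (Ideal.Quotient.mk (Ideal.span (Set.range f)) (X i))
    have h1 : Polynomial.aeval (X i : MvPolynomial (Fin n) ℂ) p ∈ Ideal.span (Set.range f) := by
      rw [← Ideal.Quotient.eq_zero_iff_mem, ← hp0, ← Polynomial.aeval_def]
      exact (Polynomial.aeval_algHom_apply (Ideal.Quotient.mkₐ ℂ _) _ _).symm
    obtain ⟨c, hc⟩ := (Ideal.mem_span_range_iff_exists_fun).mp h1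
    have h2 : weightedHomogeneousComponent w (p.natDegree * w i)
        (Polynomial.aeval (X i : MvPolynomial (Fin n) ℂ) p) = X i ^ p.natDegree := by
      rw [Polynomial.aeval_eq_sum_range, map_sum, Finset.sum_range_succ,
        Finset.sum_eq_zero, zero_add, Polynomial.Monic.coeff_natDegree hp, one_smul]
      · apply IsWeightedHomogeneous.weightedHomogeneousComponent_same
        simpa using (isWeightedHomogeneous_X ℂ w i).pow p.natDegree
      · intro k hk
        rw [map_smul, IsWeightedHomogeneous.weightedHomogeneousComponent_ne
          (m := k * w i), smul_zero]
        · simpa using (isWeightedHomogeneous_X ℂ w i).pow k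
        · intro h
          have := mul_right_cancel₀ (hw i).ne' h
          rw [Finset.mem_range] at hk
          exact hk.ne (by exact_mod_cast this.symm)
    refine ⟨p.natDegree, fun j =>
      X i * weightedHomogeneousComponent w (p.natDegree * w i - e j) (c j), ?_, ?_⟩
    · rw [pow_succ', ← h2, ← hc, map_sum, Finset.mul_sum]
      refine Finset.sum_congr rfl fun j _ => ?_
      rw [component_mul_right (hf j), mul_assoc]
    · intro j
      refine ((isWeightedHomogeneous_X ℂ w i).mul
        (weightedHomogeneousComponent_isWeightedHomogeneous _ _)).weight_congr ?_
      ring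
  choose N c h1 h2 using key
  exact ⟨⟨Finsupp.equivFunOnFinite.symm N, Matrix.of c, h1⟩, h2⟩

/-- The residue with parameters of a homogeneous polynomial is homogeneous. -/
lemma isWeightedHomogeneous_residue {m : ℕ} {w' : Fin m → ℚ} {e : Fin n → ℚ}
    {f : Fin n → MvPolynomial (Fin n) ℂ} {D : ResidueData f} (hD : D.IsHomogeneous w e)
    {p : MvPolynomial (Fin n ⊕ Fin m) ℂ} {a : ℚ}
    (hp : IsWeightedHomogeneous (Sum.elim w w') p a) :
    IsWeightedHomogeneous w'
      (residue (fun i => map (C : ℂ →+* MvPolynomial (Fin m) ℂ) (f i))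
        (sumAlgEquiv ℂ (Fin n) (Fin m) p)) (a + ∑ i, w i - ∑ i, e i) := by
  rw [residue_eq_eval (D.map C), ResidueData.eval]
  have h1 : (D.map (C : ℂ →+* MvPolynomial (Fin m) ℂ)).C.det =
      sumAlgEquiv ℂ (Fin n) (Fin m) (rename Sum.inl D.C.det) := by
    have h2 := DFunLike.congr_fun (sumAlgEquiv_comp_rename_inl (R := ℂ) (S₁ := Fin n)
      (S₂ := Fin m)) D.C.det
    refine Eq.trans ?_ h2.symm
    exact (RingHom.map_det (map (C : ℂ →+* MvPolynomial (Fin m) ℂ)) D.C).symm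
  rw [h1, ← map_mul]
  refine (IsWeightedHomogeneous.coeff_sumAlgEquiv
    ((hD.det.rename_weight (w' := Sum.elim w w') (fun i => rfl)).mul hp)
    (D.map C).ν).weight_congr ?_
  simp only [ResidueData.map]
  ring

lemma IsPotential.exists_data {V : MvPolynomial (Fin n) ℂ} (hV : IsPotential w V) :
    ∃ D : ResidueData (fun i => pderiv i V), D.IsHomogeneous w (fun i => 2 - w i) :=
  exists_homogeneous_data hV.weight_pos (fun j => hV.homogeneous.pderiv_sub j) hV.finite_jac

lemma constantCoeff_pderiv_of_mem {V : MvPolynomial (Fin n) ℂ}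
    (hV : V ∈ idealOfVars (Fin n) ℂ ^ 2) (i : Fin n) : constantCoeff (pderiv i V) = 0 := by
  rw [constantCoeff_eq, coeff_pderiv, (mem_pow_idealOfVars_iff' 2 V).mp hV, zero_mul]
  simp

end Data

/-! ### Graded polynomial automorphisms -/

section Automorphism

variable {m : ℕ} {w w' : Fin m → ℚ}

/-- The automorphism `φ` is graded from the weights `w` to the weights `w'`: each `φ(yⱼ)` has
weight `wⱼ` with respect to `w'`. For `w = w'` this is `IsWeightPreserving`. -/
def IsGradedAut (w w' : Fin m → ℚ)
    (φ : MvPolynomial (Fin m) ℂ ≃ₐ[ℂ] MvPolynomial (Fin m) ℂ) : Prop :=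
  ∀ j, IsWeightedHomogeneous w' (φ (X j)) (w j)

/-- The Jacobian matrix of an automorphism, with `∂ φ(yₖ) / ∂ yⱼ` in row `j` and column `k`. -/
def jacobian (φ : MvPolynomial (Fin m) ℂ ≃ₐ[ℂ] MvPolynomial (Fin m) ℂ) :
    Matrix (Fin m) (Fin m) (MvPolynomial (Fin m) ℂ) :=
  Matrix.of fun j k => pderiv j (φ (X k))

variable {φ : MvPolynomial (Fin m) ℂ ≃ₐ[ℂ] MvPolynomial (Fin m) ℂ}

lemma aut_apply (φ : MvPolynomial (Fin m) ℂ ≃ₐ[ℂ] MvPolynomial (Fin m) ℂ)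
    (p : MvPolynomial (Fin m) ℂ) : φ p = aeval (fun j => φ (X j)) p :=
  DFunLike.congr_fun (aeval_unique φ.toAlgHom) p

lemma aut_C (φ : MvPolynomial (Fin m) ℂ ≃ₐ[ℂ] MvPolynomial (Fin m) ℂ) (r : ℂ) :
    φ (C r) = C r := φ.commutes r

lemma IsGradedAut.apply (hφ : IsGradedAut w w' φ) {p : MvPolynomial (Fin m) ℂ} {e : ℚ}
    (hp : IsWeightedHomogeneous w p e) : IsWeightedHomogeneous w' (φ p) e := by
  rw [aut_apply]
  exact hp.aeval_weight hφ

lemma IsGradedAut.component (hφ : IsGradedAut w w' φ) (p : MvPolynomial (Fin m) ℂ) (e : ℚ) :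
    weightedHomogeneousComponent w' e (φ p) = φ (weightedHomogeneousComponent w e p) := by
  have hfin := weightedHomogeneousComponent_finsupp (w := w) p
  conv_lhs => rw [← sum_weightedHomogeneousComponent w p, finsum_eq_sum _ hfin, map_sum, map_sum]
  rw [Finset.sum_eq_single e]
  · exact (hφ.apply
      (weightedHomogeneousComponent_isWeightedHomogeneous _ _)).weightedHomogeneousComponent_same
  · intro b _ hb
    exact (hφ.apply
      (weightedHomogeneousComponent_isWeightedHomogeneous b p)).weightedHomogeneousComponent_ne
      e hb.symm
  · intro he
    have he' : weightedHomogeneousComponent w e p = 0 := by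
      by_contra h
      exact he (hfin.mem_toFinset.mpr h)
    rw [he', map_zero, map_zero]

lemma IsGradedAut.symm (hφ : IsGradedAut w w' φ) : IsGradedAut w' w φ.symm := by
  intro j
  have h1 := hφ.component (φ.symm (X j)) (w' j)
  rw [AlgEquiv.apply_symm_apply,
    (isWeightedHomogeneous_X ℂ w' j).weightedHomogeneousComponent_same] at h1
  rw [h1, AlgEquiv.symm_apply_apply]
  exact weightedHomogeneousComponent_isWeightedHomogeneous _ _

lemma IsGradedAut.constantCoeff_X (hφ : IsGradedAut w w' φ) (hw : ∀ i, 0 < w i) (j : Fin m) :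
    constantCoeff (φ (X j)) = 0 :=
  (hφ j).constantCoeff_eq_zero (hw j).ne'

lemma IsGradedAut.constantCoeff_apply (hφ : IsGradedAut w w' φ) (hw : ∀ i, 0 < w i)
    (p : MvPolynomial (Fin m) ℂ) : constantCoeff (φ p) = constantCoeff p := by
  refine DFunLike.congr_fun (f := (constantCoeff : MvPolynomial (Fin m) ℂ →+* ℂ).comp
    (φ : MvPolynomial (Fin m) ℂ →+* MvPolynomial (Fin m) ℂ)) (g := constantCoeff) ?_ p
  refine MvPolynomial.ringHom_ext (fun r => ?_) fun i => ?_
  · simp [aut_C]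
  · simpa using hφ.constantCoeff_X hw i

/-- The chain rule. -/
lemma pderiv_aut (φ : MvPolynomial (Fin m) ℂ ≃ₐ[ℂ] MvPolynomial (Fin m) ℂ) (j : Fin m)
    (p : MvPolynomial (Fin m) ℂ) :
    pderiv j (φ p) = ∑ k, jacobian φ j k * φ (pderiv k p) := by
  induction p using MvPolynomial.induction_on with
  | C r => simp [aut_C]
  | add p q hp hq => simp only [map_add, hp, hq, mul_add, Finset.sum_add_distrib]
  | mul_X p i hp =>
    classical
    simp only [map_mul, Derivation.leibniz, hp, smul_eq_mul, pderiv_X, map_add, mul_add,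
      Finset.sum_add_distrib]
    rw [Finset.mul_sum]
    congr 1
    · rw [Finset.sum_eq_single i]
      · simp [jacobian]; ring
      · intro b _ hb
        simp [hb.symm]
      · simp
    · exact Finset.sum_congr rfl fun k _ => by ring

lemma jacobian_mul_symm (φ : MvPolynomial (Fin m) ℂ ≃ₐ[ℂ] MvPolynomial (Fin m) ℂ) :
    jacobian φ * (jacobian φ.symm).map φ = 1 := by
  ext1 j k
  have h := pderiv_aut φ j (φ.symm (X k))
  rw [AlgEquiv.apply_symm_apply] at h
  rw [Matrix.mul_apply, Matrix.one_apply]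
  simp only [Matrix.map_apply]
  refine h.symm.trans ?_
  rw [pderiv_X, Pi.single_apply]
  simp [eq_comm]

lemma map_constantCoeff_jacobian (φ : MvPolynomial (Fin m) ℂ ≃ₐ[ℂ] MvPolynomial (Fin m) ℂ) :
    (jacobian φ).map constantCoeff = (linearPart φ).transpose := by
  ext j k
  simp [jacobian, linearPart, constantCoeff_eq, coeff_pderiv]

lemma jacobian_det_mul_symm (φ : MvPolynomial (Fin m) ℂ ≃ₐ[ℂ] MvPolynomial (Fin m) ℂ) :
    (jacobian φ).det * φ (jacobian φ.symm).det = 1 := by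
  have h := congrArg Matrix.det (jacobian_mul_symm φ)
  rw [Matrix.det_mul, Matrix.det_one] at h
  rw [← h]
  congr 1
  exact RingHom.map_det (φ : MvPolynomial (Fin m) ℂ →+* MvPolynomial (Fin m) ℂ) _

/-- The Jacobian determinant of an automorphism is a constant, as it is invertible. -/
lemma jacobian_det (φ : MvPolynomial (Fin m) ℂ ≃ₐ[ℂ] MvPolynomial (Fin m) ℂ) :
    (jacobian φ).det = C (linearPart φ).det := by
  have h1 : IsUnit (jacobian φ).det := IsUnit.of_mul_eq_one _ (jacobian_det_mul_symm φ)
  obtain ⟨r, _, hr⟩ := isUnit_iff_eq_C_of_isReduced.mp h1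
  have h2 : constantCoeff (jacobian φ).det = (linearPart φ).det := by
    rw [RingHom.map_det, RingHom.mapMatrix_apply, map_constantCoeff_jacobian,
      Matrix.det_transpose]
  rw [← h2, hr, constantCoeff_C]

lemma linearPart_det_mul_symm (φ : MvPolynomial (Fin m) ℂ ≃ₐ[ℂ] MvPolynomial (Fin m) ℂ) :
    (linearPart φ).det * (linearPart φ.symm).det = 1 := by
  have h := jacobian_det_mul_symm φ
  rw [jacobian_det, jacobian_det, aut_C, ← C_mul, ← C_1] at h
  exact C_injective _ _ h

lemma linearPart_det_ne_zero (φ : MvPolynomial (Fin m) ℂ ≃ₐ[ℂ] MvPolynomial (Fin m) ℂ) :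
    (linearPart φ).det ≠ 0 := left_ne_zero_of_mul_eq_one (linearPart_det_mul_symm φ)

lemma linearPart_symm_det (φ : MvPolynomial (Fin m) ℂ ≃ₐ[ℂ] MvPolynomial (Fin m) ℂ) :
    (linearPart φ.symm).det = (linearPart φ).det⁻¹ :=
  eq_inv_of_mul_eq_one_right (linearPart_det_mul_symm φ)

lemma mem_idealOfVars_iff {p : MvPolynomial (Fin m) ℂ} :
    p ∈ idealOfVars (Fin m) ℂ ↔ constantCoeff p = 0 := by
  rw [← pow_one (idealOfVars (Fin m) ℂ), mem_pow_idealOfVars_iff', constantCoeff_eq]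
  constructor
  · intro h
    exact h 0 (by simp)
  · intro h x hx
    have : x = 0 := (Finsupp.degree_eq_zero_iff x).mp (by simpa using hx)
    rw [this, h]

lemma IsGradedAut.map_mem_pow (hφ : IsGradedAut w w' φ) (hw : ∀ i, 0 < w i) {k : ℕ}
    {p : MvPolynomial (Fin m) ℂ} (hp : p ∈ idealOfVars (Fin m) ℂ ^ k) :
    φ p ∈ idealOfVars (Fin m) ℂ ^ k := by
  have h1 := Ideal.mem_map_of_mem (φ : MvPolynomial (Fin m) ℂ →+* MvPolynomial (Fin m) ℂ) hp
  rw [Ideal.map_pow] at h1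
  refine Ideal.pow_right_mono ?_ k h1
  rw [Ideal.map_le_iff_le_comap]
  intro q hq
  rw [mem_idealOfVars_iff] at hq
  rw [Ideal.mem_comap, mem_idealOfVars_iff]
  exact (hφ.constantCoeff_apply hw q).trans hq

lemma IsPotential.map (hφ : IsGradedAut w w' φ) (hw' : ∀ i, 0 < w' i)
    {V : MvPolynomial (Fin m) ℂ} (hV : IsPotential w V) : IsPotential w' (φ V) where
  weight_pos := hw'
  homogeneous := hφ.apply hV.homogeneous
  mem_sq := hφ.map_mem_pow hV.weight_pos hV.mem_sq
  finite_jac := by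
    have := hV.finite_jac
    set I := Ideal.span (Set.range fun i => pderiv i V)
    set I' := Ideal.span (Set.range fun i => pderiv i (φ V))
    have hle : I ≤ I'.comap (φ.toAlgHom) := by
      rw [Ideal.span_le]
      rintro _ ⟨k, rfl⟩
      have h1 : φ (pderiv k V) = ∑ j, ((jacobian φ.symm).map φ) k j * pderiv j (φ V) := by
        have h2 := mul_eq_one_comm.mp (jacobian_mul_symm φ)
        have h3 : (fun j => pderiv j (φ V)) =
            (jacobian φ).mulVec (fun k => φ (pderiv k V)) := by
          ext1 j
          exact pderiv_aut φ j V
        change _ = (((jacobian φ.symm).map φ).mulVec (fun j => pderiv j (φ V))) k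
        rw [h3, Matrix.mulVec_mulVec, h2, Matrix.one_mulVec]
      change φ (pderiv k V) ∈ I'
      rw [h1]
      exact I'.sum_mem fun j _ => I'.mul_mem_left _ (Ideal.subset_span ⟨j, rfl⟩)
    refine Module.Finite.of_surjective (Ideal.quotientMapₐ I' φ.toAlgHom hle).toLinearMap ?_
    exact Ideal.quotientMap_surjective (H := hle) φ.surjective

/-! ### Residues under graded automorphisms -/

lemma exists_residueData_of_mem_radical {f : Fin m → MvPolynomial (Fin m) ℂ}
    (h : ∀ i, X i ∈ (Ideal.span (Set.range f)).radical) : Nonempty (ResidueData f) := by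
  choose k hk using h
  have h2 : ∀ i, ∃ c : Fin m → MvPolynomial (Fin m) ℂ, ∑ j, c j * f j = X i ^ (k i + 1) := by
    intro i
    rw [pow_succ']
    exact Ideal.mem_span_range_iff_exists_fun.mp (Ideal.mul_mem_left _ _ (hk i))
  choose c hc using h2
  exact ⟨⟨Finsupp.equivFunOnFinite.symm k, Matrix.of c, fun i => (hc i).symm⟩⟩

/-- The coordinates are combinations of the new coordinates `φ(yⱼ)`, with a matrix inverse to the
linear part of `φ` at the origin. -/
lemma IsGradedAut.exists_matrix (hφ : IsGradedAut w w' φ) (hw : ∀ i, 0 < w i)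
    (hw' : ∀ i, 0 < w' i) :
    ∃ N : Matrix (Fin m) (Fin m) (MvPolynomial (Fin m) ℂ),
      (∀ i, X i = ∑ j, N i j * φ (X j)) ∧ constantCoeff N.det = (linearPart φ).det⁻¹ := by
  have h1 : ∀ i, ∃ c : Fin m → MvPolynomial (Fin m) ℂ, ∑ j, c j * X j = φ.symm (X i) := by
    intro i
    have h2 : φ.symm (X i) ∈ idealOfVars (Fin m) ℂ :=
      mem_idealOfVars_iff.mpr (hφ.symm.constantCoeff_X hw' i)
    exact Ideal.mem_span_range_iff_exists_fun.mp h2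
  choose c hc using h1
  have hN : ∀ i, X i = ∑ j, φ (c i j) * φ (X j) := by
    intro i
    have := congrArg φ (hc i)
    rw [AlgEquiv.apply_symm_apply] at this
    rw [← this, map_sum]
    simp
  refine ⟨Matrix.of fun i j => φ (c i j), hN, ?_⟩
  apply eq_inv_of_mul_eq_one_left
  rw [RingHom.map_det, ← Matrix.det_mul]
  convert Matrix.det_one (n := Fin m) (R := ℂ)
  ext i k
  have h3 := congrArg (fun p => constantCoeff (pderiv k p)) (hN i)
  simp only [map_sum, Derivation.leibniz, smul_eq_mul, map_add, map_mul,
    hφ.constantCoeff_X hw, zero_mul, add_zero, pderiv_X] at h3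
  rw [Matrix.mul_apply, Matrix.one_apply]
  have h4 : ∀ j, constantCoeff (pderiv k (φ (X j))) = linearPart φ j k := fun j =>
    congrFun (congrFun (map_constantCoeff_jacobian φ) k) j
  simp only [RingHom.mapMatrix_apply, Matrix.map_apply, Matrix.of_apply]
  simp only [h4] at h3
  rw [← h3, Pi.single_apply]
  split_ifs <;> simp

/-- A homogeneous polynomial of the weight of `z ^ ν` agrees with a multiple of `z ^ ν` modulo the
ideal generated by all `zᵢ ^ (νᵢ + 1)`. -/
lemma sub_monomial_mem (hw : ∀ i, 0 < w i) {ν : Fin m →₀ ℕ} {h : MvPolynomial (Fin m) ℂ}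
    (hh : IsWeightedHomogeneous w h (Finsupp.weight w ν)) :
    h - monomial ν (coeff ν h) ∈
      Ideal.span (Set.range fun i => (X i : MvPolynomial (Fin m) ℂ) ^ (ν i + 1)) := by
  classical
  have h1 : h - monomial ν (coeff ν h) = ∑ d ∈ h.support.erase ν, monomial d (coeff d h) := by
    by_cases hν : ν ∈ h.support
    · rw [sub_eq_iff_eq_add', Finset.add_sum_erase _ (fun d => monomial d (coeff d h)) hν]
      exact h.as_sum
    · rw [Finset.erase_eq_of_notMem hν, ← h.as_sum, notMem_support_iff.mp hν, map_zero, sub_zero]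
  rw [h1]
  refine Ideal.sum_mem _ fun d hd => ?_
  rw [Finset.mem_erase, mem_support_iff] at hd
  have hwt := hh hd.2
  have : ∃ i, ν i < d i := by
    by_contra hcon
    push Not at hcon
    apply hd.1
    rw [Finsupp.weight_apply, Finsupp.weight_apply, Finsupp.sum_fintype _ _ (by simp),
      Finsupp.sum_fintype _ _ (by simp), Finset.sum_eq_sum_iff_of_le
        (fun i _ => nsmul_le_nsmul_left (hw i).le (hcon i))] at hwt
    ext i
    have h2 := hwt i (Finset.mem_univ i)
    rw [nsmul_eq_mul, nsmul_eq_mul] at h2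
    exact_mod_cast mul_right_cancel₀ (hw i).ne' h2
  obtain ⟨i, hi⟩ := this
  have h3 : monomial d (coeff d h) =
      monomial (d - Finsupp.single i (ν i + 1)) (coeff d h) * X i ^ (ν i + 1) := by
    rw [X_pow_eq_monomial, monomial_mul, mul_one, tsub_add_cancel_of_le]
    rw [Finsupp.single_le_iff]
    exact hi
  rw [h3]
  exact Ideal.mul_mem_left _ _ (Ideal.subset_span ⟨i, rfl⟩)

/-- The residue of a form of top weight under a graded change of coordinates. One factor `det A⁻¹`
comes from the change of variables, the other one from the chain rule for the denominators. -/
lemma IsGradedAut.residue_apply (hφ : IsGradedAut w w' φ) (hw' : ∀ i, 0 < w' i)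
    {V : MvPolynomial (Fin m) ℂ} (hV : IsPotential w V) {g : MvPolynomial (Fin m) ℂ}
    (hg : IsWeightedHomogeneous w g (∑ i, (2 - w i) - ∑ i, w i)) :
    residue (fun j => pderiv j (φ V)) (φ g) =
      ((linearPart φ).det⁻¹) ^ 2 * residue (fun j => pderiv j V) g := by
  have hw := hV.weight_pos
  obtain ⟨D, hD⟩ := hV.exists_data
  obtain ⟨D', -⟩ := (hV.map hφ hw').exists_data
  obtain ⟨N, hN, hNdet⟩ := hφ.exists_matrix hw hw'
  set r := residue (fun j => pderiv j V) g with hr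
  have hh := hD.det.mul hg
  rw [show ∀ a b c : ℚ, a + b - c + (c - b) = a by intros; ring] at hh
  have hmem := sub_monomial_mem hw hh
  rw [show coeff D.ν (D.C.det * g) = r by rw [hr, residue_eq_eval D]; rfl] at hmem
  set p : Fin m → MvPolynomial (Fin m) ℂ := fun i => φ (X i) ^ (D.ν i + 1) with hp
  obtain ⟨E⟩ : Nonempty (ResidueData p) := by
    refine exists_residueData_of_mem_radical fun i => ?_
    rw [hN i]
    refine Ideal.sum_mem _ fun j _ => Ideal.mul_mem_left _ _ ⟨D.ν j + 1, ?_⟩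
    exact Ideal.subset_span ⟨j, rfl⟩
  have h1 : residue (fun j => φ (pderiv j V)) (φ g) = residue p (φ (D.C.det * g)) := by
    rw [residue_transform E (D.C.map φ), map_mul]
    · congr 2
      exact (RingHom.map_det (φ : MvPolynomial (Fin m) ℂ →+* MvPolynomial (Fin m) ℂ) _).symm
    · intro i
      have := congrArg φ (D.eq i)
      simpa [hp] using this
  have h2 : residue p (φ (D.C.det * g)) = residue p (φ (monomial D.ν r)) := by
    apply residue_eq_of_sub_mem
    rw [← map_sub]
    have h3 := Ideal.mem_map_of_mem (φ : MvPolynomial (Fin m) ℂ →+* MvPolynomial (Fin m) ℂ) hmem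
    refine (?_ : Ideal.map _ _ ≤ residueAnn p) h3
    rw [Ideal.map_span, Ideal.span_le]
    rintro _ ⟨_, ⟨i, rfl⟩, rfl⟩
    have := mem_residueAnn_self E i
    simpa [hp] using this
  have h4 : residue p (φ (monomial D.ν r)) = r * (linearPart φ).det⁻¹ := by
    have h5 : φ (monomial D.ν r) =
        C r * ((Matrix.diagonal fun i => φ (X i) ^ D.ν i).det * 1) := by
      rw [Matrix.det_diagonal, monomial_eq, Finsupp.prod_fintype _ _ (fun i => pow_zero _),
        map_mul, aut_C, map_prod]
      simp
    rw [h5, residue_C_mul, ← residue_transform (f := fun i => φ (X i)) E,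
      residue_of_X_eq N hN, hNdet]
    · simp
    · intro i
      simp [hp, Matrix.diagonal_apply, pow_succ]
  have h6 := residue_transform (f := fun j => φ (pderiv j V)) D' (jacobian φ)
    (fun j => pderiv_aut φ j V) (φ g)
  rw [jacobian_det, residue_C_mul, h1, h2, h4] at h6
  have h7 := linearPart_det_ne_zero φ
  field_simp
  field_simp at h6
  rw [h6]
  ring

end Automorphism

/-! ### Alternating supertraces -/

section Alternating

variable {S A : Type*} [CommRing S] [Ring A] [Algebra S A] {m : ℕ}

/-- A functional on products of `m` linear combinations of elements `d₁, …, dₘ` which vanishes as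
soon as two neighbouring factors are replaced by their anticommutator is a multiple of the
determinant. -/
lemma apply_prod_eq_det_mul (h2 : IsUnit (2 : S)) (τ : A →ₗ[S] S) (d : Fin m → A)
    (H : ∀ (l₁ l₂ : List (Fin m → S)) (u v : Fin m → S), l₁.length + l₂.length + 2 = m →
      τ ((l₁.map (Fintype.linearCombination S d)).prod *
        (Fintype.linearCombination S d u * Fintype.linearCombination S d v +
          Fintype.linearCombination S d v * Fintype.linearCombination S d u) *
        (l₂.map (Fintype.linearCombination S d)).prod) = 0)
    (M : Matrix (Fin m) (Fin m) S) :
    τ (List.ofFn fun j => ∑ k, M j k • d k).prod = M.det * τ (List.ofFn d).prod := by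
  set E := Fintype.linearCombination S d with hE
  have hrep : ∀ (u : Fin m → S) (l₂ l₁ l₃ : List (Fin m → S)),
      l₁.length + l₂.length + l₃.length + 2 = m →
      τ ((l₁.map E).prod * (E u * ((l₂.map E).prod * (E u * (l₃.map E).prod)))) = 0 := by
    intro u l₂
    induction l₂ with
    | nil =>
      intro l₁ l₃ hl
      have h := H l₁ l₃ u u (by simpa using hl)
      rw [← two_smul S (E u * E u), mul_smul_comm, smul_mul_assoc, map_smul, smul_eq_mul,
        h2.mul_right_eq_zero] at h
      rw [← h]
      simp [mul_assoc]
    | cons v l₂ ih =>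
      intro l₁ l₃ hl
      have h := H l₁ (l₂ ++ u :: l₃) u v (by simp at hl ⊢; omega)
      have h' := ih (l₁ ++ [v]) l₃ (by simp at hl ⊢; omega)
      simp only [List.map_append, List.map_cons, List.prod_append, List.prod_cons, mul_add,
        add_mul, map_add, List.map_nil, List.prod_nil, mul_one, mul_assoc] at h h' ⊢
      rwa [h', add_zero] at h
  have hsplit : ∀ l : List (Fin m → S), ¬ l.Nodup →
      ∃ l₁ u l₂ l₃, l = l₁ ++ u :: (l₂ ++ u :: l₃) := by
    intro l
    induction l with
    | nil => simp
    | cons a l ih =>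
      intro hl
      by_cases ha : a ∈ l
      · obtain ⟨s, t, rfl⟩ := List.append_of_mem ha
        exact ⟨[], a, s, t, rfl⟩
      · obtain ⟨l₁, u, l₂, l₃, rfl⟩ := ih fun h => hl (List.nodup_cons.mpr ⟨ha, h⟩)
        exact ⟨a :: l₁, u, l₂, l₃, rfl⟩
  let f : (Fin m → S) [⋀^Fin m]→ₗ[S] S :=
    { τ.compMultilinearMap
        ((MultilinearMap.mkPiAlgebraFin S m A).compLinearMap fun _ => E) with
      map_eq_zero_of_eq' := by
        intro v i j hv hij
        change τ (MultilinearMap.mkPiAlgebraFin S m A fun i => E (v i)) = 0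
        rw [MultilinearMap.mkPiAlgebraFin_apply]
        have h1 : ¬ (List.ofFn v).Nodup := fun h => hij (List.nodup_ofFn.mp h hv)
        obtain ⟨l₁, u, l₂, l₃, hl⟩ := hsplit _ h1
        have h3 := congrArg List.length hl
        simp only [List.length_ofFn, List.length_append, List.length_cons] at h3
        rw [show (List.ofFn fun i => E (v i)) = (List.ofFn v).map E by
          rw [List.map_ofFn]; rfl, hl]
        have := hrep u l₂ l₁ l₃ (by omega)
        simpa using this }
  have hf : ∀ v, f v = τ (List.ofFn fun i => E (v i)).prod := fun v => by
    change τ (MultilinearMap.mkPiAlgebraFin S m A fun i => E (v i)) = _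
    rw [MultilinearMap.mkPiAlgebraFin_apply]
  have h1 : f (Matrix.of.symm M) =
      f (Pi.basisFun S (Fin m)) * (Pi.basisFun S (Fin m)).det (Matrix.of.symm M) :=
    DFunLike.congr_fun (f.eq_smul_basis_det (Pi.basisFun S (Fin m))) (Matrix.of.symm M)
  rw [hf, hf, mul_comm, Pi.basisFun_det_apply] at h1
  simpa [hE, Fintype.linearCombination_apply] using h1

/-- If a functional vanishes on all words in the `dₖ` of length `r`, it vanishes on all products
of `r` linear combinations of them. -/
lemma apply_prod_eq_zero (τ : A →ₗ[S] S) (d : Fin m → A) (r : ℕ)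
    (H : ∀ l : List (Fin m), l.length = r → τ (l.map d).prod = 0)
    (L : List (Fin m → S)) (hL : L.length = r) :
    τ (L.map (Fintype.linearCombination S d)).prod = 0 := by
  suffices h : ∀ (L : List (Fin m → S)) (l : List (Fin m)), l.length + L.length = r →
      τ ((l.map d).prod * (L.map (Fintype.linearCombination S d)).prod) = 0 by
    simpa using h L [] (by simpa using hL)
  intro L
  induction L with
  | nil =>
    intro l hl
    simpa using H l (by simpa using hl)
  | cons v L ih =>
    intro l hl
    rw [List.map_cons, List.prod_cons, Fintype.linearCombination_apply, Finset.sum_mul,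
      Finset.mul_sum, map_sum]
    refine Finset.sum_eq_zero fun k _ => ?_
    have h := ih (l ++ [k]) (by simp at hl ⊢; omega)
    rw [smul_mul_assoc, mul_smul_comm, map_smul]
    simp only [List.map_append, List.map_cons, List.map_nil, List.prod_append, List.prod_cons,
      List.prod_nil, mul_one, mul_assoc] at h
    rw [h, smul_zero]

lemma mul_prod_of_anticomm (q : A) (l : List A) (h : ∀ a ∈ l, q * a = -(a * q)) :
    q * l.prod = (-1) ^ l.length * (l.prod * q) := by
  induction l with
  | nil => simp
  | cons a l ih =>
    have h1 := ih fun b hb => h b (List.mem_cons_of_mem _ hb)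
    rw [List.prod_cons, ← mul_assoc, h a List.mem_cons_self, neg_mul, mul_assoc, h1,
      List.length_cons, pow_succ]
    rcases neg_one_pow_eq_or A l.length with h2 | h2 <;> simp [h2, mul_assoc]

end Alternating

section Supertrace

open Matrix

variable {S T : Type*} [CommRing S] [Fintype T] [DecidableEq T] {m : ℕ}

lemma trace_odd_prod (h2 : IsUnit (2 : S)) (σ : Matrix T T S) (l : List (Matrix T T S))
    (hl : ∀ a ∈ l, σ * a = -(a * σ)) (hodd : Odd l.length) : (σ * l.prod).trace = 0 := by
  have h := congrArg trace (mul_prod_of_anticomm σ l hl)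
  rw [hodd.neg_one_pow, neg_one_mul, trace_neg, trace_mul_comm l.prod σ,
    eq_neg_iff_add_eq_zero, ← two_mul, h2.mul_right_eq_zero] at h
  exact h

/-- The supertrace of an expression containing a graded commutator with an odd element `q` vanishes
if all other factors graded-commute with `q`. -/
lemma trace_anticomm_eq_zero (h2 : IsUnit (2 : S)) (σ q B : Matrix T T S)
    (l₁ l₂ : List (Matrix T T S)) (hq : σ * q = -(q * σ)) (hB : σ * B = -(B * σ))
    (h₁ : ∀ a ∈ l₁, σ * a = -(a * σ)) (h₂ : ∀ a ∈ l₂, σ * a = -(a * σ))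
    (hq₁ : ∀ a ∈ l₁, q * a = -(a * q)) (hq₂ : ∀ a ∈ l₂, q * a = -(a * q)) :
    (σ * (l₁.prod * (q * B + B * q) * l₂.prod)).trace = 0 := by
  rcases Nat.even_or_odd (l₁.length + l₂.length) with he | ho
  · have e1 := mul_prod_of_anticomm q l₁ hq₁
    have e2 := mul_prod_of_anticomm q l₂ hq₂
    have e3 : (-1 : Matrix T T S) ^ l₁.length = (-1) ^ l₂.length := by
      rcases Nat.even_or_odd l₂.length with h | h
      · rw [h.neg_one_pow, ((Nat.even_add.mp he).mpr h).neg_one_pow]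
      · have h' : Odd l₁.length := by
          rw [← Nat.not_even_iff_odd] at h ⊢
          exact fun hcon => h ((Nat.even_add.mp he).mp hcon)
        rw [h.neg_one_pow, h'.neg_one_pow]
    have key : (σ * (l₁.prod * q * B * l₂.prod)).trace =
        -(σ * (l₁.prod * B * q * l₂.prod)).trace := by
      rw [e3] at e1
      rcases neg_one_pow_eq_or (Matrix T T S) l₂.length with h | h <;> rw [h] at e1 e2
      · rw [one_mul] at e1 e2
        rw [mul_assoc (l₁.prod * B), e2, ← e1]
        calc (σ * (q * l₁.prod * B * l₂.prod)).trace
            = (σ * q * (l₁.prod * B * l₂.prod)).trace := by simp only [mul_assoc]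
          _ = -(q * (σ * (l₁.prod * B * l₂.prod))).trace := by
              rw [hq, neg_mul, trace_neg, mul_assoc]
          _ = _ := by rw [trace_mul_comm]; simp only [mul_assoc]
      · rw [neg_one_mul] at e1 e2
        rw [mul_assoc (l₁.prod * B), e2, ← neg_eq_iff_eq_neg.mpr e1]
        calc (σ * (-(q * l₁.prod) * B * l₂.prod)).trace
            = -(σ * q * (l₁.prod * B * l₂.prod)).trace := by
              simp only [mul_assoc, neg_mul, mul_neg, trace_neg]
          _ = (q * (σ * (l₁.prod * B * l₂.prod))).trace := by
              rw [hq, neg_mul, trace_neg, mul_assoc, neg_neg]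
          _ = _ := by
              rw [trace_mul_comm]
              simp only [mul_assoc, mul_neg, trace_neg, neg_neg]
    rw [mul_add, add_mul, mul_add, trace_add, ← mul_assoc l₁.prod q B, ← mul_assoc l₁.prod B q, key,
      neg_add_cancel]
  · have hodd : ∀ a b : Matrix T T S, (σ * a = -(a * σ)) → (σ * b = -(b * σ)) →
        (σ * (l₁.prod * (a * b) * l₂.prod)).trace = 0 := by
      intro a b ha hb
      have := trace_odd_prod h2 σ (l₁ ++ a :: b :: l₂) (by
        intro c hc
        simp only [List.mem_append, List.mem_cons] at hc
        rcases hc with hc | rfl | rfl | hc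
        exacts [h₁ c hc, ha, hb, h₂ c hc]) (by
        simp only [List.length_append, List.length_cons]
        rw [show l₁.length + (l₂.length + 1 + 1) = l₁.length + l₂.length + 2 by ring]
        exact ho.add_even even_two)
      simpa [mul_assoc] using this
    rw [mul_add, add_mul, mul_add, trace_add, hodd q B hq hB, hodd B q hB hq, add_zero]

/-- The supertrace of a product whose last `m` factors are linear combinations of `d₁, …, dₘ` is
given by a determinant, if the anticommutators of the `dₖ` are scalars up to graded commutators
with `q`, all factors graded-commute with `q`, and the scalars kill the supertraces of shorter
products. -/
theorem trace_prod_eq_det_mul (h2 : IsUnit (2 : S)) (σ q : Matrix T T S)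
    (l : List (Matrix T T S)) (d : Fin m → Matrix T T S) (B : Fin m → Fin m → Matrix T T S)
    (c : Fin m → Fin m → S) (hq : σ * q = -(q * σ)) (hl : ∀ a ∈ l, σ * a = -(a * σ))
    (hd : ∀ k, σ * d k = -(d k * σ)) (hB : ∀ j k, σ * B j k = -(B j k * σ))
    (hql : ∀ a ∈ l, q * a = -(a * q)) (hqd : ∀ k, q * d k = -(d k * q))
    (hdd : ∀ j k, d j * d k + d k * d j = c j k • 1 - (q * B j k + B j k * q))
    (hc : ∀ (j k : Fin m) (t : List (Fin m)), t.length + 2 = m →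
      c j k * (σ * (l.prod * (t.map d).prod)).trace = 0)
    (M : Matrix (Fin m) (Fin m) S) :
    (σ * (l.prod * (List.ofFn fun j => ∑ k, M j k • d k).prod)).trace =
      M.det * (σ * (l.prod * (List.ofFn d).prod)).trace := by
  let τ : Matrix T T S →ₗ[S] S := traceLinearMap T S S ∘ₗ
    LinearMap.mulLeft S σ ∘ₗ LinearMap.mulLeft S l.prod
  have hτ : ∀ a, τ a = (σ * (l.prod * a)).trace := fun a => rfl
  set E := Fintype.linearCombination S d with hE
  have hEσ : ∀ v, σ * E v = -(E v * σ) := by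
    intro v
    simp only [hE, Fintype.linearCombination_apply, Finset.mul_sum, Finset.sum_mul,
      mul_smul_comm, smul_mul_assoc, hd, smul_neg, Finset.sum_neg_distrib]
  have hEq : ∀ v, q * E v = -(E v * q) := by
    intro v
    simp only [hE, Fintype.linearCombination_apply, Finset.mul_sum, Finset.sum_mul,
      mul_smul_comm, smul_mul_assoc, hqd, smul_neg, Finset.sum_neg_distrib]
  have hmapσ : ∀ L : List (Fin m → S), ∀ a ∈ L.map E, σ * a = -(a * σ) := by
    intro L a ha
    obtain ⟨v, -, rfl⟩ := List.mem_map.mp ha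
    exact hEσ v
  have hmapq : ∀ L : List (Fin m → S), ∀ a ∈ L.map E, q * a = -(a * q) := by
    intro L a ha
    obtain ⟨v, -, rfl⟩ := List.mem_map.mp ha
    exact hEq v
  rw [← hτ, ← hτ]
  refine apply_prod_eq_det_mul h2 τ d ?_ M
  intro l₁ l₂ u v hlen
  have hanti : E u * E v + E v * E u = ∑ j, ∑ k, (u j * v k) • (c j k • (1 : Matrix T T S))
      - ∑ j, ∑ k, (u j * v k) • (q * B j k + B j k * q) := by
    rw [← Finset.sum_sub_distrib]
    simp only [hE, Fintype.linearCombination_apply, ← Finset.sum_sub_distrib, ← smul_sub, ← hdd]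
    rw [Finset.sum_mul_sum, Finset.sum_mul_sum,
      Finset.sum_comm (s := Finset.univ) (t := Finset.univ)
      (f := fun i j => v i • d i * u j • d j), ← Finset.sum_add_distrib]
    refine Finset.sum_congr rfl fun j _ => ?_
    rw [← Finset.sum_add_distrib]
    refine Finset.sum_congr rfl fun k _ => ?_
    rw [smul_mul_smul_comm, smul_mul_smul_comm, smul_add, mul_comm (v k)]
  rw [hanti, mul_sub, sub_mul, map_sub]
  have z1 : τ ((l₁.map E).prod * (∑ j, ∑ k, (u j * v k) • (c j k • (1 : Matrix T T S))) *
      (l₂.map E).prod) = 0 := by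
    simp only [Finset.mul_sum, Finset.sum_mul, map_sum, mul_smul_comm, smul_mul_assoc, map_smul,
      mul_one]
    refine Finset.sum_eq_zero fun j _ => Finset.sum_eq_zero fun k _ => ?_
    have h := apply_prod_eq_zero (c j k • τ) d (m - 2) (fun t ht => hc j k t (by omega))
      (l₁ ++ l₂) (by rw [List.length_append]; omega)
    rw [List.map_append, List.prod_append, LinearMap.smul_apply] at h
    rw [h, smul_zero]
  have z2 : τ ((l₁.map E).prod * (∑ j, ∑ k, (u j * v k) • (q * B j k + B j k * q)) *
      (l₂.map E).prod) = 0 := by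
    simp only [Finset.mul_sum, Finset.sum_mul, map_sum, mul_smul_comm, smul_mul_assoc, map_smul]
    refine Finset.sum_eq_zero fun j _ => Finset.sum_eq_zero fun k _ => ?_
    have h := trace_anticomm_eq_zero h2 σ q (B j k) (l ++ l₁.map E) (l₂.map E) hq (hB j k)
      (by
        intro a ha
        rcases List.mem_append.mp ha with ha | ha
        exacts [hl a ha, hmapσ _ a ha])
      (hmapσ _)
      (by
        intro a ha
        rcases List.mem_append.mp ha with ha | ha
        exacts [hql a ha, hmapq _ a ha])
      (hmapq _)
    rw [hτ, ← mul_assoc l.prod, ← mul_assoc l.prod, ← List.prod_append, h, smul_zero]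
  rw [z1, z2, sub_zero]

end Supertrace

/-! ### Supertraces modulo the residue ideal -/

section ModResidue

open Matrix

variable {T : Type*} [Fintype T] [DecidableEq T] {m n : ℕ}

lemma map_trace_eq {R S : Type*} [CommRing R] [CommRing S] (π : R →+* S) (A : Matrix T T R) :
    π A.trace = (π.mapMatrix A).trace := by
  simp [Matrix.trace]

lemma map_anticomm {R S : Type*} [CommRing R] [CommRing S] (π : R →+* S) {a b : Matrix T T R}
    (h : a * b = -(b * a)) :
    π.mapMatrix a * π.mapMatrix b = -(π.mapMatrix b * π.mapMatrix a) := by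
  rw [← map_mul, h, map_neg, map_mul]

lemma map_anticomm_of_add {R S : Type*} [CommRing R] [CommRing S] (π : R →+* S)
    {a b : Matrix T T R} {r : R} (h : a * b + b * a = r • 1) (hr : π r = 0) :
    π.mapMatrix a * π.mapMatrix b = -(π.mapMatrix b * π.mapMatrix a) := by
  rw [eq_neg_iff_add_eq_zero, ← map_mul, ← map_mul, ← map_add, h]
  ext i j
  by_cases hij : i = j <;> simp [hij, hr]

lemma map_trace_prod {R S : Type*} [CommRing R] [CommRing S] (π : R →+* S)
    (σ : Matrix T T R) (l : List (Matrix T T R)) (d : Fin m → Matrix T T R)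
    (M : Matrix (Fin m) (Fin m) R) :
    π (σ * (l.prod * (List.ofFn fun j => ∑ k, M j k • d k).prod)).trace =
      (π.mapMatrix σ * ((l.map π.mapMatrix).prod *
        (List.ofFn fun j => ∑ k, (π.mapMatrix M) j k • π.mapMatrix (d k)).prod)).trace := by
  rw [map_trace_eq, map_mul, map_mul, map_list_prod, map_list_prod, List.map_ofFn]
  congr 6
  ext1 j
  simp only [Function.comp_apply, map_sum]
  refine Finset.sum_congr rfl fun k _ => ?_
  ext
  simp

lemma map_trace_prod' {R S : Type*} [CommRing R] [CommRing S] (π : R →+* S)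
    (σ : Matrix T T R) (l : List (Matrix T T R)) (d : Fin m → Matrix T T R) :
    π (σ * (l.prod * (List.ofFn d).prod)).trace =
      (π.mapMatrix σ * ((l.map π.mapMatrix).prod *
        (List.ofFn fun k => π.mapMatrix (d k)).prod)).trace := by
  rw [map_trace_eq, map_mul, map_mul, map_list_prod, map_list_prod, List.map_ofFn]
  rfl

lemma isUnit_two_quotient (I : Ideal (MvPolynomial (Fin n) ℂ)) :
    IsUnit (2 : MvPolynomial (Fin n) ℂ ⧸ I) := by
  have h := (IsUnit.mk0 (2 : ℂ) two_ne_zero).map (algebraMap ℂ (MvPolynomial (Fin n) ℂ ⧸ I))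
  rwa [show algebraMap ℂ (MvPolynomial (Fin n) ℂ ⧸ I) 2 = 2 from map_ofNat _ 2] at h

/-- Supertraces modulo the residue ideal of `f₁, …, fₘ`, for odd `d₁, …, dₘ` which graded-commute
with `q` up to these functions. A product of `d`s in which `d_c` is missing has a supertrace `u`
with `f_c u` in the ideal of the other `f_a`, so residues kill it. -/
theorem trace_prod_sub_det_mul_mem {f : Fin m → MvPolynomial (Fin m) ℂ} (D : ResidueData f)
    (σ q : Matrix T T (MvPolynomial (Fin m) ℂ)) (l : List (Matrix T T (MvPolynomial (Fin m) ℂ)))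
    (d : Fin m → Matrix T T (MvPolynomial (Fin m) ℂ))
    (B : Fin m → Fin m → Matrix T T (MvPolynomial (Fin m) ℂ))
    (c : Fin m → Fin m → MvPolynomial (Fin m) ℂ)
    (hq : σ * q = -(q * σ)) (hl : ∀ a ∈ l, σ * a = -(a * σ))
    (hd : ∀ k, σ * d k = -(d k * σ)) (hB : ∀ j k, σ * B j k = -(B j k * σ))
    (hql : ∀ a ∈ l, q * a = -(a * q)) (hqd : ∀ k, q * d k + d k * q = (-f k) • 1)
    (hdd : ∀ j k, d j * d k + d k * d j = c j k • 1 - (q * B j k + B j k * q))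
    (M : Matrix (Fin m) (Fin m) (MvPolynomial (Fin m) ℂ)) :
    (σ * (l.prod * (List.ofFn fun j => ∑ k, M j k • d k).prod)).trace -
      M.det * (σ * (l.prod * (List.ofFn d).prod)).trace ∈ residueAnn f := by
  have hshort : ∀ t : List (Fin m), t.length + 2 = m →
      (σ * (l.prod * (t.map d).prod)).trace ∈ residueAnn f := by
    intro t ht
    obtain ⟨a, ha⟩ : ∃ a, a ∉ t := by
      by_contra hcon
      push Not at hcon
      have h1 : (Finset.univ : Finset (Fin m)) ⊆ t.toFinset := fun a _ =>
        List.mem_toFinset.mpr (hcon a)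
      have h2 := (Finset.card_le_card h1).trans t.toFinset_card_le
      simp at h2
      omega
    refine mem_residueAnn_of_mul_mem D (c := a) ?_
    set K := Ideal.span (f '' {b | b ≠ a}) with hK
    set π := Ideal.Quotient.mk K with hπ
    have h1 := trace_anticomm_eq_zero (isUnit_two_quotient K) (π.mapMatrix σ) (π.mapMatrix q)
      (π.mapMatrix (d a)) [] ((l ++ t.map d).map π.mapMatrix) (map_anticomm π hq)
      (map_anticomm π (hd a)) (by simp)
      (by
        intro b hb
        obtain ⟨b', hb', rfl⟩ := List.mem_map.mp hb
        apply map_anticomm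
        rcases List.mem_append.mp hb' with hb | hb
        · exact hl b' hb
        · obtain ⟨k, -, rfl⟩ := List.mem_map.mp hb
          exact hd k)
      (by simp)
      (by
        intro b hb
        obtain ⟨b', hb', rfl⟩ := List.mem_map.mp hb
        rcases List.mem_append.mp hb' with hb | hb
        · exact map_anticomm π (hql b' hb)
        · obtain ⟨k, hk, rfl⟩ := List.mem_map.mp hb
          refine map_anticomm_of_add π (hqd k) ?_
          rw [map_neg, neg_eq_zero, hπ, Ideal.Quotient.eq_zero_iff_mem]
          exact Ideal.subset_span ⟨k, fun h => ha (h ▸ hk), rfl⟩)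
    rw [← map_mul, ← map_mul, ← map_add, hqd, ← map_list_prod, List.prod_nil, one_mul,
      ← map_mul, ← map_mul, ← map_trace_eq, hπ, Ideal.Quotient.eq_zero_iff_mem,
      smul_mul_assoc, mul_smul_comm, trace_smul, smul_eq_mul, neg_mul, neg_mem_iff, one_mul,
      List.prod_append] at h1
    exact h1
  set π := Ideal.Quotient.mk (residueAnn f) with hπ
  have hzero : ∀ k, π (-f k) = 0 := fun k => by
    rw [map_neg, neg_eq_zero, hπ, Ideal.Quotient.eq_zero_iff_mem]
    exact mem_residueAnn_self D k
  rw [← Ideal.Quotient.eq_zero_iff_mem, map_sub, sub_eq_zero, ← hπ, map_trace_prod, map_mul,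
    map_trace_prod', RingHom.map_det]
  refine trace_prod_eq_det_mul (isUnit_two_quotient _) (π.mapMatrix σ) (π.mapMatrix q) _ _
    (fun j k => π.mapMatrix (B j k)) (fun j k => π (c j k)) (map_anticomm π hq) ?_
    (fun k => map_anticomm π (hd k)) (fun j k => map_anticomm π (hB j k)) ?_
    (fun k => map_anticomm_of_add π (hqd k) (hzero k)) ?_ ?_ _
  · intro a ha
    obtain ⟨b, hb, rfl⟩ := List.mem_map.mp ha
    exact map_anticomm π (hl b hb)
  · intro a ha
    obtain ⟨b, hb, rfl⟩ := List.mem_map.mp ha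
    exact map_anticomm π (hql b hb)
  · intro j k
    rw [← map_mul, ← map_mul, ← map_add, hdd, map_sub, map_add, map_mul, map_mul]
    congr 1
    ext i i'
    by_cases hi : i = i' <;> simp [hi]
  · intro j k t ht
    have h1 := Ideal.Quotient.eq_zero_iff_mem.mpr (hshort t ht)
    rw [← hπ, map_trace_eq, map_mul, map_mul, map_list_prod, map_list_prod, List.map_map] at h1
    refine mul_eq_zero_of_right _ h1

/-- Supertraces modulo the residue ideal of `f₁, …, fₙ`, for odd `d₁, …, dₘ` which graded-commute
with `q` and whose anticommutators are graded commutators with `q`. -/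
theorem trace_prod_sub_det_mul_mem_of_anticomm {f : Fin n → MvPolynomial (Fin n) ℂ}
    (D : ResidueData f)
    (σ q : Matrix T T (MvPolynomial (Fin n) ℂ)) (l : List (Matrix T T (MvPolynomial (Fin n) ℂ)))
    (d : Fin m → Matrix T T (MvPolynomial (Fin n) ℂ))
    (B : Fin m → Fin m → Matrix T T (MvPolynomial (Fin n) ℂ))
    (hq : σ * q = -(q * σ)) (hl : ∀ a ∈ l, σ * a = -(a * σ))
    (hd : ∀ k, σ * d k = -(d k * σ)) (hB : ∀ j k, σ * B j k = -(B j k * σ))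
    (hql : ∀ a ∈ l, ∃ i, q * a + a * q = f i • 1) (hqd : ∀ k, q * d k = -(d k * q))
    (hdd : ∀ j k, d j * d k + d k * d j = - (q * B j k + B j k * q))
    (M : Matrix (Fin m) (Fin m) (MvPolynomial (Fin n) ℂ)) :
    (σ * (l.prod * (List.ofFn fun j => ∑ k, M j k • d k).prod)).trace -
      M.det * (σ * (l.prod * (List.ofFn d).prod)).trace ∈ residueAnn f := by
  set π := Ideal.Quotient.mk (residueAnn f) with hπ
  rw [← Ideal.Quotient.eq_zero_iff_mem, map_sub, sub_eq_zero, ← hπ, map_trace_prod, map_mul,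
    map_trace_prod', RingHom.map_det]
  refine trace_prod_eq_det_mul (isUnit_two_quotient _) (π.mapMatrix σ) (π.mapMatrix q) _ _
    (fun j k => π.mapMatrix (B j k)) (fun _ _ => 0) (map_anticomm π hq) ?_
    (fun k => map_anticomm π (hd k)) (fun j k => map_anticomm π (hB j k)) ?_
    (fun k => map_anticomm π (hqd k)) ?_ ?_ _
  · intro a ha
    obtain ⟨b, hb, rfl⟩ := List.mem_map.mp ha
    exact map_anticomm π (hl b hb)
  · intro a ha
    obtain ⟨b, hb, rfl⟩ := List.mem_map.mp ha
    obtain ⟨i, hi⟩ := hql b hb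
    refine map_anticomm_of_add π hi ?_
    rw [hπ, Ideal.Quotient.eq_zero_iff_mem]
    exact mem_residueAnn_self D i
  · intro j k
    rw [← map_mul, ← map_mul, ← map_add, hdd, map_neg, map_add, map_mul, map_mul,
      sub_eq_add_neg]
    refine (zero_add _).symm.trans (congrArg (· + _) ?_)
    ext i i'
    exact (zero_mul _).symm
  · intro j k t ht
    rw [zero_mul]

end ModResidue

/-! ### Derivatives of matrix factorisations -/

section MatrixFactorisation

variable {n m N : ℕ}

/-- The matrix is block off-diagonal. -/
def IsOddMat (A : MatXY n m N) : Prop := sigma n m N * A = -(A * sigma n m N)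

lemma isOddMat_of_blocks {A : MatXY n m N} (h₁ : A.toBlocks₁₁ = 0) (h₂ : A.toBlocks₂₂ = 0) :
    IsOddMat A := by
  rw [IsOddMat, ← Matrix.fromBlocks_toBlocks A, h₁, h₂, sigma, Matrix.fromBlocks_multiply,
    Matrix.fromBlocks_multiply, Matrix.fromBlocks_neg]
  simp

lemma toBlocks₁₁_matDeriv {A : MatXY n m N} (h : A.toBlocks₁₁ = 0) (i : Fin n ⊕ Fin m) :
    (matDeriv i A).toBlocks₁₁ = 0 := by
  ext1 r s
  have := congrFun (congrFun h r) s
  change pderiv i (A (Sum.inl r) (Sum.inl s)) = 0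
  rw [show A (Sum.inl r) (Sum.inl s) = 0 from this, map_zero]

lemma toBlocks₂₂_matDeriv {A : MatXY n m N} (h : A.toBlocks₂₂ = 0) (i : Fin n ⊕ Fin m) :
    (matDeriv i A).toBlocks₂₂ = 0 := by
  ext1 r s
  have := congrFun (congrFun h r) s
  change pderiv i (A (Sum.inr r) (Sum.inr s)) = 0
  rw [show A (Sum.inr r) (Sum.inr s) = 0 from this, map_zero]

lemma matDeriv_mul (i : Fin n ⊕ Fin m) (A B : MatXY n m N) :
    matDeriv i (A * B) = matDeriv i A * B + A * matDeriv i B := by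
  ext1 r s
  simp only [matDeriv, Matrix.map_apply, Matrix.mul_apply, Matrix.add_apply, map_sum,
    Derivation.leibniz, smul_eq_mul, Finset.sum_add_distrib]
  rw [add_comm]
  congr 1
  exact Finset.sum_congr rfl fun k _ => mul_comm _ _

lemma matDeriv_add (i : Fin n ⊕ Fin m) (A B : MatXY n m N) :
    matDeriv i (A + B) = matDeriv i A + matDeriv i B := by
  ext1 r s
  simp [matDeriv]

lemma matDeriv_smul_one (i : Fin n ⊕ Fin m) (p : PolyXY n m) :
    matDeriv i (p • (1 : MatXY n m N)) = pderiv i p • (1 : MatXY n m N) := by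
  ext1 r s
  by_cases h : r = s <;> simp [matDeriv, h]

lemma anticomm_matDeriv {Q : MatXY n m N} {W : PolyXY n m} (hQ : Q * Q = W • (1 : MatXY n m N))
    (i : Fin n ⊕ Fin m) :
    Q * matDeriv i Q + matDeriv i Q * Q = pderiv i W • (1 : MatXY n m N) := by
  rw [← matDeriv_smul_one, ← hQ, matDeriv_mul, add_comm]

lemma matDeriv_anticomm_matDeriv {Q : MatXY n m N} {W : PolyXY n m}
    (hQ : Q * Q = W • (1 : MatXY n m N)) (i j : Fin n ⊕ Fin m) :
    matDeriv i Q * matDeriv j Q + matDeriv j Q * matDeriv i Q =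
      pderiv i (pderiv j W) • (1 : MatXY n m N) -
        (Q * matDeriv i (matDeriv j Q) + matDeriv i (matDeriv j Q) * Q) := by
  rw [← matDeriv_smul_one, ← anticomm_matDeriv hQ j, matDeriv_add, matDeriv_mul, matDeriv_mul]
  abel

lemma pderiv_inl_rename_inr (i : Fin n) (p : MvPolynomial (Fin m) ℂ) :
    pderiv (Sum.inl i) (rename Sum.inr p : PolyXY n m) = 0 := by
  induction p using MvPolynomial.induction_on with
  | C r => simp
  | add p q hp hq => simp [hp, hq]
  | mul_X p j hp => simp [hp, pderiv_X]

lemma pderiv_inr_rename_inl (j : Fin m) (p : MvPolynomial (Fin n) ℂ) :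
    pderiv (Sum.inr j) (rename Sum.inl p : PolyXY n m) = 0 := by
  induction p using MvPolynomial.induction_on with
  | C r => simp
  | add p q hp hq => simp [hp, hq]
  | mul_X p j hp => simp [hp, pderiv_X]

lemma pderiv_inl_diffPot (V₁ : MvPolynomial (Fin n) ℂ) (V₂ : MvPolynomial (Fin m) ℂ) (i : Fin n) :
    pderiv (Sum.inl i) (diffPot V₁ V₂) = rename Sum.inl (pderiv i V₁) := by
  rw [diffPot, map_sub, pderiv_inl_rename_inr, sub_zero, pderiv_rename Sum.inl_injective]

lemma pderiv_inr_diffPot (V₁ : MvPolynomial (Fin n) ℂ) (V₂ : MvPolynomial (Fin m) ℂ) (j : Fin m) :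
    pderiv (Sum.inr j) (diffPot V₁ V₂) = -rename Sum.inr (pderiv j V₂) := by
  rw [diffPot, map_sub, pderiv_inr_rename_inl, zero_sub, pderiv_rename Sum.inr_injective]

/-- Setting `y = 0`. -/
def evalLeft (n m : ℕ) : PolyXY n m →ₐ[ℂ] MvPolynomial (Fin n) ℂ := aeval (Sum.elim X 0)

/-- Setting `x = 0`. -/
def evalRight (n m : ℕ) : PolyXY n m →ₐ[ℂ] MvPolynomial (Fin m) ℂ := aeval (Sum.elim 0 X)

lemma evalLeft_rename_inl (p : MvPolynomial (Fin n) ℂ) :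
    evalLeft n m (rename Sum.inl p) = p := by
  have : (evalLeft n m).comp (rename Sum.inl) = AlgHom.id ℂ _ := by ext i; simp [evalLeft]
  exact DFunLike.congr_fun this p

lemma evalRight_rename_inr (p : MvPolynomial (Fin m) ℂ) :
    evalRight n m (rename Sum.inr p) = p := by
  have : (evalRight n m).comp (rename Sum.inr) = AlgHom.id ℂ _ := by ext i; simp [evalRight]
  exact DFunLike.congr_fun this p

lemma evalLeft_rename_inr (p : MvPolynomial (Fin m) ℂ) :
    evalLeft n m (rename Sum.inr p) = C (constantCoeff p) := by
  induction p using MvPolynomial.induction_on with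
  | C r => simp
  | add p q hp hq => simp [hp, hq]
  | mul_X p j hp => simp [evalLeft]

lemma evalRight_rename_inl (p : MvPolynomial (Fin n) ℂ) :
    evalRight n m (rename Sum.inl p) = C (constantCoeff p) := by
  induction p using MvPolynomial.induction_on with
  | C r => simp
  | add p q hp hq => simp [hp, hq]
  | mul_X p j hp => simp [evalRight]

lemma map_constantCoeff_sumAlgEquiv (p : PolyXY n m) :
    map constantCoeff (sumAlgEquiv ℂ (Fin n) (Fin m) p) = evalLeft n m p := by
  induction p using MvPolynomial.induction_on with
  | C r => simp
  | add p q hp hq => simp only [map_add, hp, hq]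
  | mul_X p j hp => rcases j with j | j <;> simp [hp, evalLeft]

lemma evalLeft_rename_swap (p : PolyXY n m) :
    evalLeft m n (rename Sum.swap p) = evalRight n m p := by
  rw [evalLeft, evalRight, aeval_rename]
  congr 2
  ext1 (i | i) <;> rfl

lemma map_constantCoeff_residue {k l : ℕ} {w : Fin k → ℚ} {V : MvPolynomial (Fin k) ℂ}
    (hV : IsPotential w V) (p : PolyXY k l) :
    constantCoeff (residue (fun i => map (C : ℂ →+* MvPolynomial (Fin l) ℂ) (pderiv i V))
      (sumAlgEquiv ℂ (Fin k) (Fin l) p)) = residue (fun i => pderiv i V) (evalLeft k l p) := by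
  obtain ⟨D, -⟩ := hV.exists_data
  rw [(D.map (C : ℂ →+* MvPolynomial (Fin l) ℂ)).map_residue, map_constantCoeff_sumAlgEquiv]
  congr 1
  ext1 i
  rw [map_map]
  convert map_id _
  ext; simp

lemma constantCoeff_qL {wx : Fin n → ℚ} {V₁ : MvPolynomial (Fin n) ℂ} (hV : IsPotential wx V₁)
    (Q : MatXY n m N) : constantCoeff (qL V₁ Q) =
      (-1) ^ (m + 1).choose 2 * residue (fun i => pderiv i V₁) (evalLeft n m (strDeriv Q)) := by
  rw [qL, map_mul, map_constantCoeff_residue hV, map_pow, map_neg, map_one]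

lemma constantCoeff_qR {wy : Fin m → ℚ} {V₂ : MvPolynomial (Fin m) ℂ} (hV : IsPotential wy V₂)
    (Q : MatXY n m N) : constantCoeff (qR V₂ Q) =
      (-1) ^ (n + 1).choose 2 * residue (fun j => pderiv j V₂) (evalRight n m (strDeriv Q)) := by
  rw [qR, map_mul, map_constantCoeff_residue hV, map_pow, map_neg, map_one, evalLeft_rename_swap]

/-! ### Weights of the quantum dimensions -/

/-- The entries of `A` have the weights `gₛ - gᵣ + e`. -/
def IsGradedMat {τ T : Type*} (w : τ → ℚ) (g : T → ℚ) (e : ℚ)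
    (A : Matrix T T (MvPolynomial τ ℂ)) : Prop :=
  ∀ r s, IsWeightedHomogeneous w (A r s) (g s - g r + e)

lemma IsGradedMat.mul {τ T : Type*} [Fintype T] {w : τ → ℚ} {g : T → ℚ} {a b : ℚ}
    {A B : Matrix T T (MvPolynomial τ ℂ)} (hA : IsGradedMat w g a A) (hB : IsGradedMat w g b B) :
    IsGradedMat w g (a + b) (A * B) := by
  intro r s
  rw [Matrix.mul_apply]
  refine IsWeightedHomogeneous.sum _ _ _ fun k _ => ?_
  refine ((hA r k).mul (hB k s)).weight_congr ?_
  ring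

lemma isGradedMat_one {τ T : Type*} [DecidableEq T] {w : τ → ℚ} {g : T → ℚ} :
    IsGradedMat w g 0 (1 : Matrix T T (MvPolynomial τ ℂ)) := by
  intro r s
  rw [Matrix.one_apply]
  split_ifs with h
  · subst h
    refine (isWeightedHomogeneous_one ℂ w).weight_congr ?_
    ring
  · exact isWeightedHomogeneous_zero _ _ _

lemma IsGradedMat.prod_ofFn {τ T : Type*} [Fintype T] [DecidableEq T] {w : τ → ℚ} {g : T → ℚ}
    {k : ℕ} {a : Fin k → ℚ} {A : Fin k → Matrix T T (MvPolynomial τ ℂ)}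
    (hA : ∀ i, IsGradedMat w g (a i) (A i)) :
    IsGradedMat w g (∑ i, a i) (List.ofFn A).prod := by
  induction k with
  | zero => simpa using isGradedMat_one
  | succ k ih =>
    rw [List.ofFn_succ, List.prod_cons, Fin.sum_univ_succ]
    exact (hA 0).mul (ih fun i => hA i.succ)

lemma IsGradedMat.matDeriv {wx : Fin n → ℚ} {wy : Fin m → ℚ} {g : Fin N ⊕ Fin N → ℚ} {a : ℚ}
    {A : MatXY n m N} (hA : IsGradedMat (Sum.elim wx wy) g a A) (i : Fin n ⊕ Fin m) :
    IsGradedMat (Sum.elim wx wy) g (a - Sum.elim wx wy i) (matDeriv i A) := by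
  intro r s
  refine ((hA r s).pderiv_sub i).weight_congr ?_
  ring

variable {wx : Fin n → ℚ} {wy : Fin m → ℚ} {V₁ : MvPolynomial (Fin n) ℂ}
  {V₂ : MvPolynomial (Fin m) ℂ} {Q : MatXY n m N}

lemma IsGradedMF.homogeneous_strDeriv (hQ : IsGradedMF wx wy V₁ V₂ Q) :
    IsWeightedHomogeneous (Sum.elim wx wy) (strDeriv Q)
      (∑ i, (1 - wx i) + ∑ j, (1 - wy j)) := by
  obtain ⟨g, hg⟩ := hQ.graded
  have hσ : IsGradedMat (Sum.elim wx wy) g 0 (sigma n m N) := by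
    intro r s
    rcases r with r | r <;> rcases s with s | s <;>
      simp only [sigma, Matrix.fromBlocks_apply₁₁, Matrix.fromBlocks_apply₁₂,
        Matrix.fromBlocks_apply₂₁, Matrix.fromBlocks_apply₂₂, Matrix.one_apply, Matrix.zero_apply,
        Matrix.neg_apply]
    · split_ifs with h
      · subst h
        exact (isWeightedHomogeneous_one ℂ _).weight_congr (by ring)
      · exact isWeightedHomogeneous_zero _ _ _
    · exact isWeightedHomogeneous_zero _ _ _
    · exact isWeightedHomogeneous_zero _ _ _
    · split_ifs with h
      · subst h
        exact (isWeightedHomogeneous_one ℂ _).neg.weight_congr (by ring)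
      · exact isWeightedHomogeneous_zero _ _ _ |>.neg
  have hprod := hσ.mul ((IsGradedMat.prod_ofFn fun i : Fin n =>
    IsGradedMat.matDeriv (A := Q) hg (Sum.inl i)).mul (IsGradedMat.prod_ofFn fun j : Fin m =>
      IsGradedMat.matDeriv (A := Q) hg (Sum.inr j)))
  rw [strDeriv, str, Matrix.trace]
  refine IsWeightedHomogeneous.sum _ _ _ fun r _ => (hprod r r).weight_congr ?_
  simp

/-- The left quantum dimension has weight `∑ (1 - |yⱼ|) - ∑ (1 - |xᵢ|)`. -/
lemma IsGradedMF.homogeneous_qL (hQ : IsGradedMF wx wy V₁ V₂ Q) (hV : IsPotential wx V₁) :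
    IsWeightedHomogeneous wy (qL V₁ Q) (∑ j, (1 - wy j) - ∑ i, (1 - wx i)) := by
  obtain ⟨D, hD⟩ := hV.exists_data
  have h := isWeightedHomogeneous_residue (w' := wy) hD hQ.homogeneous_strDeriv
  have h' : ∑ i, (1 - wx i) + ∑ j, (1 - wy j) + ∑ i, wx i - ∑ i, (2 - wx i) =
      ∑ j, (1 - wy j) - ∑ i, (1 - wx i) := by
    simp only [Finset.sum_sub_distrib, Finset.sum_const]
    simp
    ring
  rw [h'] at h
  rw [qL]
  rcases neg_one_pow_eq_or (MvPolynomial (Fin m) ℂ) ((m + 1).choose 2) with hs | hs <;> rw [hs]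
  · rwa [one_mul]
  · rw [neg_one_mul]
    exact h.neg

/-- The right quantum dimension has weight `∑ (1 - |xᵢ|) - ∑ (1 - |yⱼ|)`. -/
lemma IsGradedMF.homogeneous_qR (hQ : IsGradedMF wx wy V₁ V₂ Q) (hV : IsPotential wy V₂) :
    IsWeightedHomogeneous wx (qR V₂ Q) (∑ i, (1 - wx i) - ∑ j, (1 - wy j)) := by
  obtain ⟨D, hD⟩ := hV.exists_data
  have h := isWeightedHomogeneous_residue (w' := wx) hD (hQ.homogeneous_strDeriv.rename_weight
    (ι := Sum.swap) (w' := Sum.elim wy wx) (by rintro (i | i) <;> rfl))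
  have h' : ∑ i, (1 - wx i) + ∑ j, (1 - wy j) + ∑ i, wy i - ∑ i, (2 - wy i) =
      ∑ i, (1 - wx i) - ∑ j, (1 - wy j) := by
    simp only [Finset.sum_sub_distrib, Finset.sum_const]
    simp
    ring
  rw [h'] at h
  rw [qR]
  rcases neg_one_pow_eq_or (MvPolynomial (Fin n) ℂ) ((n + 1).choose 2) with hs | hs <;> rw [hs]
  · rwa [one_mul]
  · rw [neg_one_mul]
    exact h.neg

/-- If the central charges agree, the quantum dimensions are constants. -/
lemma IsGradedMF.qL_eq_C (hQ : IsGradedMF wx wy V₁ V₂ Q) (hV₁ : IsPotential wx V₁)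
    (hV₂ : IsPotential wy V₂) (hc : ∑ i, (1 - wx i) = ∑ j, (1 - wy j)) :
    qL V₁ Q = C (constantCoeff (qL V₁ Q)) :=
  ((hQ.homogeneous_qL hV₁).weight_congr (by rw [hc, sub_self])).eq_C hV₂.weight_pos

lemma IsGradedMF.qR_eq_C (hQ : IsGradedMF wx wy V₁ V₂ Q) (hV₁ : IsPotential wx V₁)
    (hV₂ : IsPotential wy V₂) (hc : ∑ i, (1 - wx i) = ∑ j, (1 - wy j)) :
    qR V₂ Q = C (constantCoeff (qR V₂ Q)) :=
  ((hQ.homogeneous_qR hV₂).weight_congr (by rw [hc, sub_self])).eq_C hV₁.weight_pos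

/-- Potentials related by an orbifold equivalence have the same central charge. -/
lemma IsOrbifoldEquivalence.charge_eq (h : IsOrbifoldEquivalence wx wy V₁ V₂ Q) :
    ∑ i, (1 - wx i) = ∑ j, (1 - wy j) :=
  sub_eq_zero.mp ((h.mf.homogeneous_qR h.pot₂).weight_eq_zero
    (h.unit_qR.map (constantCoeff : MvPolynomial (Fin n) ℂ →+* ℂ)).ne_zero)

end MatrixFactorisation

/-! ### Changes of the variables `y` in a matrix factorisation -/

section Substitution

variable {n m N : ℕ}

/-- The substitution of `φ(yⱼ)` for `yⱼ` in polynomials in `(x, y)`. -/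
def substPoly (n : ℕ) (φ : MvPolynomial (Fin m) ℂ ≃ₐ[ℂ] MvPolynomial (Fin m) ℂ) :
    PolyXY n m →ₐ[ℂ] PolyXY n m :=
  aeval (Sum.elim (fun i => X (Sum.inl i)) (fun j => rename Sum.inr (φ (X j))))

variable {φ : MvPolynomial (Fin m) ℂ ≃ₐ[ℂ] MvPolynomial (Fin m) ℂ}

lemma substPoly_rename_inl (p : MvPolynomial (Fin n) ℂ) :
    substPoly n φ (rename Sum.inl p) = rename Sum.inl p := by
  have : (substPoly n φ).comp (rename Sum.inl) = rename Sum.inl := by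
    ext j
    simp [substPoly]
  exact DFunLike.congr_fun this p

lemma substPoly_rename_inr (p : MvPolynomial (Fin m) ℂ) :
    substPoly n φ (rename Sum.inr p) = rename Sum.inr (φ p) := by
  have : (substPoly n φ).comp (rename Sum.inr) = (rename Sum.inr).comp φ.toAlgHom := by
    ext j
    simp [substPoly]
  exact DFunLike.congr_fun this p

lemma substPoly_diffPot (V₁ : MvPolynomial (Fin n) ℂ) (V₂ : MvPolynomial (Fin m) ℂ) :
    substPoly n φ (diffPot V₁ V₂) = diffPot V₁ (φ V₂) := by
  rw [diffPot, map_sub, substPoly_rename_inl, substPoly_rename_inr, diffPot]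

lemma pderiv_inl_substPoly (i : Fin n) (p : PolyXY n m) :
    pderiv (Sum.inl i) (substPoly n φ p) = substPoly n φ (pderiv (Sum.inl i) p) := by
  induction p using MvPolynomial.induction_on with
  | C r => simp
  | add p q hp hq => simp only [map_add, hp, hq]
  | mul_X p j hp =>
    classical
    simp only [map_mul, Derivation.leibniz, hp, smul_eq_mul, map_add]
    rcases j with j | j
    · by_cases hj : j = i
      · subst hj
        simp [substPoly]
      · simp [substPoly, pderiv_X, hj]
    · simp [substPoly, pderiv_X, pderiv_inl_rename_inr]

lemma pderiv_inr_substPoly (j : Fin m) (p : PolyXY n m) :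
    pderiv (Sum.inr j) (substPoly n φ p) =
      ∑ k, rename Sum.inr (jacobian φ j k) * substPoly n φ (pderiv (Sum.inr k) p) := by
  induction p using MvPolynomial.induction_on with
  | C r => simp
  | add p q hp hq => simp only [map_add, hp, hq, mul_add, Finset.sum_add_distrib]
  | mul_X p i hp =>
    classical
    simp only [map_mul, Derivation.leibniz, hp, smul_eq_mul, map_add, mul_add,
      Finset.sum_add_distrib]
    rw [Finset.mul_sum]
    refine congrArg₂ (· + ·) ?_ (Finset.sum_congr rfl fun k _ => mul_left_comm _ _ _)
    rcases i with i | i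
    · simp [substPoly, pderiv_X]
    · have h1 : ∀ k, pderiv (Sum.inr k) (X (Sum.inr i) : PolyXY n m) =
          if k = i then 1 else 0 := by
        intro k
        rw [pderiv_X, Pi.single_apply]
        simp [eq_comm]
      have h2 : substPoly n φ (X (Sum.inr i)) = rename Sum.inr (φ (X i)) := by
        simp [substPoly]
      have h3 : pderiv (Sum.inr j) (rename Sum.inr (φ (X i)) : PolyXY n m) =
          rename Sum.inr (jacobian φ j i) := pderiv_rename Sum.inr_injective _ _
      simp only [h1, h2, h3, apply_ite (substPoly n φ), map_one, map_zero, mul_ite, mul_one,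
        mul_zero, Finset.sum_ite_eq', Finset.mem_univ, if_true]
      exact mul_comm _ _

lemma evalRight_substPoly (p : PolyXY n m) :
    evalRight n m (substPoly n φ p) = φ (evalRight n m p) := by
  have : (evalRight n m).comp (substPoly n φ) = φ.toAlgHom.comp (evalRight n m) := by
    ext (i | j)
    · simp [evalRight, substPoly]
    · simp only [AlgHom.comp_apply, substPoly, aeval_X, Sum.elim_inr, evalRight_rename_inr]
      simp [evalRight]
  exact DFunLike.congr_fun this p

lemma evalLeft_substPoly (h0 : ∀ j, constantCoeff (φ (X j)) = 0) (p : PolyXY n m) :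
    evalLeft n m (substPoly n φ p) = evalLeft n m p := by
  have : (evalLeft n m).comp (substPoly n φ) = evalLeft n m := by
    ext (i | j)
    · simp [evalLeft, substPoly]
    · simp only [AlgHom.comp_apply, substPoly, aeval_X, Sum.elim_inr, evalLeft_rename_inr]
      simp [evalLeft, h0]
  exact DFunLike.congr_fun this p

lemma substY_eq (Q : MatXY n m N) :
    substY φ Q = (substPoly n φ : PolyXY n m →+* PolyXY n m).mapMatrix Q := rfl

lemma matDeriv_inl_substY (i : Fin n) (Q : MatXY n m N) :
    matDeriv (Sum.inl i) (substY φ Q) = substY φ (matDeriv (Sum.inl i) Q) := by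
  ext1 r s
  exact pderiv_inl_substPoly i (Q r s)

lemma matDeriv_inr_substY (j : Fin m) (Q : MatXY n m N) :
    matDeriv (Sum.inr j) (substY φ Q) =
      ∑ k, (rename Sum.inr (jacobian φ j k) : PolyXY n m) • substY φ (matDeriv (Sum.inr k) Q) := by
  ext1 r s
  rw [Matrix.sum_apply]
  exact pderiv_inr_substPoly j (Q r s)

lemma constantCoeff_substPoly (h0 : ∀ j, constantCoeff (φ (X j)) = 0) (p : PolyXY n m) :
    constantCoeff (substPoly n φ p) = constantCoeff p := by
  have h : (constantCoeff : PolyXY n m →+* ℂ).comp (substPoly n φ : PolyXY n m →+* PolyXY n m) =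
      constantCoeff := by
    refine MvPolynomial.ringHom_ext (fun r => by simp) ?_
    rintro (i | j)
    · simp [substPoly]
    · simp [substPoly, constantCoeff_rename, h0]
  exact DFunLike.congr_fun h p

lemma noConstantEntries_substY (h0 : ∀ j, constantCoeff (φ (X j)) = 0) {Q : MatXY n m N}
    (hQ : NoConstantEntries Q) : NoConstantEntries (substY φ Q) := fun r s =>
  (constantCoeff_substPoly h0 (Q r s)).trans (hQ r s)

variable {wx : Fin n → ℚ} {wy : Fin m → ℚ} {V₁ : MvPolynomial (Fin n) ℂ}
  {V₂ : MvPolynomial (Fin m) ℂ} {Q : MatXY n m N}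

lemma IsGradedMF.substY {wy' : Fin m → ℚ} (hQ : IsGradedMF wx wy V₁ V₂ Q)
    (hφ : IsGradedAut wy wy' φ) : IsGradedMF wx wy' V₁ (φ V₂) (substY φ Q) where
  odd₁ := by
    ext1 r s
    have h : Q (Sum.inl r) (Sum.inl s) = 0 := congrFun (congrFun hQ.odd₁ r) s
    change substPoly n φ (Q (Sum.inl r) (Sum.inl s)) = 0
    rw [h, map_zero]
  odd₂ := by
    ext1 r s
    have h : Q (Sum.inr r) (Sum.inr s) = 0 := congrFun (congrFun hQ.odd₂ r) s
    change substPoly n φ (Q (Sum.inr r) (Sum.inr s)) = 0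
    rw [h, map_zero]
  sq := by
    rw [substY_eq, ← map_mul, hQ.sq, ← substPoly_diffPot]
    ext1 r s
    by_cases h : r = s <;> simp [h]
  graded := by
    obtain ⟨g, hg⟩ := hQ.graded
    refine ⟨g, fun r s => (hg r s).aeval_weight ?_⟩
    rintro (i | j)
    · exact isWeightedHomogeneous_X ℂ (Sum.elim wx wy') (Sum.inl i)
    · exact (hφ j).rename_weight (ι := Sum.inr) (w' := Sum.elim wx wy') fun _ => rfl

/-- The derivatives of `Q` under a homomorphism `π` from `ℂ[x, y]`, as they enter in
`strDeriv`. -/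
lemma map_strDeriv {S : Type*} [CommRing S] (π : PolyXY n m →+* S) (Q : MatXY n m N) :
    π (strDeriv Q) = (π.mapMatrix (sigma n m N) *
      (((List.ofFn fun i => matDeriv (Sum.inl i) Q).map π.mapMatrix).prod *
        (List.ofFn fun j => π.mapMatrix (matDeriv (Sum.inr j) Q)).prod)).trace := by
  rw [strDeriv, str, map_trace_prod']

/-- After setting `x = 0`, the supertrace of the transformed factorisation is the determinant of
`φ` times the original one up to terms killed by the residue. -/
lemma IsGradedMF.evalRight_strDeriv_substY (hQ : IsGradedMF wx wy V₁ V₂ Q)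
    (hV₁ : IsPotential wx V₁) (hV₂ : IsPotential wy V₂)
    (φ : MvPolynomial (Fin m) ℂ ≃ₐ[ℂ] MvPolynomial (Fin m) ℂ) :
    ∃ g, evalRight n m (strDeriv (LG.substY φ Q)) = φ g ∧
      residue (fun j => pderiv j V₂) g =
        (linearPart φ).det * residue (fun j => pderiv j V₂) (evalRight n m (strDeriv Q)) := by
  obtain ⟨D, -⟩ := hV₂.exists_data
  set π : PolyXY n m →+* MvPolynomial (Fin m) ℂ := (evalRight n m).toRingHom with hπ
  have hodd : IsOddMat Q := isOddMat_of_blocks hQ.odd₁ hQ.odd₂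
  have hodd' : ∀ i, IsOddMat (matDeriv i Q) := fun i => isOddMat_of_blocks
    (toBlocks₁₁_matDeriv hQ.odd₁ i) (toBlocks₂₂_matDeriv hQ.odd₂ i)
  have hodd'' : ∀ i j, IsOddMat (matDeriv i (matDeriv j Q)) := fun i j => isOddMat_of_blocks
    (toBlocks₁₁_matDeriv (toBlocks₁₁_matDeriv hQ.odd₁ j) i)
    (toBlocks₂₂_matDeriv (toBlocks₂₂_matDeriv hQ.odd₂ j) i)
  set M := (φ.symm : MvPolynomial (Fin m) ℂ →+* MvPolynomial (Fin m) ℂ).mapMatrix (jacobian φ)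
    with hM
  have hMdet : M.det = C (linearPart φ).det := by
    rw [hM, ← RingHom.map_det, jacobian_det]
    exact aut_C φ.symm _
  have key := trace_prod_sub_det_mul_mem D (π.mapMatrix (sigma n m N)) (π.mapMatrix Q)
    ((List.ofFn fun i => matDeriv (Sum.inl i) Q).map π.mapMatrix)
    (fun j => π.mapMatrix (matDeriv (Sum.inr j) Q))
    (fun j k => π.mapMatrix (matDeriv (Sum.inr j) (matDeriv (Sum.inr k) Q)))
    (fun j k => π (pderiv (Sum.inr j) (pderiv (Sum.inr k) (diffPot V₁ V₂))))
    (map_anticomm π hodd)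
    (by
      intro a ha
      obtain ⟨b, hb, rfl⟩ := List.mem_map.mp ha
      obtain ⟨i, rfl⟩ := List.mem_ofFn.mp hb
      exact map_anticomm π (hodd' _))
    (fun k => map_anticomm π (hodd' _)) (fun j k => map_anticomm π (hodd'' _ _))
    (by
      intro a ha
      obtain ⟨b, hb, rfl⟩ := List.mem_map.mp ha
      obtain ⟨i, rfl⟩ := List.mem_ofFn.mp hb
      refine map_anticomm_of_add π (anticomm_matDeriv hQ.sq _) ?_
      rw [pderiv_inl_diffPot]
      exact (evalRight_rename_inl _).trans
        (by rw [constantCoeff_pderiv_of_mem hV₁.mem_sq, map_zero]))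
    (by
      intro k
      rw [← map_mul, ← map_mul, ← map_add, anticomm_matDeriv hQ.sq, pderiv_inr_diffPot]
      have := evalRight_rename_inr (n := n) (pderiv k V₂)
      ext1 r s
      by_cases h : r = s <;> simp [h, hπ, this])
    (by
      intro j k
      rw [← map_mul, ← map_mul, ← map_add, matDeriv_anticomm_matDeriv hQ.sq, map_sub, map_add,
        map_mul, map_mul]
      congr 1
      ext1 r s
      by_cases h : r = s <;> simp [h])
    M
  rw [← map_strDeriv, hMdet] at key
  refine ⟨_, ?_, (residue_eq_of_sub_mem key).trans (residue_C_mul _ _ _)⟩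
  have h1 := map_strDeriv π (LG.substY φ Q)
  rw [show π (strDeriv (LG.substY φ Q)) = evalRight n m (strDeriv (LG.substY φ Q)) from rfl] at h1
  rw [h1]
  have hcomp : ∀ A : MatXY n m N, π.mapMatrix (LG.substY φ A) =
      (φ : MvPolynomial (Fin m) ℂ →+* MvPolynomial (Fin m) ℂ).mapMatrix (π.mapMatrix A) := by
    intro A
    ext1 r s
    exact evalRight_substPoly (A r s)
  have h2 := map_trace_prod (φ : MvPolynomial (Fin m) ℂ →+* MvPolynomial (Fin m) ℂ)
    (π.mapMatrix (sigma n m N)) ((List.ofFn fun i => matDeriv (Sum.inl i) Q).map π.mapMatrix)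
    (fun j => π.mapMatrix (matDeriv (Sum.inr j) Q)) M
  refine Eq.trans ?_ h2.symm
  congr 2
  · ext1 r s
    rcases r with r | r <;> rcases s with s | s <;> by_cases h : r = s <;> simp [sigma, h]
  · congr 2
    · rw [List.map_ofFn, List.map_ofFn, List.map_ofFn]
      congr 1
      ext1 i
      simp only [Function.comp_apply, matDeriv_inl_substY, hcomp]
    · congr 1
      ext1 j
      rw [matDeriv_inr_substY, map_sum]
      refine Finset.sum_congr rfl fun k _ => ?_
      rw [← hcomp]
      ext1 r s
      have e1 : φ (M j k) = jacobian φ j k := φ.apply_symm_apply _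
      have e2 := evalRight_rename_inr (n := n) (jacobian φ j k)
      simp only [RingHom.mapMatrix_apply, Matrix.map_apply, Matrix.smul_apply, smul_eq_mul,
        map_mul]
      congr 1
      exact e2.trans e1.symm

lemma constantCoeff_pderiv_pderiv_of_mem {V : MvPolynomial (Fin m) ℂ}
    (hV : V ∈ idealOfVars (Fin m) ℂ ^ 3) (j k : Fin m) :
    constantCoeff (pderiv j (pderiv k V)) = 0 := by
  rw [constantCoeff_eq, coeff_pderiv, coeff_pderiv, (mem_pow_idealOfVars_iff' 3 V).mp hV]
  · simp
  · simp

lemma linearPart_apply_eq_zero (hφ : IsGradedAut wy wy φ) {j k : Fin m} (h : wy k ≠ wy j) :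
    linearPart φ j k = 0 := by
  by_contra hcon
  have := hφ j hcon
  rw [Finsupp.weight_single, one_smul] at this
  exact h this

/-- After setting `y = 0`, the supertrace of the transformed factorisation is `det A` times the
original one up to terms killed by the residue. For distinct weights `A` is diagonal; for
`V₂ ∈ 𝔪³` the second derivatives of `V₂`, which are the obstruction to antisymmetry, vanish. -/
lemma IsGradedMF.evalLeft_strDeriv_substY (hQ : IsGradedMF wx wy V₁ V₂ Q)
    (hV₁ : IsPotential wx V₁) (hV₂ : IsPotential wy V₂) (hφ : IsGradedAut wy wy φ)
    (h : Function.Injective wy ∨ V₂ ∈ idealOfVars (Fin m) ℂ ^ 3) :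
    residue (fun i => pderiv i V₁) (evalLeft n m (strDeriv (LG.substY φ Q))) =
      (linearPart φ).det * residue (fun i => pderiv i V₁) (evalLeft n m (strDeriv Q)) := by
  obtain ⟨D, -⟩ := hV₁.exists_data
  set π : PolyXY n m →+* MvPolynomial (Fin n) ℂ := (evalLeft n m).toRingHom with hπ
  have h0 := hφ.constantCoeff_X hV₂.weight_pos
  have hcomp : ∀ A : MatXY n m N, π.mapMatrix (LG.substY φ A) = π.mapMatrix A := by
    intro A
    ext1 r s
    exact evalLeft_substPoly h0 (A r s)
  set M : Matrix (Fin m) (Fin m) (MvPolynomial (Fin n) ℂ) :=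
    (C : ℂ →+* MvPolynomial (Fin n) ℂ).mapMatrix (linearPart φ).transpose with hM
  have hMdet : M.det = C (linearPart φ).det := by
    rw [hM, ← RingHom.map_det, Matrix.det_transpose]
  set l := (List.ofFn fun i => matDeriv (Sum.inl i) Q).map π.mapMatrix with hl
  set d : Fin m → Matrix (Fin N ⊕ Fin N) (Fin N ⊕ Fin N) (MvPolynomial (Fin n) ℂ) :=
    fun j => π.mapMatrix (matDeriv (Sum.inr j) Q) with hd
  have hsubst : π (strDeriv (LG.substY φ Q)) = (π.mapMatrix (sigma n m N) *
      (l.prod * (List.ofFn fun j => ∑ k, M j k • d k).prod)).trace := by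
    have e1 : (List.ofFn fun i => matDeriv (Sum.inl i) (LG.substY φ Q)).map π.mapMatrix = l := by
      rw [hl, List.map_ofFn, List.map_ofFn]
      refine congrArg List.ofFn (funext fun i => ?_)
      simp only [Function.comp_apply, matDeriv_inl_substY, hcomp]
    have e2 : ∀ j, π.mapMatrix (matDeriv (Sum.inr j) (LG.substY φ Q)) = ∑ k, M j k • d k := by
      intro j
      rw [matDeriv_inr_substY, map_sum]
      refine Finset.sum_congr rfl fun k _ => ?_
      rw [show d k = π.mapMatrix (LG.substY φ (matDeriv (Sum.inr k) Q)) from (hcomp _).symm]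
      ext1 r s
      have e3 : constantCoeff (jacobian φ j k) = linearPart φ k j :=
        congrFun (congrFun (map_constantCoeff_jacobian φ) j) k
      have e4 := evalLeft_rename_inr (n := n) (jacobian φ j k)
      rw [e3] at e4
      simp only [RingHom.mapMatrix_apply, Matrix.map_apply, Matrix.smul_apply, smul_eq_mul,
        map_mul]
      exact congrArg (· * _) e4
    rw [map_strDeriv, e1]
    simp only [e2]
  have horig : π (strDeriv Q) = (π.mapMatrix (sigma n m N) * (l.prod * (List.ofFn d).prod)).trace :=
    map_strDeriv π Q
  suffices key : π (strDeriv (LG.substY φ Q)) - C (linearPart φ).det * π (strDeriv Q) ∈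
      residueAnn fun i => pderiv i V₁ from
    (residue_eq_of_sub_mem key).trans (residue_C_mul _ _ _)
  rw [hsubst, horig, ← hMdet]
  rcases h with hinj | hcube
  · have hdiag : ∀ j k, j ≠ k → M j k = 0 := by
      intro j k hjk
      have : linearPart φ k j = 0 := linearPart_apply_eq_zero hφ fun h => hjk (hinj h)
      simp [hM, this]
    have h1 : ∀ j, ∑ k, M j k • d k = M j j • d j := by
      intro j
      refine Finset.sum_eq_single j (fun k _ hk => ?_) (by simp)
      rw [hdiag j k hk.symm, zero_smul]
    have h2 : M.det = ∏ j, M j j := by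
      rw [← Matrix.det_diagonal]
      congr 1
      ext1 j k
      by_cases hjk : j = k
      · subst hjk; simp
      · simp [hjk, hdiag j k hjk]
    have h3 := (MultilinearMap.mkPiAlgebraFin (MvPolynomial (Fin n) ℂ) m
      (Matrix (Fin N ⊕ Fin N) (Fin N ⊕ Fin N) (MvPolynomial (Fin n) ℂ))).map_smul_univ
        (fun j => M j j) d
    rw [MultilinearMap.mkPiAlgebraFin_apply, MultilinearMap.mkPiAlgebraFin_apply] at h3
    simp only [h1, h3, mul_smul_comm, Matrix.trace_smul, smul_eq_mul, h2, sub_self]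
    exact Ideal.zero_mem _
  · have hodd : IsOddMat Q := isOddMat_of_blocks hQ.odd₁ hQ.odd₂
    have hodd' : ∀ i, IsOddMat (matDeriv i Q) := fun i => isOddMat_of_blocks
      (toBlocks₁₁_matDeriv hQ.odd₁ i) (toBlocks₂₂_matDeriv hQ.odd₂ i)
    have hodd'' : ∀ i j, IsOddMat (matDeriv i (matDeriv j Q)) := fun i j => isOddMat_of_blocks
      (toBlocks₁₁_matDeriv (toBlocks₁₁_matDeriv hQ.odd₁ j) i)
      (toBlocks₂₂_matDeriv (toBlocks₂₂_matDeriv hQ.odd₂ j) i)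
    refine trace_prod_sub_det_mul_mem_of_anticomm D (π.mapMatrix (sigma n m N)) (π.mapMatrix Q)
      l d (fun j k => π.mapMatrix (matDeriv (Sum.inr j) (matDeriv (Sum.inr k) Q)))
      (map_anticomm π hodd) ?_ (fun k => map_anticomm π (hodd' _))
      (fun j k => map_anticomm π (hodd'' _ _)) ?_ ?_ ?_ M
    · intro a ha
      obtain ⟨b, hb, rfl⟩ := List.mem_map.mp ha
      obtain ⟨i, rfl⟩ := List.mem_ofFn.mp hb
      exact map_anticomm π (hodd' _)
    · intro a ha
      obtain ⟨b, hb, rfl⟩ := List.mem_map.mp ha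
      obtain ⟨i, rfl⟩ := List.mem_ofFn.mp hb
      refine ⟨i, ?_⟩
      rw [← map_mul, ← map_mul, ← map_add, anticomm_matDeriv hQ.sq, pderiv_inl_diffPot]
      have := evalLeft_rename_inl (m := m) (pderiv i V₁)
      ext1 r s
      by_cases h : r = s <;> simp [h, hπ, this]
    · intro k
      refine map_anticomm_of_add π (anticomm_matDeriv hQ.sq _) ?_
      rw [pderiv_inr_diffPot, map_neg, neg_eq_zero]
      exact (evalLeft_rename_inr _).trans
        (by rw [constantCoeff_pderiv_of_mem hV₂.mem_sq, map_zero])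
    · intro j k
      rw [← map_mul, ← map_mul, ← map_add, matDeriv_anticomm_matDeriv hQ.sq, map_sub, map_add,
        map_mul, map_mul, sub_eq_neg_self, pderiv_inr_diffPot, map_neg,
        pderiv_rename Sum.inr_injective]
      have := evalLeft_rename_inr (n := n) (pderiv j (pderiv k V₂))
      rw [constantCoeff_pderiv_pderiv_of_mem hcube, map_zero] at this
      ext1 r s
      by_cases h : r = s <;> simp [h, hπ, this]

/-- Orbifold equivalences under a weight-preserving change of the variables `y`. The factor of `q_R`
combines `det A` from the supertrace with `(det A)⁻²` from the residue; only the supertrace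
contributes to `q_L`. -/
lemma IsOrbifoldEquivalence.substY (hQ : IsOrbifoldEquivalence wx wy V₁ V₂ Q)
    (hφ : IsGradedAut wy wy φ)
    (h : Function.Injective wy ∨ V₂ ∈ idealOfVars (Fin m) ℂ ^ 3) :
    IsOrbifoldEquivalence wx wy V₁ (φ V₂) (LG.substY φ Q) ∧
      qR (φ V₂) (LG.substY φ Q) = C ((linearPart φ).det⁻¹) * qR V₂ Q ∧
      qL V₁ (LG.substY φ Q) = C (linearPart φ).det * qL V₁ Q ∧
      (NoConstantEntries Q → NoConstantEntries (LG.substY φ Q)) := by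
  have hpos := hQ.pot₂.weight_pos
  have hpot := hQ.pot₂.map hφ hpos
  have hmf := hQ.mf.substY hφ
  have hcharge := hQ.charge_eq
  have hdet := linearPart_det_ne_zero φ
  have hqR : qR (φ V₂) (LG.substY φ Q) = C ((linearPart φ).det⁻¹) * qR V₂ Q := by
    rw [hmf.qR_eq_C hQ.pot₁ hpot hcharge, hQ.mf.qR_eq_C hQ.pot₁ hQ.pot₂ hcharge, ← C_mul,
      constantCoeff_qR hpot, constantCoeff_qR hQ.pot₂]
    obtain ⟨g, hg, hres⟩ := hQ.mf.evalRight_strDeriv_substY hQ.pot₁ hQ.pot₂ φ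
    have hstr : IsWeightedHomogeneous wy (evalRight n m (strDeriv (LG.substY φ Q)))
        (∑ i, (1 - wx i) + ∑ j, (1 - wy j)) := by
      refine hmf.homogeneous_strDeriv.aeval_weight ?_
      rintro (i | j)
      · exact isWeightedHomogeneous_zero ℂ wy _
      · exact isWeightedHomogeneous_X ℂ wy j
    have hg' : IsWeightedHomogeneous wy g (∑ i, (2 - wy i) - ∑ i, wy i) := by
      have h1 := hφ.symm.apply hstr
      rw [hg, AlgEquiv.symm_apply_apply, hcharge] at h1
      refine h1.weight_congr ?_
      rw [← Finset.sum_add_distrib, ← Finset.sum_sub_distrib]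
      exact Finset.sum_congr rfl fun j _ => by ring
    rw [hg, hφ.residue_apply hpos hQ.pot₂ hg', hres]
    congr 1
    field_simp
  have hqL : qL V₁ (LG.substY φ Q) = C (linearPart φ).det * qL V₁ Q := by
    rw [hmf.qL_eq_C hQ.pot₁ hpot hcharge, hQ.mf.qL_eq_C hQ.pot₁ hQ.pot₂ hcharge, ← C_mul,
      constantCoeff_qL hQ.pot₁, constantCoeff_qL hQ.pot₁,
      hQ.mf.evalLeft_strDeriv_substY hQ.pot₁ hQ.pot₂ hφ h]
    congr 1
    ring
  refine ⟨⟨hQ.pot₁, hpot, hmf, ?_, ?_⟩, hqR, hqL,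
    noConstantEntries_substY (hφ.constantCoeff_X hpos)⟩
  · rw [hqL]
    exact ((IsUnit.mk0 _ hdet).map C).mul hQ.unit_qL
  · rw [hqR]
    exact ((IsUnit.mk0 _ (inv_ne_zero hdet)).map C).mul hQ.unit_qR

end Substitution

/-! ### Clifford generators on a Fock space -/

section Clifford

/-- The operator acting by `x` on the even part and by `y` on the odd part. -/
def parityDiag {T : Type} [DecidableEq T] (ε : T → Bool) (x y : ℂ) : Matrix T T ℂ :=
  Matrix.diagonal fun t => if ε t then x else y


/-- Matrices `γ_a`, indexed by `k` annihilators and `k` creators, with `γ_a γ_b + γ_b γ_a = 1` if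
`a` and `b` are partners and `0` otherwise. They are odd for the parity `ε` and shift the grading
`g` by `∓ δ`, and the supertrace of their product does not vanish. -/
structure FockData (T : Type) [Fintype T] [DecidableEq T] (ε : T → Bool) (k : ℕ)
    (δ : Fin k → ℚ) where
  g : T → ℚ
  γ : Fin k ⊕ Fin k → Matrix T T ℂ
  odd : ∀ a r s, γ a r s ≠ 0 → ε r ≠ ε s
  graded : ∀ a r s, γ a r s ≠ 0 → g s - g r = Sum.elim (fun i => -δ i) δ a
  anticomm : ∀ a b, γ a * γ b + γ b * γ a = if b = a.swap then 1 else 0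
  trace_ne : (parityDiag ε 1 (-1) *
    ((List.ofFn fun i => γ (Sum.inl i)).prod * (List.ofFn fun i => γ (Sum.inr i)).prod)).trace ≠ 0

/-- Fock data for `k = 0`. -/
def FockData.zero (δ : Fin 0 → ℚ) : FockData Unit (fun _ => true) 0 δ where
  g _ := 0
  γ a := 0
  odd a := a.elim Fin.elim0 Fin.elim0
  graded a := a.elim Fin.elim0 Fin.elim0
  anticomm a := a.elim Fin.elim0 Fin.elim0
  trace_ne := by simp [parityDiag]

/-- Relabelling of the basis. -/
def FockData.reindex {T T' : Type} [Fintype T] [DecidableEq T] [Fintype T'] [DecidableEq T']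
    {ε : T → Bool} {k : ℕ} {δ : Fin k → ℚ} (F : FockData T ε k δ) (e : T ≃ T') :
    FockData T' (ε ∘ e.symm) k δ where
  g := F.g ∘ e.symm
  γ a := Matrix.reindexAlgEquiv ℂ ℂ e (F.γ a)
  odd a r s h := F.odd a _ _ h
  graded a r s h := F.graded a _ _ h
  anticomm a b := by
    rw [← map_mul, ← map_mul, ← map_add, F.anticomm]
    split_ifs <;> simp
  trace_ne := by
    have h : parityDiag (ε ∘ e.symm) 1 (-1) =
        Matrix.reindexAlgEquiv ℂ ℂ e (parityDiag ε 1 (-1)) := by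
      ext r s
      simp [parityDiag, Matrix.diagonal_apply]
    have h1 : ∀ f : Fin k → Matrix T T ℂ,
        (List.ofFn fun i => Matrix.reindexAlgEquiv ℂ ℂ e (f i)).prod =
          Matrix.reindexAlgEquiv ℂ ℂ e (List.ofFn f).prod := by
      intro f
      rw [map_list_prod, List.map_ofFn]
      rfl
    rw [h, h1, h1, ← map_mul, ← map_mul]
    have h2 : ∀ A : Matrix T T ℂ, (Matrix.reindexAlgEquiv ℂ ℂ e A).trace = A.trace := by
      intro A
      exact Equiv.sum_comp e.symm fun t => A t t
    rw [h2]
    exact F.trace_ne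

variable {T : Type} [Fintype T] [DecidableEq T]

/-- The off-diagonal doubling of a matrix. -/
def offDiag (A : Matrix T T ℂ) : Matrix (T ⊕ T) (T ⊕ T) ℂ := Matrix.fromBlocks 0 A A 0

lemma prod_map_offDiag (l : List (Matrix T T ℂ)) :
    (l.map offDiag).prod = Matrix.fromBlocks l.prod 0 0 l.prod * offDiag 1 ^ l.length := by
  induction l with
  | nil => simp
  | cons A l ih =>
    have h1 : ∀ P : Matrix T T ℂ, offDiag A * Matrix.fromBlocks P 0 0 P =
        Matrix.fromBlocks (A * P) 0 0 (A * P) * offDiag 1 := by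
      intro P
      simp [offDiag, Matrix.fromBlocks_multiply]
    rw [List.map_cons, List.prod_cons, ih, ← mul_assoc, h1, List.prod_cons, List.length_cons,
      pow_succ', mul_assoc]

lemma prod_map_offDiag_of_even {l : List (Matrix T T ℂ)} (hl : Even l.length) :
    (l.map offDiag).prod = Matrix.fromBlocks l.prod 0 0 l.prod := by
  obtain ⟨r, hr⟩ := hl
  have : offDiag (1 : Matrix T T ℂ) * offDiag 1 = 1 := by
    simp [offDiag, Matrix.fromBlocks_multiply]
  rw [prod_map_offDiag, hr, ← two_mul, pow_mul, pow_two, this, one_pow, mul_one]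

/-- The additional pair of generators on the doubled space `T ⊕ T`. The signs and projections make
them anticommute with the doubled old generators, which are odd for `ε`. -/
def newGen (ε : T → Bool) : Unit ⊕ Unit → Matrix (T ⊕ T) (T ⊕ T) ℂ
  | Sum.inl _ => Matrix.fromBlocks 0 (parityDiag ε 0 (-1)) (parityDiag ε 1 0) 0
  | Sum.inr _ => Matrix.fromBlocks 0 (parityDiag ε 1 0) (parityDiag ε 0 (-1)) 0

lemma parityDiag_mul (ε : T → Bool) (x y x' y' : ℂ) :
    parityDiag ε x y * parityDiag ε x' y' = parityDiag ε (x * x') (y * y') := by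
  rw [parityDiag, parityDiag, parityDiag, Matrix.diagonal_mul_diagonal]
  congr 1
  ext1 t
  split_ifs <;> rfl

lemma parityDiag_mul_odd {ε : T → Bool} {A : Matrix T T ℂ} (hA : ∀ r s, A r s ≠ 0 → ε r ≠ ε s)
    (x y : ℂ) : parityDiag ε x y * A = A * parityDiag ε y x := by
  ext r s
  rw [parityDiag, parityDiag, Matrix.diagonal_mul, Matrix.mul_diagonal]
  by_cases h : A r s = 0
  · simp [h]
  · have := hA r s h
    cases h1 : ε r <;> cases h2 : ε s <;> simp_all [mul_comm]

lemma newGen_anticomm_offDiag {ε : T → Bool} {A : Matrix T T ℂ}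
    (hA : ∀ r s, A r s ≠ 0 → ε r ≠ ε s) (a : Unit ⊕ Unit) :
    newGen ε a * offDiag A = -(offDiag A * newGen ε a) := by
  have hneg : ∀ x y : ℂ, parityDiag ε (-x) (-y) = -parityDiag ε x y := by
    intro x y
    ext r s
    simp only [parityDiag, Matrix.diagonal_apply, Matrix.neg_apply]
    split_ifs <;> simp
  have h := hneg 1 0
  rw [neg_zero] at h
  rcases a with a | a <;>
    simp only [newGen, offDiag, Matrix.fromBlocks_multiply, Matrix.fromBlocks_neg,
      parityDiag_mul_odd hA, h, zero_mul, mul_zero, zero_add, add_zero, mul_neg, neg_zero] <;>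
    simp [← mul_neg, ← hneg]

lemma newGen_anticomm (ε : T → Bool) (a b : Unit ⊕ Unit) :
    newGen ε a * newGen ε b + newGen ε b * newGen ε a = if b = a.swap then 1 else 0 := by
  have h0 : parityDiag ε 0 0 = (0 : Matrix T T ℂ) := by simp [parityDiag]
  have h1 : parityDiag ε 0 1 + parityDiag ε 1 0 = (1 : Matrix T T ℂ) := by
    rw [parityDiag, parityDiag, Matrix.diagonal_add, ← Matrix.diagonal_one]
    congr 1
    ext1 t
    split_ifs <;> simp
  rcases a with a | a <;> rcases b with b | b <;>
    simp [newGen, Matrix.fromBlocks_multiply, Matrix.fromBlocks_add, parityDiag_mul, h0, h1,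
      add_comm (parityDiag ε 1 0)]

lemma offDiag_anticomm (A B : Matrix T T ℂ) :
    offDiag A * offDiag B + offDiag B * offDiag A =
      Matrix.fromBlocks (A * B + B * A) 0 0 (A * B + B * A) := by
  simp [offDiag, Matrix.fromBlocks_multiply, Matrix.fromBlocks_add]

/-- Adding one pair of generators doubles the Fock space. The parity of the new space is that of
its two blocks, and the grading is shifted by `± x / 2` so that the new generators have weights
`∓ x` while the weights of the old ones are unchanged. -/
def FockData.succ {ε : T → Bool} {k : ℕ} {δ : Fin k → ℚ} (F : FockData T ε k δ) (x : ℚ) :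
    FockData (T ⊕ T) (Sum.elim (fun _ => true) fun _ => false) (k + 1) (Fin.cons x δ) where
  g := Sum.elim (fun t => F.g t + if ε t then -x / 2 else x / 2)
    (fun t => F.g t + if ε t then x / 2 else -x / 2)
  γ := Sum.elim (Fin.cons (newGen ε (Sum.inl ())) fun i => offDiag (F.γ (Sum.inl i)))
    (Fin.cons (newGen ε (Sum.inr ())) fun i => offDiag (F.γ (Sum.inr i)))
  odd a r s := by
    rcases r with r | r <;> rcases s with s | s <;> rcases a with a | a <;>
      refine Fin.cases ?_ (fun i => ?_) a <;> simp [newGen, offDiag]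
  graded a r s h := by
    have key : ∀ (A : Matrix T T ℂ) (y : ℚ), (∀ r s, A r s ≠ 0 → ε r ≠ ε s) →
        (∀ r s, A r s ≠ 0 → F.g s - F.g r = y) → offDiag A r s ≠ 0 →
        Sum.elim (fun t => F.g t + if ε t then -x / 2 else x / 2)
          (fun t => F.g t + if ε t then x / 2 else -x / 2) s -
        Sum.elim (fun t => F.g t + if ε t then -x / 2 else x / 2)
          (fun t => F.g t + if ε t then x / 2 else -x / 2) r = y := by
      intro A y h1 h2 h3
      rcases r with r | r <;> rcases s with s | s <;> simp [offDiag] at h3 ⊢ <;>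
      · have h4 := h1 r s h3
        have h5 := h2 r s h3
        cases e1 : ε r <;> cases e2 : ε s <;> simp_all
    rcases a with a | a <;> revert h <;> refine Fin.cases ?_ (fun i => ?_) a <;> intro h
    · rcases r with r | r <;> rcases s with s | s <;>
        simp [newGen, parityDiag, Matrix.diagonal_apply] at h ⊢
      all_goals
        obtain ⟨rfl, h⟩ := h
        simp [h]
        ring
    · exact key _ _ (F.odd _) (F.graded (Sum.inl i)) h
    · rcases r with r | r <;> rcases s with s | s <;>
        simp [newGen, parityDiag, Matrix.diagonal_apply] at h ⊢
      all_goals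
        obtain ⟨rfl, h⟩ := h
        simp [h]
        ring
    · exact key _ _ (F.odd _) (F.graded (Sum.inr i)) h
  anticomm a b := by
    have hold : ∀ a b, offDiag (F.γ a) * offDiag (F.γ b) + offDiag (F.γ b) * offDiag (F.γ a) =
        if b = a.swap then 1 else 0 := by
      intro a b
      rw [offDiag_anticomm, F.anticomm]
      split_ifs <;> simp
    have hmix : ∀ a b, newGen ε a * offDiag (F.γ b) + offDiag (F.γ b) * newGen ε a = 0 := by
      intro a b
      rw [newGen_anticomm_offDiag (F.odd b), neg_add_cancel]
    have hmix' : ∀ a b, offDiag (F.γ b) * newGen ε a + newGen ε a * offDiag (F.γ b) = 0 := by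
      intro a b
      rw [add_comm, hmix]
    rcases a with a | a <;> rcases b with b | b <;> refine Fin.cases ?_ (fun i => ?_) a <;>
      refine Fin.cases ?_ (fun j => ?_) b <;>
      simp [hold, hmix, hmix', newGen_anticomm, Fin.succ_ne_zero, (Fin.succ_ne_zero _).symm]
  -- The new creator is moved past the old annihilators. The product of the two new generators is
  -- diagonal, and its supertrace against the old product is minus the old supertrace.
  trace_ne := by
    set P := (List.ofFn fun i => F.γ (Sum.inl i)).prod * (List.ofFn fun i => F.γ (Sum.inr i)).prod
      with hP
    have h1 : ∀ f : Fin k → Matrix T T ℂ,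
        (List.ofFn fun i => offDiag (f i)) = (List.ofFn f).map offDiag := by
      intro f
      rw [List.map_ofFn]
      rfl
    have h2 : ((List.ofFn fun i => F.γ (Sum.inl i)).map offDiag).prod *
        ((List.ofFn fun i => F.γ (Sum.inr i)).map offDiag).prod = Matrix.fromBlocks P 0 0 P := by
      rw [← List.prod_append, ← List.map_append, prod_map_offDiag_of_even (by simp),
        List.prod_append]
    have h3 := mul_prod_of_anticomm (newGen ε (Sum.inr ()))
      ((List.ofFn fun i => F.γ (Sum.inl i)).map offDiag) (by
        intro a ha
        obtain ⟨b, hb, rfl⟩ := List.mem_map.mp ha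
        obtain ⟨i, rfl⟩ := List.mem_ofFn.mp hb
        exact newGen_anticomm_offDiag (F.odd _) _)
    have h4 : ∀ f : Fin k → Matrix T T ℂ, ∀ a,
        (List.ofFn (Fin.cons (newGen ε a) fun i => offDiag (f i) :
          Fin (k + 1) → Matrix (T ⊕ T) (T ⊕ T) ℂ)).prod =
        newGen ε a * ((List.ofFn f).map offDiag).prod := by
      intro f a
      rw [List.ofFn_succ, List.prod_cons, ← h1]
      simp
    simp only [Sum.elim_inl, Sum.elim_inr, h4]
    have h5 : parityDiag (Sum.elim (fun _ => true) fun _ => false : T ⊕ T → Bool) 1 (-1) =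
        Matrix.fromBlocks 1 0 0 (-1) := by
      ext (r | r) (s | s) <;> simp [parityDiag, Matrix.diagonal_apply, Matrix.one_apply]
      split_ifs <;> simp
    have h6 : (Matrix.fromBlocks 1 0 0 (-1) * (newGen ε (Sum.inl ()) * newGen ε (Sum.inr ()) *
        Matrix.fromBlocks P 0 0 P)).trace = -(parityDiag ε 1 (-1) * P).trace := by
      have h7 : parityDiag ε 1 (-1) = parityDiag ε 1 0 - (parityDiag ε 0 1 : Matrix T T ℂ) := by
        ext r s
        simp only [parityDiag, Matrix.sub_apply, Matrix.diagonal_apply]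
        split_ifs <;> simp
      rw [h7, sub_mul, Matrix.trace_sub]
      simp [newGen, Matrix.fromBlocks_multiply, parityDiag_mul, Matrix.trace,
        sub_eq_add_neg]
    rw [h5]
    have h8 : ∀ s : Matrix (T ⊕ T) (T ⊕ T) ℂ, s = 1 ∨ s = -1 →
        newGen ε (Sum.inr ()) * ((List.ofFn fun i => F.γ (Sum.inl i)).map offDiag).prod =
          s * (((List.ofFn fun i => F.γ (Sum.inl i)).map offDiag).prod * newGen ε (Sum.inr ())) →
        newGen ε (Sum.inl ()) * ((List.ofFn fun i => F.γ (Sum.inl i)).map offDiag).prod *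
          (newGen ε (Sum.inr ()) * ((List.ofFn fun i => F.γ (Sum.inr i)).map offDiag).prod) =
        s * (newGen ε (Sum.inl ()) * newGen ε (Sum.inr ()) * Matrix.fromBlocks P 0 0 P) := by
      rintro s (rfl | rfl) h
      · rw [one_mul] at h ⊢
        rw [← h2, ← mul_assoc, mul_assoc (newGen ε (Sum.inl ())), ← h]
        simp only [mul_assoc]
      · rw [neg_one_mul] at h ⊢
        rw [← h2, ← mul_assoc, mul_assoc (newGen ε (Sum.inl ())), ← neg_eq_iff_eq_neg.mpr h]
        simp only [mul_assoc, neg_mul, mul_neg]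
    rw [h8 _ (neg_one_pow_eq_or _ _) h3]
    rcases neg_one_pow_eq_or (Matrix (T ⊕ T) (T ⊕ T) ℂ)
      ((List.ofFn fun i => F.γ (Sum.inl i)).map offDiag).length with h | h <;> rw [h]
    · rw [one_mul, h6, neg_ne_zero]
      exact F.trace_ne
    · rw [neg_one_mul, mul_neg, Matrix.trace_neg, h6, neg_neg]
      exact F.trace_ne

lemma exists_fockData (k : ℕ) (δ : Fin k → ℚ) : ∃ (N : ℕ) (ε : Fin N → Bool),
    Nonempty (FockData (Fin N) ε k δ) := by
  induction k with
  | zero => exact ⟨_, _, ⟨(FockData.zero δ).reindex (Equiv.ofUnique Unit (Fin 1))⟩⟩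
  | succ k ih =>
    obtain ⟨N, ε, ⟨F⟩⟩ := ih (Fin.tail δ)
    have F' := F.succ (δ 0)
    rw [Fin.cons_self_tail] at F'
    exact ⟨_, _, ⟨F'.reindex finSumFinEquiv⟩⟩

/-- Fock data with equally many even and odd basis vectors. -/
lemma exists_fockData_succ (k : ℕ) (δ : Fin (k + 1) → ℚ) : ∃ N : ℕ,
    Nonempty (FockData (Fin N ⊕ Fin N) (Sum.elim (fun _ => true) fun _ => false) (k + 1) δ) := by
  obtain ⟨N, ε, ⟨F⟩⟩ := exists_fockData k (Fin.tail δ)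
  have F' := F.succ (δ 0)
  rw [Fin.cons_self_tail] at F'
  exact ⟨N, ⟨F'⟩⟩

end Clifford

/-! ### Koszul matrix factorisations -/

section Koszul

variable {k N n m : ℕ} {δ : Fin k → ℚ}

/-- The parity of the standard basis of `ℂ ^ N ⊕ ℂ ^ N`. -/
def blockParity (N : ℕ) : Fin N ⊕ Fin N → Bool := Sum.elim (fun _ => true) fun _ => false

variable (F : FockData (Fin N ⊕ Fin N) (blockParity N) k δ)

lemma FockData.parityDiag_mul_γ (a : Fin k ⊕ Fin k) :
    parityDiag (blockParity N) 1 (-1) * F.γ a = -(F.γ a * parityDiag (blockParity N) 1 (-1)) := by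
  rw [parityDiag_mul_odd (F.odd a), ← mul_neg]
  congr 1
  ext r s
  simp only [parityDiag, Matrix.diagonal_apply, Matrix.neg_apply]
  split_ifs <;> simp

/-- The supertrace of a word in fewer than `2 k` generators vanishes: if `γ_a` is missing, its
partner anticommutes with the word, and `1` is the anticommutator of the two. -/
lemma FockData.trace_word_eq_zero (t : List (Fin k ⊕ Fin k)) (ht : t.length < k + k) :
    (parityDiag (blockParity N) 1 (-1) * (t.map F.γ).prod).trace = 0 := by
  obtain ⟨a, ha⟩ : ∃ a, a ∉ t := by
    by_contra! hcon
    have h1 := Finset.card_le_card (fun a _ => List.mem_toFinset.mpr (hcon a) :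
      Finset.univ ⊆ t.toFinset)
    have h2 := t.toFinset_card_le
    simp at h1
    omega
  have h := trace_anticomm_eq_zero (IsUnit.mk0 (2 : ℂ) two_ne_zero)
    (parityDiag (blockParity N) 1 (-1)) (F.γ a.swap) (F.γ a) [] (t.map F.γ)
    (F.parityDiag_mul_γ _) (F.parityDiag_mul_γ _) (by simp)
    (by
      intro b hb
      obtain ⟨c, -, rfl⟩ := List.mem_map.mp hb
      exact F.parityDiag_mul_γ _) (by simp)
    (by
      intro b hb
      obtain ⟨c, hc, rfl⟩ := List.mem_map.mp hb
      rw [eq_neg_iff_add_eq_zero, F.anticomm, if_neg]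
      rintro rfl
      exact ha (by simpa using hc))
  rw [F.anticomm, if_pos (by simp)] at h
  simpa using h

/-- The matrix `∑ₐ qₐ γₐ`. -/
def FockData.mat (q : Fin k ⊕ Fin k → PolyXY n m) : MatXY n m N :=
  ∑ a, q a • (C : ℂ →+* PolyXY n m).mapMatrix (F.γ a)

lemma FockData.mat_apply (q : Fin k ⊕ Fin k → PolyXY n m) (r s : Fin N ⊕ Fin N) :
    F.mat q r s = ∑ a, q a * C (F.γ a r s) := by
  simp [FockData.mat, Matrix.sum_apply]

lemma FockData.map_anticomm (a b : Fin k ⊕ Fin k) :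
    (C : ℂ →+* PolyXY n m).mapMatrix (F.γ a) * (C : ℂ →+* PolyXY n m).mapMatrix (F.γ b) +
      (C : ℂ →+* PolyXY n m).mapMatrix (F.γ b) * (C : ℂ →+* PolyXY n m).mapMatrix (F.γ a) =
      if b = a.swap then 1 else 0 := by
  rw [← map_mul, ← map_mul, ← map_add, F.anticomm]
  split_ifs <;> simp only [map_one, map_zero]

/-- Symmetrising the double sum leaves only the pairs of partners. -/
lemma FockData.mat_mul_self (q : Fin k ⊕ Fin k → PolyXY n m) :
    F.mat q * F.mat q = (∑ i, q (Sum.inl i) * q (Sum.inr i)) • (1 : MatXY n m N) := by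
  set G := fun a => (C : ℂ →+* PolyXY n m).mapMatrix (F.γ a) with hG
  have h1 : F.mat q * F.mat q = ∑ a, ∑ b, (q a * q b) • (G a * G b) := by
    rw [FockData.mat, Finset.sum_mul_sum]
    refine Finset.sum_congr rfl fun a _ => Finset.sum_congr rfl fun b _ => ?_
    rw [smul_mul_smul_comm]
  have h2 : F.mat q * F.mat q = ∑ a, ∑ b, (q a * q b) • (G b * G a) := by
    rw [h1, Finset.sum_comm]
    refine Finset.sum_congr rfl fun a _ => Finset.sum_congr rfl fun b _ => ?_
    rw [mul_comm (q b)]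
  have h3 : F.mat q * F.mat q + F.mat q * F.mat q =
      ∑ a, (q a * q a.swap) • (1 : MatXY n m N) := by
    conv_lhs => rw [h1]
    conv_lhs => enter [2]; rw [← h1, h2]
    rw [← Finset.sum_add_distrib]
    refine Finset.sum_congr rfl fun a _ => ?_
    rw [← Finset.sum_add_distrib, Finset.sum_eq_single a.swap]
    · rw [← smul_add, hG, F.map_anticomm, if_pos rfl]
    · intro b _ hb
      rw [← smul_add, hG, F.map_anticomm, if_neg hb, smul_zero]
    · simp
  rw [← two_smul ℂ, Fintype.sum_sum_type] at h3
  have h4 : ∑ i, (q (Sum.inr i) * q (Sum.swap (Sum.inr i))) • (1 : MatXY n m N) =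
      ∑ i, (q (Sum.inl i) * q (Sum.swap (Sum.inl i))) • (1 : MatXY n m N) := by
    refine Finset.sum_congr rfl fun i _ => ?_
    rw [mul_comm]
    rfl
  rw [h4, ← two_smul ℂ] at h3
  rw [Finset.sum_smul]
  exact smul_right_injective _ (two_ne_zero (α := ℂ)) h3

lemma FockData.isGradedMF {wx : Fin n → ℚ} {wy : Fin m → ℚ} {V₁ : MvPolynomial (Fin n) ℂ}
    {V₂ : MvPolynomial (Fin m) ℂ} {q : Fin k ⊕ Fin k → PolyXY n m}
    (hq : ∑ i, q (Sum.inl i) * q (Sum.inr i) = diffPot V₁ V₂)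
    (hl : ∀ i, IsWeightedHomogeneous (Sum.elim wx wy) (q (Sum.inl i)) (1 - δ i))
    (hr : ∀ i, IsWeightedHomogeneous (Sum.elim wx wy) (q (Sum.inr i)) (1 + δ i)) :
    IsGradedMF wx wy V₁ V₂ (F.mat q) where
  odd₁ := by
    ext1 r s
    change F.mat q (Sum.inl r) (Sum.inl s) = 0
    rw [F.mat_apply]
    refine Finset.sum_eq_zero fun a _ => ?_
    rw [not_not.mp fun h => F.odd a (Sum.inl r) (Sum.inl s) h rfl, map_zero, mul_zero]
  odd₂ := by
    ext1 r s
    change F.mat q (Sum.inr r) (Sum.inr s) = 0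
    rw [F.mat_apply]
    refine Finset.sum_eq_zero fun a _ => ?_
    rw [not_not.mp fun h => F.odd a (Sum.inr r) (Sum.inr s) h rfl, map_zero, mul_zero]
  sq := by rw [F.mat_mul_self, hq]
  graded := by
    refine ⟨F.g, fun r s => ?_⟩
    rw [F.mat_apply]
    refine IsWeightedHomogeneous.sum _ _ _ fun a _ => ?_
    by_cases h : F.γ a r s = 0
    · rw [h, map_zero, mul_zero]
      exact isWeightedHomogeneous_zero _ _ _
    · rw [F.graded a r s h, mul_comm]
      rcases a with i | i
      · exact ((hl i).C_mul _).weight_congr (by simp; ring)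
      · exact ((hr i).C_mul _).weight_congr (by simp; ring)

/-- As the supertraces of short words in the generators vanish, the supertrace of the derivatives
of `∑ₐ qₐ γₐ` is a multiple of the Jacobian determinant of the `qₐ`. -/
lemma FockData.strDeriv_mat (q : Fin k ⊕ Fin k → PolyXY k k) :
    strDeriv (F.mat q) = (Matrix.of fun z a => pderiv z (q a)).det *
      C (parityDiag (blockParity N) 1 (-1) * ((List.ofFn fun i => F.γ (Sum.inl i)).prod *
        (List.ofFn fun i => F.γ (Sum.inr i)).prod)).trace := by
  set ι : Matrix (Fin N ⊕ Fin N) (Fin N ⊕ Fin N) ℂ →+* MatXY k k N :=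
    (C : ℂ →+* PolyXY k k).mapMatrix with hι
  set e : Fin k ⊕ Fin k ≃ Fin (k + k) := finSumFinEquiv with he
  set M := Matrix.of fun z a => pderiv z (q a) with hM
  have hσ : sigma k k N = ι (parityDiag (blockParity N) 1 (-1)) := by
    ext1 r s
    rcases r with r | r <;> rcases s with s | s <;> by_cases h : r = s <;>
      simp [sigma, hι, parityDiag, blockParity, h]
  have hder : ∀ z, matDeriv z (F.mat q) = ∑ i, M z (e.symm i) • ι (F.γ (e.symm i)) := by
    intro z
    rw [Equiv.sum_comp e.symm (fun a => M z a • ι (F.γ a))]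
    ext1 r s
    rw [matDeriv, Matrix.map_apply, F.mat_apply, Matrix.sum_apply, map_sum]
    refine Finset.sum_congr rfl fun a _ => ?_
    simp [hM, hι, mul_comm]
  have happ : ∀ f : Fin k ⊕ Fin k → MatXY k k N,
      (List.ofFn fun i => f (Sum.inl i)).prod * (List.ofFn fun i => f (Sum.inr i)).prod =
        (List.ofFn fun i => f (e.symm i)).prod := by
    intro f
    rw [← List.prod_append, ← List.ofFn_fin_append]
    congr 2
    ext1 i
    refine Fin.addCases (fun i => ?_) (fun i => ?_) i
    · rw [Fin.append_left, he, finSumFinEquiv_symm_apply_castAdd]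
    · rw [Fin.append_right, he, finSumFinEquiv_symm_apply_natAdd]
  have key := trace_prod_eq_det_mul ((IsUnit.mk0 (2 : ℂ) two_ne_zero).map (C : ℂ →+* PolyXY k k))
    (sigma k k N) 0 [] (fun i => ι (F.γ (e.symm i))) (fun _ _ => 0)
    (fun i j => if e.symm j = (e.symm i).swap then 1 else 0) (by simp) (by simp)
    (fun i => by rw [hσ, ← map_mul, F.parityDiag_mul_γ, map_neg, map_mul])
    (by simp) (by simp) (by simp)
    (by
      intro i j
      rw [hι, F.map_anticomm]
      split_ifs <;> simp)
    (by
      intro i j t ht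
      have h := F.trace_word_eq_zero (t.map e.symm) (by rw [List.length_map]; omega)
      have h' := congrArg (C : ℂ →+* PolyXY k k) h
      rw [map_trace_eq, map_mul, map_list_prod, map_zero, List.map_map, List.map_map] at h'
      rw [hσ, List.prod_nil, one_mul]
      exact mul_eq_zero_of_right _ h')
    (M.submatrix e.symm e.symm)
  rw [Matrix.det_submatrix_equiv_self, List.prod_nil, one_mul, one_mul] at key
  rw [strDeriv, str, happ fun z => matDeriv z (F.mat q)]
  simp only [hder]
  refine key.trans ?_
  rw [map_trace_eq, map_mul, map_mul, map_list_prod, map_list_prod, List.map_ofFn, List.map_ofFn,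
    hσ, ← happ fun a => ι (F.γ a)]
  rfl

/-- A potential is the pairing of the coordinate differences `xᵢ - yᵢ` with homogeneous
polynomials `bᵢ`. -/
lemma IsPotential.exists_koszul {w : Fin k → ℚ} {V : MvPolynomial (Fin k) ℂ}
    (hV : IsPotential w V) : ∃ b : Fin k → PolyXY k k,
      ∑ i, (X (Sum.inl i) - X (Sum.inr i)) * b i = diffPot V V ∧
      (∀ i, IsWeightedHomogeneous (Sum.elim w w) (b i) (2 - w i)) ∧
      ∀ i, constantCoeff (b i) = 0 := by
  set I : Ideal (PolyXY k k) :=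
    Ideal.span (Set.range fun i => X (Sum.inl i) - X (Sum.inr i)) with hI
  have h1 : (Ideal.Quotient.mkₐ ℂ I).comp (rename Sum.inl) =
      (Ideal.Quotient.mkₐ ℂ I).comp (rename Sum.inr) := by
    ext i
    simp only [AlgHom.comp_apply, rename_X]
    exact Ideal.Quotient.eq.mpr (Ideal.subset_span ⟨i, rfl⟩)
  have h2 : diffPot V V ∈ I := Ideal.Quotient.eq.mp (DFunLike.congr_fun h1 V)
  obtain ⟨c, hc⟩ := Ideal.mem_span_range_iff_exists_fun.mp h2
  have hX : ∀ i, IsWeightedHomogeneous (Sum.elim w w)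
      (X (Sum.inl i) - X (Sum.inr i) : PolyXY k k) (w i) := fun i =>
    (isWeightedHomogeneous_X ℂ (Sum.elim w w) (Sum.inl i)).sub
      (isWeightedHomogeneous_X ℂ (Sum.elim w w) (Sum.inr i))
  have hdiff : IsWeightedHomogeneous (Sum.elim w w) (diffPot V V) 2 :=
    (hV.homogeneous.rename_weight (ι := Sum.inl) (w' := Sum.elim w w) fun _ => rfl).sub
      (hV.homogeneous.rename_weight (ι := Sum.inr) (w' := Sum.elim w w) fun _ => rfl)
  have hb : ∑ i, (X (Sum.inl i) - X (Sum.inr i)) *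
      weightedHomogeneousComponent (Sum.elim w w) (2 - w i) (c i) = diffPot V V := by
    rw [← hdiff.weightedHomogeneousComponent_same, ← hc, map_sum]
    refine Finset.sum_congr rfl fun i _ => ?_
    rw [component_mul_right (hX i), mul_comm]
  refine ⟨_, hb, fun i => weightedHomogeneousComponent_isWeightedHomogeneous _ _, fun i => ?_⟩
  -- At the origin, the derivative by `xᵢ` of the left hand side is `bᵢ`.
  have h3 := congrArg (fun p => constantCoeff (pderiv (Sum.inl i) p)) hb
  simp only [pderiv_inl_diffPot, constantCoeff_rename, constantCoeff_pderiv_of_mem hV.mem_sq,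
    map_sum, Derivation.leibniz, map_add, smul_eq_mul, map_mul, map_sub, constantCoeff_X,
    sub_self, zero_mul, zero_add, pderiv_X] at h3
  rw [Finset.sum_eq_single i (by intro j _ hj; simp [hj]) (by simp)] at h3
  simpa using h3

end Koszul

/-! ### Equivalences from changes of variables -/

section GradedAut

variable {k : ℕ} {w w' : Fin k → ℚ}

/-- The derivatives `(∂_{xₗ} + ∂_{yₗ}) bᵢ` of the coefficients of a Koszul factorisation. The
derivation `∂_{xₗ} + ∂_{yₗ}` annihilates all differences `xᵢ - yᵢ`. -/
def koszulHessian (b : Fin k → PolyXY k k) : Matrix (Fin k) (Fin k) (PolyXY k k) :=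
  Matrix.of fun l i => pderiv (Sum.inl l) (b i) + pderiv (Sum.inr l) (b i)

lemma sum_mul_koszulHessian {V : MvPolynomial (Fin k) ℂ} {b : Fin k → PolyXY k k}
    (hb : ∑ i, (X (Sum.inl i) - X (Sum.inr i)) * b i = diffPot V V) (l : Fin k) :
    ∑ i, (X (Sum.inl i) - X (Sum.inr i)) * koszulHessian b l i =
      rename Sum.inl (pderiv l V) - rename Sum.inr (pderiv l V) := by
  rw [← pderiv_inl_diffPot V V, sub_eq_add_neg, ← pderiv_inr_diffPot V V, ← hb, map_sum, map_sum,
    ← Finset.sum_add_distrib]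
  refine Finset.sum_congr rfl fun i _ => ?_
  simp only [koszulHessian, Matrix.of_apply, Derivation.leibniz, smul_eq_mul, map_sub, pderiv_X]
  by_cases h : l = i
  · subst h
    simp
    ring
  · have h' : i ≠ l := fun e => h e.symm
    simp [h']
    ring

lemma pderiv_eq_sum_evalRight {V : MvPolynomial (Fin k) ℂ}
    (hV : V ∈ idealOfVars (Fin k) ℂ ^ 2) {b : Fin k → PolyXY k k}
    (hb : ∑ i, (X (Sum.inl i) - X (Sum.inr i)) * b i = diffPot V V) (l : Fin k) :
    pderiv l V = ∑ i, (evalRight k k).mapMatrix (koszulHessian b) l i * X i := by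
  have h := congrArg (evalRight k k) (sum_mul_koszulHessian hb l)
  rw [map_sub, evalRight_rename_inr, evalRight_rename_inl, constantCoeff_pderiv_of_mem hV, map_zero,
    zero_sub, map_sum, eq_neg_iff_add_eq_zero, add_comm, ← eq_neg_iff_add_eq_zero] at h
  rw [h, ← Finset.sum_neg_distrib]
  refine Finset.sum_congr rfl fun i _ => ?_
  simp [evalRight, mul_comm]

lemma pderiv_eq_sum_evalLeft {V : MvPolynomial (Fin k) ℂ}
    (hV : V ∈ idealOfVars (Fin k) ℂ ^ 2) {b : Fin k → PolyXY k k}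
    (hb : ∑ i, (X (Sum.inl i) - X (Sum.inr i)) * b i = diffPot V V) (l : Fin k) :
    pderiv l V = ∑ i, (evalLeft k k).mapMatrix (koszulHessian b) l i * X i := by
  have h := congrArg (evalLeft k k) (sum_mul_koszulHessian hb l)
  rw [map_sub, evalLeft_rename_inr, evalLeft_rename_inl, constantCoeff_pderiv_of_mem hV, map_zero,
    sub_zero, map_sum] at h
  rw [← h]
  refine Finset.sum_congr rfl fun i _ => ?_
  simp [evalLeft, mul_comm]

/-- The coefficients of the Koszul factorisation of `V(x) - V(φ(y))`. -/
def koszulCoeff (φ : MvPolynomial (Fin k) ℂ ≃ₐ[ℂ] MvPolynomial (Fin k) ℂ)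
    (b : Fin k → PolyXY k k) : Fin k ⊕ Fin k → PolyXY k k :=
  Sum.elim (fun i => X (Sum.inl i) - rename Sum.inr (φ (X i))) fun i => substPoly k φ (b i)

/-- The Jacobian matrix has the blocks `1`, `B_x`, `-J` and `J B_y`, with `J` the Jacobian matrix of
`φ`, so its determinant is that of `J (B_x + B_y)`. -/
lemma det_pderiv_koszulCoeff (φ : MvPolynomial (Fin k) ℂ ≃ₐ[ℂ] MvPolynomial (Fin k) ℂ)
    (b : Fin k → PolyXY k k) :
    (Matrix.of fun z a => pderiv z (koszulCoeff φ b a)).det =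
      C (linearPart φ).det * substPoly k φ (koszulHessian b).det := by
  set R : MvPolynomial (Fin k) ℂ →+* PolyXY k k := (rename Sum.inr : _ →ₐ[ℂ] _).toRingHom with hR
  set S : PolyXY k k →+* PolyXY k k := (substPoly k φ).toRingHom with hS
  set Bx : Matrix (Fin k) (Fin k) (PolyXY k k) := Matrix.of fun l i => pderiv (Sum.inl l) (b i)
    with hBx
  set By : Matrix (Fin k) (Fin k) (PolyXY k k) := Matrix.of fun l i => pderiv (Sum.inr l) (b i)
    with hBy
  have h1 : (Matrix.of fun z a => pderiv z (koszulCoeff φ b a)) =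
      Matrix.fromBlocks 1 (S.mapMatrix Bx) (-R.mapMatrix (jacobian φ))
        (R.mapMatrix (jacobian φ) * S.mapMatrix By) := by
    ext1 z a
    rcases z with z | z <;> rcases a with a | a <;>
      simp only [koszulCoeff, Matrix.of_apply, Sum.elim_inl, Sum.elim_inr,
        Matrix.fromBlocks_apply₁₁, Matrix.fromBlocks_apply₁₂, Matrix.fromBlocks_apply₂₁,
        Matrix.fromBlocks_apply₂₂, map_sub, pderiv_inl_rename_inr, pderiv_inl_substPoly,
        pderiv_inr_substPoly, pderiv_rename Sum.inr_injective]
    · rw [sub_zero, pderiv_X, Matrix.one_apply, Pi.single_apply]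
      simp [eq_comm]
    · rfl
    · rw [pderiv_X_of_ne (by simp), zero_sub]
      rfl
    · rfl
  have h2 : koszulHessian b = Bx + By := rfl
  have h3 : substPoly k φ (koszulHessian b).det = (S.mapMatrix (koszulHessian b)).det :=
    RingHom.map_det S _
  have h4 : (R.mapMatrix (jacobian φ)).det = C (linearPart φ).det := by
    rw [← RingHom.map_det, jacobian_det]
    exact rename_C _ _
  rw [h1, Matrix.det_fromBlocks_one₁₁, neg_mul, sub_neg_eq_add, ← mul_add, ← map_add, add_comm,
    ← h2, Matrix.det_mul, h3, h4]

/-- A potential is orbifold equivalent to its transforms under graded automorphisms: substitute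
the automorphism into the Koszul factorisation of `V(x) - V(y)`. -/
theorem IsPotential.orbifoldEquivalent {w w' : Fin (k + 1) → ℚ} {V : MvPolynomial (Fin (k + 1)) ℂ}
    (hV : IsPotential w V) {φ : MvPolynomial (Fin (k + 1)) ℂ ≃ₐ[ℂ] MvPolynomial (Fin (k + 1)) ℂ}
    (hφ : IsGradedAut w w' φ) (hw' : ∀ i, 0 < w' i) : OrbifoldEquivalent V (φ V) := by
  have hw := hV.weight_pos
  obtain ⟨b, hb, hbw, hb0⟩ := hV.exists_koszul
  obtain ⟨N, ⟨F⟩⟩ := exists_fockData_succ k fun i => 1 - w i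
  change FockData _ (blockParity N) _ _ at F
  have hV' := hV.map hφ hw'
  obtain ⟨D, -⟩ := hV.exists_data
  obtain ⟨D', -⟩ := hV'.exists_data
  set q := koszulCoeff φ b with hq
  have hgrade : ∀ j, IsWeightedHomogeneous (Sum.elim w w')
      (Sum.elim (fun i => X (Sum.inl i)) (fun j => rename Sum.inr (φ (X j))) j :
        PolyXY (k + 1) (k + 1)) (Sum.elim w w j) := by
    rintro (i | j)
    · exact isWeightedHomogeneous_X ℂ (Sum.elim w w') (Sum.inl i)
    · exact (hφ j).rename_weight (ι := Sum.inr) (w' := Sum.elim w w') fun _ => rfl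
  have hmf : IsGradedMF w w' V (φ V) (F.mat q) := by
    refine F.isGradedMF ?_ (fun i => ?_) fun i => ?_
    · rw [← substPoly_diffPot, ← hb, map_sum]
      refine Finset.sum_congr rfl fun i _ => ?_
      simp [hq, koszulCoeff, substPoly]
    · rw [sub_sub_cancel]
      exact (hgrade (Sum.inl i)).sub (hgrade (Sum.inr i))
    · exact ((hbw i).aeval_weight hgrade).weight_congr (by ring)
  have hq0 : ∀ a, constantCoeff (q a) = 0 := by
    rintro (i | i)
    · simp [hq, koszulCoeff, constantCoeff_rename, hφ.constantCoeff_X hw]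
    · exact (constantCoeff_substPoly (hφ.constantCoeff_X hw) (b i)).trans (hb0 i)
  obtain ⟨c, hc0, hc⟩ : ∃ c : ℂ, c ≠ 0 ∧ strDeriv (F.mat q) =
      C (linearPart φ).det * substPoly (k + 1) φ (koszulHessian b).det * C c :=
    ⟨_, F.trace_ne, by rw [F.strDeriv_mat, det_pderiv_koszulCoeff]⟩
  have hdet := linearPart_det_ne_zero φ
  have hR : constantCoeff (qR (φ V) (F.mat q)) ≠ 0 := by
    set B := (evalRight (k + 1) (k + 1)).mapMatrix (koszulHessian b) with hB
    obtain ⟨A, hA, hAdet⟩ := hφ.exists_matrix hw hw'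
    have h1 := residue_transform (f := fun i => φ (X i)) D'
      (jacobian φ * (φ : _ →+* MvPolynomial (Fin (k + 1)) ℂ).mapMatrix B) (by
        intro j
        simp only [Matrix.mul_apply, Finset.sum_mul]
        rw [Finset.sum_comm, pderiv_aut]
        refine Finset.sum_congr rfl fun l _ => ?_
        rw [pderiv_eq_sum_evalRight hV.mem_sq hb l, map_sum, Finset.mul_sum]
        refine Finset.sum_congr rfl fun i _ => ?_
        rw [map_mul, mul_assoc]
        rfl) 1
    rw [residue_of_X_eq A hA, hAdet, map_one, mul_one, mul_one, Matrix.det_mul, jacobian_det,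
      ← RingHom.map_det] at h1
    have h2 : evalRight (k + 1) (k + 1) (strDeriv (F.mat q)) =
        C c * (C (linearPart φ).det * φ B.det) := by
      have h3 : evalRight (k + 1) (k + 1) (koszulHessian b).det = B.det :=
        AlgHom.map_det _ _
      rw [hc, map_mul, map_mul, evalRight_substPoly, h3, ← algebraMap_eq, AlgHom.commutes,
        ← algebraMap_eq, AlgHom.commutes]
      ring
    rw [constantCoeff_qR hV', h2, residue_C_mul]
    refine mul_ne_zero (pow_ne_zero _ (by norm_num)) (mul_ne_zero hc0 ?_)
    exact h1 ▸ inv_ne_zero hdet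
  have hL : constantCoeff (qL V (F.mat q)) ≠ 0 := by
    set B := (evalLeft (k + 1) (k + 1)).mapMatrix (koszulHessian b) with hB
    have h1 := residue_det_mul_of_eq D B (fun l => pderiv_eq_sum_evalLeft hV.mem_sq hb l) 1
    rw [map_one, mul_one] at h1
    have h2 : evalLeft (k + 1) (k + 1) (strDeriv (F.mat q)) =
        C (c * (linearPart φ).det) * B.det := by
      have h3 : evalLeft (k + 1) (k + 1) (koszulHessian b).det = B.det := AlgHom.map_det _ _
      rw [hc, map_mul, map_mul, evalLeft_substPoly (hφ.constantCoeff_X hw), h3, C_mul,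
        ← algebraMap_eq, AlgHom.commutes, ← algebraMap_eq, AlgHom.commutes]
      ring
    rw [constantCoeff_qL hV, h2, residue_C_mul, h1, mul_one]
    exact mul_ne_zero (pow_ne_zero _ (by norm_num)) (mul_ne_zero hc0 hdet)
  refine ⟨w, w', N, F.mat q, ⟨hV, hV', hmf, ?_, ?_⟩, fun r s => ?_⟩
  · have h := hmf.homogeneous_qL hV
    rw [(h.weight_congr (h.weight_eq_zero hL)).eq_C hw']
    exact (IsUnit.mk0 _ hL).map C
  · have h := hmf.homogeneous_qR hV'
    rw [(h.weight_congr (h.weight_eq_zero hR)).eq_C hw]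
    exact (IsUnit.mk0 _ hR).map C
  · rw [F.mat_apply, map_sum]
    exact Finset.sum_eq_zero fun a _ => by rw [map_mul, hq0, zero_mul]

end GradedAut

/-! ### A criterion for potentials -/

section Criterion

variable {n : ℕ} {w : Fin n → ℚ} {V : MvPolynomial (Fin n) ℂ}

/-- By the Nullstellensatz, the Jacobi ring is finite-dimensional if the origin is the only
critical point. -/
lemma finite_quotient_of_zeros {f : Fin n → MvPolynomial (Fin n) ℂ}
    (h : ∀ x : Fin n → ℂ, (∀ i, eval x (f i) = 0) → x = 0) :
    Module.Finite ℂ (MvPolynomial (Fin n) ℂ ⧸ Ideal.span (Set.range f)) := by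
  set I := Ideal.span (Set.range f) with hI
  have hrad : ∀ i, X i ∈ I.radical := by
    intro i
    rw [← vanishingIdeal_zeroLocus_eq_radical (K := ℂ)]
    intro x hx
    have : x = 0 := h x fun j => by
      simpa [coe_aeval_eq_eval] using hx (f j) (Ideal.subset_span ⟨j, rfl⟩)
    simp [this]
  have : Algebra.IsIntegral ℂ (MvPolynomial (Fin n) ℂ ⧸ I) := by
    refine ⟨fun a => ?_⟩
    obtain ⟨p, rfl⟩ := Ideal.Quotient.mk_surjective a
    induction p using MvPolynomial.induction_on with
    | C r => exact isIntegral_algebraMap (R := ℂ) (x := r)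
    | add p q hp hq =>
      rw [map_add]
      exact hp.add hq
    | mul_X p i hp =>
      rw [map_mul]
      refine hp.mul ?_
      obtain ⟨k, hk⟩ := hrad i
      refine IsIntegral.of_pow (n := k + 1) (Nat.succ_pos k) ?_
      rw [← map_pow, Ideal.Quotient.eq_zero_iff_mem.mpr
        (by rw [pow_succ]; exact I.mul_mem_right _ hk)]
      exact isIntegral_zero
  exact Algebra.IsIntegral.finite

/-- Weights at most `1` force a polynomial of weight `2` to lie in `𝔪²`. -/
lemma isPotential_of_zeros (hw : ∀ i, 0 < w i) (hw' : ∀ i, w i ≤ 1)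
    (hV : IsWeightedHomogeneous w V 2)
    (h : ∀ x : Fin n → ℂ, (∀ i, eval x (pderiv i V) = 0) → x = 0) : IsPotential w V where
  weight_pos := hw
  homogeneous := hV
  mem_sq := by
    rw [mem_pow_idealOfVars_iff']
    intro d hd
    by_contra hcon
    have h1 := hV hcon
    have h2 : Finsupp.weight w d ≤ d.degree := by
      rw [Finsupp.weight_apply, Finsupp.degree_eq_sum, Finsupp.sum_fintype _ _ (by simp),
        Nat.cast_sum]
      refine Finset.sum_le_sum fun i _ => ?_
      rw [nsmul_eq_mul]
      exact mul_le_of_le_one_right (Nat.cast_nonneg _) (hw' i)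
    rw [h1] at h2
    have h3 : (2 : ℕ) ≤ d.degree := by exact_mod_cast h2
    omega
  finite_jac := finite_quotient_of_zeros h

end Criterion

/-! ### Linear and triangular automorphisms -/

section Automorphisms

variable {n : ℕ}

/-- The linear automorphism `yᵢ ↦ ∑ⱼ Aᵢⱼ yⱼ`. -/
def linearAut (A : Matrix (Fin n) (Fin n) ℂ) (hA : IsUnit A.det) :
    MvPolynomial (Fin n) ℂ ≃ₐ[ℂ] MvPolynomial (Fin n) ℂ :=
  have key : ∀ A B : Matrix (Fin n) (Fin n) ℂ, A * B = 1 →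
      (aeval fun i => ∑ j, C (B i j) * X j : MvPolynomial (Fin n) ℂ →ₐ[ℂ] _).comp
        (aeval fun i => ∑ j, C (A i j) * X j) = AlgHom.id ℂ (MvPolynomial (Fin n) ℂ) := by
    intro A B h
    ext1 i
    simp only [AlgHom.comp_apply, aeval_X, map_sum, map_mul, AlgHom.id_apply,
      aeval_C, algebraMap_eq, Finset.mul_sum]
    rw [Finset.sum_comm]
    have h1 : ∀ j, ∑ l, C (A i l) * (C (B l j) * X j) =
        (C ((1 : Matrix (Fin n) (Fin n) ℂ) i j) * X j : MvPolynomial (Fin n) ℂ) := by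
      intro j
      rw [← h, Matrix.mul_apply, map_sum, Finset.sum_mul]
      exact Finset.sum_congr rfl fun l _ => by rw [C_mul, mul_assoc]
    simp only [h1]
    rw [Finset.sum_eq_single i (by intro j _ hj; simp [hj.symm]) (by simp)]
    simp
  AlgEquiv.ofAlgHom (aeval fun i => ∑ j, C (A i j) * X j) (aeval fun i => ∑ j, C (A⁻¹ i j) * X j)
    (key A⁻¹ A (Matrix.nonsing_inv_mul A hA)) (key A A⁻¹ (Matrix.mul_nonsing_inv A hA))

lemma linearAut_X (A : Matrix (Fin n) (Fin n) ℂ) (hA : IsUnit A.det) (i : Fin n) :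
    linearAut A hA (X i) = ∑ j, C (A i j) * X j := aeval_X _ i

lemma isGradedAut_linearAut {A : Matrix (Fin n) (Fin n) ℂ} (hA : IsUnit A.det) {w w' : Fin n → ℚ}
    (h : ∀ i j, A i j ≠ 0 → w i = w' j) : IsGradedAut w w' (linearAut A hA) := by
  intro i
  rw [linearAut_X]
  refine IsWeightedHomogeneous.sum _ _ _ fun j _ => ?_
  by_cases hij : A i j = 0
  · rw [hij, C_0, zero_mul]
    exact isWeightedHomogeneous_zero _ _ _
  · rw [h i j hij]
    exact (isWeightedHomogeneous_X ℂ w' j).C_mul _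

/-- The automorphism `yᵢ ↦ yᵢ + p` for a polynomial `p` in the other variables. -/
def shear (i : Fin n) (p : MvPolynomial (Fin n) ℂ) (hp : ∀ s, aeval (Function.update X i s) p = p) :
    MvPolynomial (Fin n) ℂ ≃ₐ[ℂ] MvPolynomial (Fin n) ℂ :=
  have key : ∀ p : MvPolynomial (Fin n) ℂ, (∀ s, aeval (Function.update X i s) p = p) →
      (aeval (Function.update X i (X i + p)) : MvPolynomial (Fin n) ℂ →ₐ[ℂ] _).comp
        (aeval (Function.update X i (X i - p))) = AlgHom.id ℂ (MvPolynomial (Fin n) ℂ) := by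
    intro p hp
    ext1 j
    by_cases hj : j = i
    · subst hj
      rw [AlgHom.comp_apply, aeval_X, Function.update_self, map_sub, aeval_X, Function.update_self,
        hp, add_sub_cancel_right, AlgHom.id_apply]
    · simp [hj]
  AlgEquiv.ofAlgHom (aeval (Function.update X i (X i + p)))
    (aeval (Function.update X i (X i - p))) (key p hp) (by
      have := key (-p) fun s => by rw [map_neg, hp]
      rwa [sub_neg_eq_add, ← sub_eq_add_neg] at this)

lemma shear_X (i : Fin n) (p : MvPolynomial (Fin n) ℂ)
    (hp : ∀ s, aeval (Function.update X i s) p = p) (j : Fin n) :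
    shear i p hp (X j) = if j = i then X i + p else X j := by
  refine (aeval_X _ j).trans ?_
  by_cases hj : j = i
  · subst hj
    simp
  · simp [hj]

lemma isGradedAut_shear {i : Fin n} {p : MvPolynomial (Fin n) ℂ}
    (hp : ∀ s, aeval (Function.update X i s) p = p) {w : Fin n → ℚ}
    (h : IsWeightedHomogeneous w p (w i)) : IsGradedAut w w (shear i p hp) := by
  intro j
  rw [shear_X]
  split_ifs with hj
  · subst hj
    exact (isWeightedHomogeneous_X ℂ w j).add h
  · exact isWeightedHomogeneous_X ℂ w j

lemma IsGradedAut.trans {w w' w'' : Fin n → ℚ}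
    {φ ψ : MvPolynomial (Fin n) ℂ ≃ₐ[ℂ] MvPolynomial (Fin n) ℂ} (hφ : IsGradedAut w w' φ)
    (hψ : IsGradedAut w' w'' ψ) : IsGradedAut w w'' (φ.trans ψ) := fun j => hψ.apply (hφ j)

variable {k : ℕ} {w w' : Fin (k + 1) → ℚ} {V V₁ V₂ : MvPolynomial (Fin (k + 1)) ℂ}
  {φ ψ : MvPolynomial (Fin (k + 1)) ℂ ≃ₐ[ℂ] MvPolynomial (Fin (k + 1)) ℂ}

/-- Two graded transforms of one potential are orbifold equivalent. -/
lemma IsPotential.orbifoldEquivalent_of_apply_eq (hV : IsPotential w V) (hw' : ∀ i, 0 < w' i)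
    (hφ : IsGradedAut w w' φ) (hψ : IsGradedAut w w ψ) (h₁ : φ V = V₁) (h₂ : ψ V = V₂) :
    OrbifoldEquivalent V₁ V₂ := by
  have h := (hV.map hφ hw').orbifoldEquivalent (hφ.symm.trans hψ) hV.weight_pos
  rwa [AlgEquiv.trans_apply, AlgEquiv.symm_apply_apply, h₁, h₂] at h

lemma IsPotential.orbifoldEquivalent_right (hV : IsPotential w V) (hφ : IsGradedAut w w φ)
    (h : φ V = V₂) : OrbifoldEquivalent V V₂ := h ▸ hV.orbifoldEquivalent hφ hV.weight_pos

lemma isGradedAut_refl : IsGradedAut w w AlgEquiv.refl := isWeightedHomogeneous_X ℂ w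

lemma IsPotential.orbifoldEquivalent_left (hV : IsPotential w V) (hw' : ∀ i, 0 < w' i)
    (hφ : IsGradedAut w w' φ) (h : φ V = V₁) : OrbifoldEquivalent V₁ V :=
  hV.orbifoldEquivalent_of_apply_eq hw' hφ isGradedAut_refl h rfl

end Automorphisms

/-! ### Singularities in three variables -/

section Examples

lemma isWeightedHomogeneous_two {p q e : ℚ} (a b : ℕ) (h : a * p + b * q = e) :
    IsWeightedHomogeneous ![p, q] (X 0 ^ a * X 1 ^ b : MvPolynomial (Fin 2) ℂ) e :=
  (((isWeightedHomogeneous_X ℂ ![p, q] 0).pow a).mul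
    ((isWeightedHomogeneous_X ℂ ![p, q] 1).pow b)).weight_congr (by simpa using h)

lemma isWeightedHomogeneous_three {p q r e : ℚ} (a b c : ℕ) (h : a * p + b * q + c * r = e) :
    IsWeightedHomogeneous ![p, q, r] (X 0 ^ a * X 1 ^ b * X 2 ^ c : MvPolynomial (Fin 3) ℂ) e :=
  ((((isWeightedHomogeneous_X ℂ ![p, q, r] 0).pow a).mul
    ((isWeightedHomogeneous_X ℂ ![p, q, r] 1).pow b)).mul
    ((isWeightedHomogeneous_X ℂ ![p, q, r] 2).pow c)).weight_congr (by simpa using h)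

lemma exists_ne_zero_pow_eq {c : ℂ} (hc : c ≠ 0) {n : ℕ} (hn : 0 < n) : ∃ a, a ≠ 0 ∧ a ^ n = c := by
  obtain ⟨a, ha⟩ := IsAlgClosed.exists_pow_nat_eq c hn
  refine ⟨a, ?_, ha⟩
  rintro rfl
  rw [zero_pow hn.ne'] at ha
  exact hc ha.symm

lemma isPotential_U12a : IsPotential ![1 / 2, 2 / 3, 2 / 3] U12a := by
  refine isPotential_of_zeros (by intro i; fin_cases i <;> norm_num)
    (by intro i; fin_cases i <;> norm_num) ?_ fun x hx => ?_
  · simpa [U12a] using ((isWeightedHomogeneous_three 4 0 0 (by norm_num)).add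
      (isWeightedHomogeneous_three 0 3 0 (by norm_num))).add
      (isWeightedHomogeneous_three 0 0 3 (by norm_num))
  · have h0 : 4 * x 0 ^ 3 = 0 := by simpa [U12a, pderiv_X] using hx 0
    have h1 : 3 * x 1 ^ 2 = 0 := by simpa [U12a, pderiv_X] using hx 1
    have h2 : 3 * x 2 ^ 2 = 0 := by simpa [U12a, pderiv_X] using hx 2
    ext i
    fin_cases i <;> simp_all

/-- The substitution `y₂ ↦ a (y₂ + b y₃)`, `y₃ ↦ a (y₂ - b y₃)` turns `y₂³ + y₃³` into
`2 a³ (y₂³ + 3 b² y₂ y₃²)`. -/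
lemma exists_U12b : ∃ φ, IsGradedAut ![1 / 2, 2 / 3, 2 / 3] ![1 / 2, 2 / 3, 2 / 3] φ ∧
    φ U12a = U12b := by
  obtain ⟨a, ha0, ha⟩ := exists_ne_zero_pow_eq (c := 1 / 2) (by norm_num) (n := 3) (by norm_num)
  obtain ⟨b, hb0, hb⟩ := exists_ne_zero_pow_eq (c := 1 / 3) (by norm_num) (n := 2) (by norm_num)
  have hdet : IsUnit (!![1, 0, 0; 0, a, a * b; 0, a, -(a * b)] : Matrix (Fin 3) (Fin 3) ℂ).det := by
    rw [isUnit_iff_ne_zero, Matrix.det_fin_three]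
    simp
    intro h
    have : 2 * (a * a * b) = 0 := by linear_combination -h
    simp_all
  refine ⟨linearAut _ hdet, isGradedAut_linearAut hdet ?_, ?_⟩
  · intro i j
    fin_cases i <;> fin_cases j <;> simp
  · have e1 : (2 * C a ^ 3 : MvPolynomial (Fin 3) ℂ) = 1 := by
      rw [← C_pow, ha, ← map_ofNat C, ← C_mul]
      norm_num
    have e2 : (3 * C b ^ 2 : MvPolynomial (Fin 3) ℂ) = 1 := by
      rw [← C_pow, hb, ← map_ofNat C, ← C_mul]
      norm_num
    simp [U12a, U12b, linearAut_X, Fin.sum_univ_three]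
    linear_combination (X 1 ^ 3 + X 1 * X 2 ^ 2) * e1 + 2 * C a ^ 3 * X 1 * X 2 ^ 2 * e2

/-- The substitution `y₂ ↦ u / 2 + b v`, `y₃ ↦ u / 2 - b v` with `u = y₂ + y₃`, `v = y₂ - y₃` turns
`y₂³ + y₃³` into `u³ / 4 + 3 b² u v²`, and `u (u² - v²) = 4 u y₂ y₃`. -/
lemma exists_U12c : ∃ φ, IsGradedAut ![1 / 2, 2 / 3, 2 / 3] ![1 / 2, 2 / 3, 2 / 3] φ ∧
    φ U12a = U12c := by
  obtain ⟨b, hb0, hb⟩ := exists_ne_zero_pow_eq (c := -1 / 12) (by norm_num) (n := 2) (by norm_num)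
  set a : ℂ := 1 / 2 with ha
  have hdet : IsUnit (!![1, 0, 0; 0, a + b, a - b; 0, a - b, a + b] :
      Matrix (Fin 3) (Fin 3) ℂ).det := by
    rw [isUnit_iff_ne_zero, Matrix.det_fin_three]
    simp
    intro h
    have : 2 * b = 0 := by rw [ha] at h; linear_combination h
    simp_all
  refine ⟨linearAut _ hdet, isGradedAut_linearAut hdet ?_, ?_⟩
  · intro i j
    fin_cases i <;> fin_cases j <;> simp
  · have e1 : (2 * C a : MvPolynomial (Fin 3) ℂ) = 1 := by
      rw [ha, ← map_ofNat C, ← C_mul]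
      norm_num
    have e2 : (12 * C b ^ 2 : MvPolynomial (Fin 3) ℂ) = -1 := by
      rw [← C_pow, hb, ← map_ofNat C, ← C_mul]
      norm_num
    simp [U12a, U12c, linearAut_X, Fin.sum_univ_three]
    linear_combination (C a ^ 2 * (X 1 + X 2) ^ 3 - 6 * C a * C b ^ 2 * (X 1 + X 2) *
      (X 1 - X 2) ^ 2 + (2 * C a + 1) * (X 1 + X 2) * X 1 * X 2) * e1 +
      C a ^ 2 * (X 1 + X 2) * (X 1 - X 2) ^ 2 * e2

lemma isPotential_Q12a : IsPotential ![2 / 5, 4 / 5, 2 / 3] Q12a := by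
  refine isPotential_of_zeros (by intro i; fin_cases i <;> norm_num)
    (by intro i; fin_cases i <;> norm_num) ?_ fun x hx => ?_
  · simpa [Q12a] using ((isWeightedHomogeneous_three 5 0 0 (by norm_num)).add
      (isWeightedHomogeneous_three 1 2 0 (by norm_num))).add
      (isWeightedHomogeneous_three 0 0 3 (by norm_num))
  · have h0 : 5 * x 0 ^ 4 + x 1 ^ 2 = 0 := by simpa [Q12a, pderiv_X] using hx 0
    have h1 : x 0 * (2 * x 1) = 0 := by simpa [Q12a, pderiv_X] using hx 1
    have h2 : 3 * x 2 ^ 2 = 0 := by simpa [Q12a, pderiv_X] using hx 2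
    ext i
    rcases (by simpa using h1 : x 0 = 0 ∨ x 1 = 0) with h | h <;> fin_cases i <;> simp_all

/-- Complete the square `y₁ (y₂ + y₁²/2)²` and rescale. -/
lemma orbifoldEquivalent_Q12a_Q12b : OrbifoldEquivalent Q12a Q12b := by
  obtain ⟨s, hs⟩ : ∃ s : ℂ, 2 * s = 1 := ⟨1 / 2, by norm_num⟩
  have hs0 : s ≠ 0 := by
    rintro rfl
    simp at hs
  obtain ⟨a, ha0, ha⟩ := exists_ne_zero_pow_eq (c := -s ^ 2) (by simp [hs0]) (n := 5)
    (by norm_num)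
  obtain ⟨c, hc0, hc⟩ := exists_ne_zero_pow_eq (c := a⁻¹) (by simp [ha0]) (n := 2)
    (by norm_num)
  have hdet : IsUnit (!![a, 0, 0; 0, c, 0; 0, 0, 1] : Matrix (Fin 3) (Fin 3) ℂ).det := by
    simp [Matrix.det_fin_three, ha0, hc0]
  have hp : ∀ q, aeval (Function.update X 1 q) (C s * X 0 ^ 2) =
      (C s * X 0 ^ 2 : MvPolynomial (Fin 3) ℂ) := by
    intro q
    simp [algebraMap_eq]
  refine isPotential_Q12a.orbifoldEquivalent_right
    (φ := (linearAut _ hdet).trans (shear 1 _ hp)) ((isGradedAut_linearAut hdet ?_).trans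
      (isGradedAut_shear hp ?_)) ?_
  · intro i j
    fin_cases i <;> fin_cases j <;> simp
  · refine IsWeightedHomogeneous.C_mul ?_ s
    simpa using isWeightedHomogeneous_three 2 0 0 (by norm_num)
  · have e1 : (C a ^ 5 : MvPolynomial (Fin 3) ℂ) = -C s ^ 2 := by
      rw [← C_pow, ha, C_neg, C_pow]
    have e3 : (C a * C c ^ 2 : MvPolynomial (Fin 3) ℂ) = 1 := by
      rw [← C_pow, hc, ← C_mul, mul_inv_cancel₀ ha0, C_1]
    have e2 : (2 * C s : MvPolynomial (Fin 3) ℂ) = 1 := by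
      rw [← C_1, ← hs, C_mul, map_ofNat]
    simp [Q12a, Q12b, linearAut_X, shear_X, Fin.sum_univ_three, AlgEquiv.trans_apply, aut_C]
    linear_combination X 0 ^ 5 * e1 + X 0 ^ 3 * X 1 * e2 + X 0 * (X 1 + C s * X 0 ^ 2) ^ 2 * e3

lemma isPotential_W12a : IsPotential ![2 / 5, 1 / 2, 1] W12a := by
  refine isPotential_of_zeros (by intro i; fin_cases i <;> norm_num)
    (by intro i; fin_cases i <;> norm_num) ?_ fun x hx => ?_
  · simpa [W12a] using ((isWeightedHomogeneous_three 5 0 0 (by norm_num)).add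
      (isWeightedHomogeneous_three 0 4 0 (by norm_num))).add
      (isWeightedHomogeneous_three 0 0 2 (by norm_num))
  · have h0 : 5 * x 0 ^ 4 = 0 := by simpa [W12a, pderiv_X] using hx 0
    have h1 : 4 * x 1 ^ 3 = 0 := by simpa [W12a, pderiv_X] using hx 1
    have h2 : 2 * x 2 = 0 := by simpa [W12a, pderiv_X] using hx 2
    ext i
    fin_cases i <;> simp_all

/-- Complete the square `(y₃ + y₂²/2)²` and rescale. -/
lemma orbifoldEquivalent_W12a_W12b : OrbifoldEquivalent W12a W12b := by
  obtain ⟨s, hs⟩ : ∃ s : ℂ, 2 * s = 1 := ⟨1 / 2, by norm_num⟩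
  have hs0 : s ≠ 0 := by
    rintro rfl
    simp at hs
  obtain ⟨a, ha0, ha⟩ := exists_ne_zero_pow_eq (c := -s ^ 2) (by simp [hs0]) (n := 4)
    (by norm_num)
  have hdet : IsUnit (!![1, 0, 0; 0, a, 0; 0, 0, 1] : Matrix (Fin 3) (Fin 3) ℂ).det := by
    simp [Matrix.det_fin_three, ha0]
  have hp : ∀ q, aeval (Function.update X 2 q) (C s * X 1 ^ 2) =
      (C s * X 1 ^ 2 : MvPolynomial (Fin 3) ℂ) := by
    intro q
    simp [algebraMap_eq]
  refine isPotential_W12a.orbifoldEquivalent_right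
    (φ := (linearAut _ hdet).trans (shear 2 _ hp)) ((isGradedAut_linearAut hdet ?_).trans
      (isGradedAut_shear hp ?_)) ?_
  · intro i j
    fin_cases i <;> fin_cases j <;> simp
  · refine IsWeightedHomogeneous.C_mul ?_ s
    simpa using isWeightedHomogeneous_three 0 2 0 (by norm_num)
  · have e1 : (C a ^ 4 : MvPolynomial (Fin 3) ℂ) = -C s ^ 2 := by
      rw [← C_pow, ha, C_neg, C_pow]
    have e2 : (2 * C s : MvPolynomial (Fin 3) ℂ) = 1 := by
      rw [← C_1, ← hs, C_mul, map_ofNat]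
    simp [W12a, W12b, linearAut_X, shear_X, Fin.sum_univ_three, AlgEquiv.trans_apply, aut_C]
    linear_combination X 1 ^ 4 * e1 + X 1 ^ 2 * X 2 * e2

lemma isPotential_W13a : IsPotential ![3 / 8, 1 / 2, 1] W13a := by
  refine isPotential_of_zeros (by intro i; fin_cases i <;> norm_num)
    (by intro i; fin_cases i <;> norm_num) ?_ fun x hx => ?_
  · simpa [W13a] using ((isWeightedHomogeneous_three 4 1 0 (by norm_num)).add
      (isWeightedHomogeneous_three 0 4 0 (by norm_num))).add
      (isWeightedHomogeneous_three 0 0 2 (by norm_num))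
  · have h0 : x 1 * (4 * x 0 ^ 3) = 0 := by simpa [W13a, pderiv_X] using hx 0
    have h1 : x 0 ^ 4 + 4 * x 1 ^ 3 = 0 := by simpa [W13a, pderiv_X] using hx 1
    have h2 : 2 * x 2 = 0 := by simpa [W13a, pderiv_X] using hx 2
    ext i
    rcases (by simpa using h0 : x 1 = 0 ∨ x 0 = 0) with h | h <;> fin_cases i <;> simp_all

/-- Complete the square `(y₃ + y₂²/2)²` and rescale. -/
lemma orbifoldEquivalent_W13a_W13b : OrbifoldEquivalent W13a W13b := by
  obtain ⟨s, hs⟩ : ∃ s : ℂ, 2 * s = 1 := ⟨1 / 2, by norm_num⟩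
  have hs0 : s ≠ 0 := by
    rintro rfl
    simp at hs
  obtain ⟨a, ha0, ha⟩ := exists_ne_zero_pow_eq (c := -s ^ 2) (by simp [hs0]) (n := 4)
    (by norm_num)
  obtain ⟨c, hc0, hc⟩ := exists_ne_zero_pow_eq (c := a⁻¹) (by simp [ha0]) (n := 4)
    (by norm_num)
  have hdet : IsUnit (!![c, 0, 0; 0, a, 0; 0, 0, 1] : Matrix (Fin 3) (Fin 3) ℂ).det := by
    simp [Matrix.det_fin_three, ha0, hc0]
  have hp : ∀ q, aeval (Function.update X 2 q) (C s * X 1 ^ 2) =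
      (C s * X 1 ^ 2 : MvPolynomial (Fin 3) ℂ) := by
    intro q
    simp [algebraMap_eq]
  refine isPotential_W13a.orbifoldEquivalent_right
    (φ := (linearAut _ hdet).trans (shear 2 _ hp)) ((isGradedAut_linearAut hdet ?_).trans
      (isGradedAut_shear hp ?_)) ?_
  · intro i j
    fin_cases i <;> fin_cases j <;> simp
  · refine IsWeightedHomogeneous.C_mul ?_ s
    simpa using isWeightedHomogeneous_three 0 2 0 (by norm_num)
  · have e1 : (C a ^ 4 : MvPolynomial (Fin 3) ℂ) = -C s ^ 2 := by
      rw [← C_pow, ha, C_neg, C_pow]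
    have e3 : (C a * C c ^ 4 : MvPolynomial (Fin 3) ℂ) = 1 := by
      rw [← C_pow, hc, ← C_mul, mul_inv_cancel₀ ha0, C_1]
    have e2 : (2 * C s : MvPolynomial (Fin 3) ℂ) = 1 := by
      rw [← C_1, ← hs, C_mul, map_ofNat]
    simp [W13a, W13b, linearAut_X, shear_X, Fin.sum_univ_three, AlgEquiv.trans_apply, aut_C]
    linear_combination X 1 ^ 4 * e1 + X 1 ^ 2 * X 2 * e2 + X 0 ^ 4 * X 1 * e3

lemma isPotential_Z13a : IsPotential ![1 / 3, 5 / 9, 1] Z13a := by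
  refine isPotential_of_zeros (by intro i; fin_cases i <;> norm_num)
    (by intro i; fin_cases i <;> norm_num) ?_ fun x hx => ?_
  · simpa [Z13a] using ((isWeightedHomogeneous_three 6 0 0 (by norm_num)).add
      (isWeightedHomogeneous_three 1 3 0 (by norm_num))).add
      (isWeightedHomogeneous_three 0 0 2 (by norm_num))
  · have h0 : 6 * x 0 ^ 5 + x 1 ^ 3 = 0 := by simpa [Z13a, pderiv_X] using hx 0
    have h1 : x 0 * (3 * x 1 ^ 2) = 0 := by simpa [Z13a, pderiv_X] using hx 1
    have h2 : 2 * x 2 = 0 := by simpa [Z13a, pderiv_X] using hx 2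
    ext i
    rcases (by simpa using h1 : x 0 = 0 ∨ x 1 = 0) with h | h <;> fin_cases i <;> simp_all

/-- Complete the square `(y₃ + y₁³/2)²` and rescale. -/
lemma orbifoldEquivalent_Z13a_Z13b : OrbifoldEquivalent Z13a Z13b := by
  obtain ⟨s, hs⟩ : ∃ s : ℂ, 2 * s = 1 := ⟨1 / 2, by norm_num⟩
  have hs0 : s ≠ 0 := by
    rintro rfl
    simp at hs
  obtain ⟨a, ha0, ha⟩ := exists_ne_zero_pow_eq (c := -s ^ 2) (by simp [hs0]) (n := 6)
    (by norm_num)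
  obtain ⟨c, hc0, hc⟩ := exists_ne_zero_pow_eq (c := a⁻¹) (by simp [ha0]) (n := 3)
    (by norm_num)
  have hdet : IsUnit (!![a, 0, 0; 0, c, 0; 0, 0, 1] : Matrix (Fin 3) (Fin 3) ℂ).det := by
    simp [Matrix.det_fin_three, ha0, hc0]
  have hp : ∀ q, aeval (Function.update X 2 q) (C s * X 0 ^ 3) =
      (C s * X 0 ^ 3 : MvPolynomial (Fin 3) ℂ) := by
    intro q
    simp [algebraMap_eq]
  refine isPotential_Z13a.orbifoldEquivalent_right
    (φ := (linearAut _ hdet).trans (shear 2 _ hp)) ((isGradedAut_linearAut hdet ?_).trans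
      (isGradedAut_shear hp ?_)) ?_
  · intro i j
    fin_cases i <;> fin_cases j <;> simp
  · refine IsWeightedHomogeneous.C_mul ?_ s
    simpa using isWeightedHomogeneous_three 3 0 0 (by norm_num)
  · have e1 : (C a ^ 6 : MvPolynomial (Fin 3) ℂ) = -C s ^ 2 := by
      rw [← C_pow, ha, C_neg, C_pow]
    have e3 : (C a * C c ^ 3 : MvPolynomial (Fin 3) ℂ) = 1 := by
      rw [← C_pow, hc, ← C_mul, mul_inv_cancel₀ ha0, C_1]
    have e2 : (2 * C s : MvPolynomial (Fin 3) ℂ) = 1 := by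
      rw [← C_1, ← hs, C_mul, map_ofNat]
    simp [Z13a, Z13b, linearAut_X, shear_X, Fin.sum_univ_three, AlgEquiv.trans_apply, aut_C]
    linear_combination X 0 ^ 6 * e1 + X 0 ^ 3 * X 2 * e2 + X 0 * X 1 ^ 3 * e3

lemma isPotential_E14a : IsPotential ![1 / 4, 1, 2 / 3] E14a := by
  refine isPotential_of_zeros (by intro i; fin_cases i <;> norm_num)
    (by intro i; fin_cases i <;> norm_num) ?_ fun x hx => ?_
  · simpa [E14a] using ((isWeightedHomogeneous_three 8 0 0 (by norm_num)).add
      (isWeightedHomogeneous_three 0 2 0 (by norm_num))).add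
      (isWeightedHomogeneous_three 0 0 3 (by norm_num))
  · have h0 : 8 * x 0 ^ 7 = 0 := by simpa [E14a, pderiv_X] using hx 0
    have h1 : 2 * x 1 = 0 := by simpa [E14a, pderiv_X] using hx 1
    have h2 : 3 * x 2 ^ 2 = 0 := by simpa [E14a, pderiv_X] using hx 2
    ext i
    fin_cases i <;> simp_all

/-- Complete the square `(y₂ + y₁⁴/2)²` and rescale. -/
lemma orbifoldEquivalent_E14a_E14b : OrbifoldEquivalent E14a E14b := by
  obtain ⟨s, hs⟩ : ∃ s : ℂ, 2 * s = 1 := ⟨1 / 2, by norm_num⟩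
  have hs0 : s ≠ 0 := by
    rintro rfl
    simp at hs
  obtain ⟨a, ha0, ha⟩ := exists_ne_zero_pow_eq (c := -s ^ 2) (by simp [hs0]) (n := 8)
    (by norm_num)
  have hdet : IsUnit (!![a, 0, 0; 0, 1, 0; 0, 0, 1] : Matrix (Fin 3) (Fin 3) ℂ).det := by
    simp [Matrix.det_fin_three, ha0]
  have hp : ∀ q, aeval (Function.update X 1 q) (C s * X 0 ^ 4) =
      (C s * X 0 ^ 4 : MvPolynomial (Fin 3) ℂ) := by
    intro q
    simp [algebraMap_eq]
  refine isPotential_E14a.orbifoldEquivalent_right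
    (φ := (linearAut _ hdet).trans (shear 1 _ hp)) ((isGradedAut_linearAut hdet ?_).trans
      (isGradedAut_shear hp ?_)) ?_
  · intro i j
    fin_cases i <;> fin_cases j <;> simp
  · refine IsWeightedHomogeneous.C_mul ?_ s
    simpa using isWeightedHomogeneous_three 4 0 0 (by norm_num)
  · have e1 : (C a ^ 8 : MvPolynomial (Fin 3) ℂ) = -C s ^ 2 := by
      rw [← C_pow, ha, C_neg, C_pow]
    have e2 : (2 * C s : MvPolynomial (Fin 3) ℂ) = 1 := by
      rw [← C_1, ← hs, C_mul, map_ofNat]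
    simp [E14a, E14b, linearAut_X, shear_X, Fin.sum_univ_three, AlgEquiv.trans_apply, aut_C]
    linear_combination X 0 ^ 8 * e1 + X 0 ^ 4 * X 1 * e2

lemma isPotential_Q17Tb : IsPotential ![3 / 5, 1 / 5, 1] Q17Tb := by
  refine isPotential_of_zeros (by intro i; fin_cases i <;> norm_num)
    (by intro i; fin_cases i <;> norm_num) ?_ fun x hx => ?_
  · simpa [Q17Tb] using ((isWeightedHomogeneous_three 3 1 0 (by norm_num)).add
      (isWeightedHomogeneous_three 0 10 0 (by norm_num))).add
      (isWeightedHomogeneous_three 0 0 2 (by norm_num))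
  · have h0 : x 1 * (3 * x 0 ^ 2) = 0 := by simpa [Q17Tb, pderiv_X] using hx 0
    have h1 : x 0 ^ 3 + 10 * x 1 ^ 9 = 0 := by simpa [Q17Tb, pderiv_X] using hx 1
    have h2 : 2 * x 2 = 0 := by simpa [Q17Tb, pderiv_X] using hx 2
    ext i
    rcases (by simpa using h0 : x 1 = 0 ∨ x 0 = 0) with h | h <;> fin_cases i <;> simp_all

/-- Complete the square `(x₃ + x₂⁵/2)²` and rescale. -/
lemma orbifoldEquivalent_Q17Tb_Q17Ta : OrbifoldEquivalent Q17Ta Q17Tb := by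
  obtain ⟨s, hs⟩ : ∃ s : ℂ, 2 * s = 1 := ⟨1 / 2, by norm_num⟩
  have hs0 : s ≠ 0 := by
    rintro rfl
    simp at hs
  obtain ⟨a, ha0, ha⟩ := exists_ne_zero_pow_eq (c := -s ^ 2) (by simp [hs0]) (n := 10)
    (by norm_num)
  obtain ⟨c, hc0, hc⟩ := exists_ne_zero_pow_eq (c := a⁻¹) (by simp [ha0]) (n := 3)
    (by norm_num)
  have hdet : IsUnit (!![c, 0, 0; 0, a, 0; 0, 0, 1] : Matrix (Fin 3) (Fin 3) ℂ).det := by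
    simp [Matrix.det_fin_three, ha0, hc0]
  have hp : ∀ q, aeval (Function.update X 2 q) (C s * X 1 ^ 5) =
      (C s * X 1 ^ 5 : MvPolynomial (Fin 3) ℂ) := by
    intro q
    simp [algebraMap_eq]
  refine isPotential_Q17Tb.orbifoldEquivalent_left isPotential_Q17Tb.weight_pos
    (φ := (linearAut _ hdet).trans (shear 2 _ hp)) ((isGradedAut_linearAut hdet ?_).trans
      (isGradedAut_shear hp ?_)) ?_
  · intro i j
    fin_cases i <;> fin_cases j <;> simp
  · refine IsWeightedHomogeneous.C_mul ?_ s
    simpa using isWeightedHomogeneous_three 0 5 0 (by norm_num)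
  · have e1 : (C a ^ 10 : MvPolynomial (Fin 3) ℂ) = -C s ^ 2 := by
      rw [← C_pow, ha, C_neg, C_pow]
    have e3 : (C a * C c ^ 3 : MvPolynomial (Fin 3) ℂ) = 1 := by
      rw [← C_pow, hc, ← C_mul, mul_inv_cancel₀ ha0, C_1]
    have e2 : (2 * C s : MvPolynomial (Fin 3) ℂ) = 1 := by
      rw [← C_1, ← hs, C_mul, map_ofNat]
    simp [Q17Tb, Q17Ta, linearAut_X, shear_X, Fin.sum_univ_three, AlgEquiv.trans_apply, aut_C]
    linear_combination X 1 ^ 10 * e1 + X 1 ^ 5 * X 2 * e2 + X 0 ^ 3 * X 1 * e3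

end Examples

/-! ### Infinite series -/

section Series

lemma isPotential_singAOdd {n : ℕ} (hn : 2 ≤ n) : IsPotential ![1 / n, 1] (singAOdd n) := by
  have hn0 : (0 : ℚ) < n := by exact_mod_cast (by omega : 0 < n)
  refine isPotential_of_zeros ?_ ?_ ?_ fun x hx => ?_
  · intro i
    fin_cases i <;> simp [hn0]
  · intro i
    fin_cases i
    · simpa using Nat.cast_inv_le_one n
    · simp
  · simpa [singAOdd] using (isWeightedHomogeneous_two (2 * n) 0
      (by push_cast; field_simp; simp)).add
      (isWeightedHomogeneous_two 0 2 (by norm_num))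
  · have h0 : (2 * n : ℂ) * x 0 ^ (2 * n - 1) = 0 := by
      simpa [singAOdd, pderiv_X] using hx 0
    have h1 : 2 * x 1 = 0 := by simpa [singAOdd, pderiv_X] using hx 1
    have h2 : (n : ℂ) ≠ 0 := by exact_mod_cast (by omega : n ≠ 0)
    have h3 : 2 * n - 1 ≠ 0 := by omega
    ext i
    fin_cases i <;> simp_all

/-- Complete the square `(y₂ + y₁ⁿ/2)²` and rescale. -/
lemma orbifoldEquivalent_singAOdd_singDT {n : ℕ} (hn : 2 ≤ n) :
    OrbifoldEquivalent (singAOdd n) (singDT n) := by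
  have hn0 : (n : ℚ) ≠ 0 := by exact_mod_cast (by omega : n ≠ 0)
  obtain ⟨s, hs⟩ : ∃ s : ℂ, 2 * s = 1 := ⟨1 / 2, by norm_num⟩
  have hs0 : s ≠ 0 := by
    rintro rfl
    simp at hs
  obtain ⟨a, ha0, ha⟩ := exists_ne_zero_pow_eq (c := -s ^ 2) (by simp [hs0]) (n := 2 * n)
    (by omega)
  have hdet : IsUnit (!![a, 0; 0, 1] : Matrix (Fin 2) (Fin 2) ℂ).det := by
    simp [Matrix.det_fin_two, ha0]
  have hp : ∀ q, aeval (Function.update X 1 q) (C s * X 0 ^ n) =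
      (C s * X 0 ^ n : MvPolynomial (Fin 2) ℂ) := by
    intro q
    simp [algebraMap_eq]
  refine (isPotential_singAOdd hn).orbifoldEquivalent_right
    (φ := (linearAut _ hdet).trans (shear 1 _ hp)) ((isGradedAut_linearAut hdet ?_).trans
      (isGradedAut_shear hp ?_)) ?_
  · intro i j
    fin_cases i <;> fin_cases j <;> simp
  · refine IsWeightedHomogeneous.C_mul ?_ s
    simpa using isWeightedHomogeneous_two n 0 (by simp [hn0])
  · have e1 : (C a ^ (2 * n) : MvPolynomial (Fin 2) ℂ) = -C s ^ 2 := by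
      rw [← C_pow, ha, C_neg, C_pow]
    have e2 : (2 * C s : MvPolynomial (Fin 2) ℂ) = 1 := by
      rw [← C_1, ← hs, C_mul, map_ofNat]
    simp [singAOdd, singDT, linearAut_X, shear_X, AlgEquiv.trans_apply, aut_C]
    linear_combination X 0 ^ (2 * n) * e1 + X 0 ^ n * X 1 * e2

lemma isPotential_singDEven (k : ℕ) :
    IsPotential ![2 / (2 * k + 3), (2 * k + 2) / (2 * k + 3)] (singDEven (k + 2)) := by
  have hk : 2 * (k + 2) - 1 = 2 * k + 3 := by omega
  refine isPotential_of_zeros ?_ ?_ ?_ fun x hx => ?_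
  · intro i
    fin_cases i <;> simp <;> positivity
  · intro i
    fin_cases i
    · simp
      rw [div_le_one (by positivity)]
      linarith [(Nat.cast_nonneg k : (0 : ℚ) ≤ k)]
    · simp
      rw [div_le_one (by positivity)]
      linarith
  · simpa [singDEven, hk] using (isWeightedHomogeneous_two (2 * k + 3) 0
      (by push_cast; field_simp; ring)).add
      (isWeightedHomogeneous_two 1 2 (by push_cast; field_simp; ring))
  · have h0 : (2 * k + 3 : ℂ) * x 0 ^ (2 * k + 2) + x 1 ^ 2 = 0 := by
      simpa [singDEven, hk, pderiv_X] using hx 0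
    have h1 : x 0 * (2 * x 1) = 0 := by simpa [singDEven, hk, pderiv_X] using hx 1
    have h2 : (2 * k + 3 : ℂ) ≠ 0 := by exact_mod_cast (by omega : 2 * k + 3 ≠ 0)
    ext i
    rcases (by simpa using h1 : x 0 = 0 ∨ x 1 = 0) with h | h <;> fin_cases i <;> simp_all

/-- Complete the square `x₁ (x₂ + x₁ⁿ⁻¹/2)²` and rescale. -/
lemma orbifoldEquivalent_singL_singDEven {n : ℕ} (hn : 2 ≤ n) :
    OrbifoldEquivalent (singL n) (singDEven n) := by
  obtain ⟨k, rfl⟩ := Nat.exists_eq_add_of_le' hn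
  have hk : 2 * (k + 2) - 1 = 2 * k + 3 := by omega
  obtain ⟨s, hs⟩ : ∃ s : ℂ, 2 * s = 1 := ⟨1 / 2, by norm_num⟩
  have hs0 : s ≠ 0 := by
    rintro rfl
    simp at hs
  obtain ⟨a, ha0, ha⟩ := exists_ne_zero_pow_eq (c := -s ^ 2) (by simp [hs0]) (n := 2 * k + 3)
    (by omega)
  obtain ⟨c, hc0, hc⟩ := exists_ne_zero_pow_eq (c := a⁻¹) (by simp [ha0]) (n := 2) (by norm_num)
  have hdet : IsUnit (!![a, 0; 0, c] : Matrix (Fin 2) (Fin 2) ℂ).det := by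
    simp [Matrix.det_fin_two, ha0, hc0]
  have hp : ∀ q, aeval (Function.update X 1 q) (C s * X 0 ^ (k + 1)) =
      (C s * X 0 ^ (k + 1) : MvPolynomial (Fin 2) ℂ) := by
    intro q
    simp [algebraMap_eq]
  refine (isPotential_singDEven k).orbifoldEquivalent_left (isPotential_singDEven k).weight_pos
    (φ := (linearAut _ hdet).trans (shear 1 _ hp)) ((isGradedAut_linearAut hdet ?_).trans
      (isGradedAut_shear hp ?_)) ?_
  · intro i j
    fin_cases i <;> fin_cases j <;> simp
  · refine IsWeightedHomogeneous.C_mul ?_ s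
    simpa using isWeightedHomogeneous_two (p := 2 / (2 * (k : ℚ) + 3)) (k + 1) 0
      (by push_cast; field_simp; simp)
  · have e1 : (C a ^ (2 * k + 3) : MvPolynomial (Fin 2) ℂ) = -C s ^ 2 := by
      rw [← C_pow, ha, C_neg, C_pow]
    have e2 : (2 * C s : MvPolynomial (Fin 2) ℂ) = 1 := by
      rw [← C_1, ← hs, C_mul, map_ofNat]
    have e3 : (C a * C c ^ 2 : MvPolynomial (Fin 2) ℂ) = 1 := by
      rw [← C_pow, hc, ← C_mul, mul_inv_cancel₀ ha0, C_1]
    simp [singDEven, hk, singL, linearAut_X, shear_X, AlgEquiv.trans_apply, aut_C]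
    linear_combination X 0 ^ (2 * k + 3) * e1 + X 0 ^ (k + 2) * X 1 * e2 +
      X 0 * (X 1 + C s * X 0 ^ (k + 1)) ^ 2 * e3

lemma isPotential_singDOdd {n : ℕ} (hn : 2 ≤ n) :
    IsPotential ![1 / n, 1 - 1 / (2 * n), 1] (singDOdd n) := by
  have hn0 : (0 : ℚ) < n := by exact_mod_cast (by omega : 0 < n)
  have hn2 : (2 : ℚ) ≤ n := by exact_mod_cast hn
  have hle : 1 / (2 * n : ℚ) < 1 := by
    rw [div_lt_one (by positivity)]
    linarith
  refine isPotential_of_zeros ?_ ?_ ?_ fun x hx => ?_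
  · intro i
    fin_cases i
    · simp [hn0]
    · simpa using hle
    · simp
  · intro i
    fin_cases i
    · simpa using Nat.cast_inv_le_one n
    · simp
    · simp
  · simpa [singDOdd] using ((isWeightedHomogeneous_three (2 * n) 0 0
      (by push_cast; field_simp; simp)).add
      (isWeightedHomogeneous_three 1 2 0 (by push_cast; field_simp; ring))).add
      (isWeightedHomogeneous_three 0 0 2 (by norm_num))
  · have h0 : (2 * n : ℂ) * x 0 ^ (2 * n - 1) + x 1 ^ 2 = 0 := by
      simpa [singDOdd, pderiv_X] using hx 0
    have h1 : x 0 * (2 * x 1) = 0 := by simpa [singDOdd, pderiv_X] using hx 1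
    have h2 : 2 * x 2 = 0 := by simpa [singDOdd, pderiv_X] using hx 2
    have h3 : (n : ℂ) ≠ 0 := by exact_mod_cast (by omega : n ≠ 0)
    have h4 : 2 * n - 1 ≠ 0 := by omega
    ext i
    rcases (by simpa using h1 : x 0 = 0 ∨ x 1 = 0) with h | h <;> fin_cases i <;> simp_all

/-- Complete the square `(x₃ + x₂ⁿ/2)²`, rescale, and exchange the first two variables. -/
lemma orbifoldEquivalent_singC_singDOdd {n : ℕ} (hn : 2 ≤ n) :
    OrbifoldEquivalent (singC n) (singDOdd n) := by
  have hn0 : (n : ℚ) ≠ 0 := by exact_mod_cast (by omega : n ≠ 0)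
  have hV := isPotential_singDOdd hn
  obtain ⟨s, hs⟩ : ∃ s : ℂ, 2 * s = 1 := ⟨1 / 2, by norm_num⟩
  have hs0 : s ≠ 0 := by
    rintro rfl
    simp at hs
  obtain ⟨a, ha0, ha⟩ := exists_ne_zero_pow_eq (c := -s ^ 2) (by simp [hs0]) (n := 2 * n)
    (by omega)
  obtain ⟨c, hc0, hc⟩ := exists_ne_zero_pow_eq (c := a⁻¹) (by simp [ha0]) (n := 2) (by norm_num)
  have hdet : IsUnit (!![0, a, 0; c, 0, 0; 0, 0, 1] : Matrix (Fin 3) (Fin 3) ℂ).det := by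
    simp [Matrix.det_fin_three, ha0, hc0]
  have hp : ∀ q, aeval (Function.update X 2 q) (C s * X 1 ^ n) =
      (C s * X 1 ^ n : MvPolynomial (Fin 3) ℂ) := by
    intro q
    simp [algebraMap_eq]
  refine hV.orbifoldEquivalent_left (w' := ![1 - 1 / (2 * n), 1 / n, 1]) ?_
    (φ := (linearAut _ hdet).trans (shear 2 _ hp)) ((isGradedAut_linearAut hdet ?_).trans
      (isGradedAut_shear hp ?_)) ?_
  · intro i
    fin_cases i
    exacts [hV.weight_pos 1, hV.weight_pos 0, hV.weight_pos 2]
  · intro i j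
    fin_cases i <;> fin_cases j <;> simp
  · refine IsWeightedHomogeneous.C_mul ?_ s
    simpa using isWeightedHomogeneous_three (q := 1 / (n : ℚ)) 0 n 0 (by simp [hn0])
  · have e1 : (C a ^ (2 * n) : MvPolynomial (Fin 3) ℂ) = -C s ^ 2 := by
      rw [← C_pow, ha, C_neg, C_pow]
    have e2 : (2 * C s : MvPolynomial (Fin 3) ℂ) = 1 := by
      rw [← C_1, ← hs, C_mul, map_ofNat]
    have e3 : (C a * C c ^ 2 : MvPolynomial (Fin 3) ℂ) = 1 := by
      rw [← C_pow, hc, ← C_mul, mul_inv_cancel₀ ha0, C_1]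
    simp [singDOdd, singC, linearAut_X, shear_X, Fin.sum_univ_three, AlgEquiv.trans_apply, aut_C]
    linear_combination X 1 ^ (2 * n) * e1 + X 1 ^ n * X 2 * e2 + X 0 ^ 2 * X 1 * e3

end Series

/-! ### Marginal deformations -/

section Marginal

lemma isPotential_singA8A2 : IsPotential ![2 / 9, 2 / 3] singA8A2 := by
  refine isPotential_of_zeros (by intro i; fin_cases i <;> norm_num)
    (by intro i; fin_cases i <;> norm_num) ?_ fun x hx => ?_
  · simpa [singA8A2] using (isWeightedHomogeneous_two 9 0 (by norm_num)).add
      (isWeightedHomogeneous_two 0 3 (by norm_num))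
  · have h0 : 9 * x 0 ^ 8 = 0 := by simpa [singA8A2, pderiv_X] using hx 0
    have h1 : 3 * x 1 ^ 2 = 0 := by simpa [singA8A2, pderiv_X] using hx 1
    ext i
    fin_cases i <;> simp_all

/-- Complete the cube `(y₂ + μ/3 y₁³)³`: the coefficient `μ²/3` of `y₁⁶ y₂` has to be `1`. -/
lemma orbifoldEquivalent_singA8A2_singZ13T {μ : ℂ} (hμ : μ ^ 2 = 3) :
    OrbifoldEquivalent singA8A2 (singZ13T μ) := by
  obtain ⟨s, hs⟩ : ∃ s : ℂ, 3 * s = μ := ⟨μ / 3, by ring⟩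
  have hs2 : 3 * s ^ 2 = 1 := by linear_combination hμ / 3 + (s + μ / 3) * hs
  have hs0 : s ≠ 0 := by
    rintro rfl
    simp at hs2
  obtain ⟨a, ha0, ha⟩ := exists_ne_zero_pow_eq (c := -s ^ 3) (by simp [hs0]) (n := 9) (by norm_num)
  have hdet : IsUnit (!![a, 0; 0, 1] : Matrix (Fin 2) (Fin 2) ℂ).det := by
    simp [Matrix.det_fin_two, ha0]
  have hp : ∀ q, aeval (Function.update X 1 q) (C s * X 0 ^ 3) =
      (C s * X 0 ^ 3 : MvPolynomial (Fin 2) ℂ) := by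
    intro q
    simp [algebraMap_eq]
  refine isPotential_singA8A2.orbifoldEquivalent_right
    (φ := (linearAut _ hdet).trans (shear 1 _ hp)) ((isGradedAut_linearAut hdet ?_).trans
      (isGradedAut_shear hp ?_)) ?_
  · intro i j
    fin_cases i <;> fin_cases j <;> simp
  · refine IsWeightedHomogeneous.C_mul ?_ s
    simpa using isWeightedHomogeneous_two 3 0 (by norm_num)
  · have e1 : (C a ^ 9 : MvPolynomial (Fin 2) ℂ) = -C s ^ 3 := by
      rw [← C_pow, ha, C_neg, C_pow]
    have e2 : (3 * C s : MvPolynomial (Fin 2) ℂ) = C μ := by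
      rw [← hs, C_mul, map_ofNat]
    have e3 : (3 * C s ^ 2 : MvPolynomial (Fin 2) ℂ) = 1 := by
      rw [← C_1, ← hs2, C_mul, map_ofNat, C_pow]
    simp [singA8A2, singZ13T, linearAut_X, shear_X, AlgEquiv.trans_apply, aut_C]
    linear_combination X 0 ^ 9 * e1 + X 0 ^ 3 * X 1 ^ 2 * e2 + X 0 ^ 6 * X 1 * e3

/-- For `μ² ≠ 4`, the first derivatives of the loop have no common zeros away from the axes: as
quadratic polynomials in `t = x₁ / x₂²`, they are `3t² + 2μt + 1` and `t² + 3μt + 5`. -/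
lemma isPotential_loop35 {μ : ℂ} (hμ : μ ^ 2 ≠ 4) : IsPotential ![4 / 7, 2 / 7] (loop35 μ) := by
  refine isPotential_of_zeros (by intro i; fin_cases i <;> norm_num)
    (by intro i; fin_cases i <;> norm_num) ?_ fun x hx => ?_
  · simpa [loop35] using ((isWeightedHomogeneous_two 1 5 (by norm_num)).add
      (isWeightedHomogeneous_two 3 1 (by norm_num))).add
      ((isWeightedHomogeneous_two 2 3 (by norm_num)).C_mul μ)
  · have h0 : x 1 ^ 5 + x 1 * (3 * x 0 ^ 2) + μ * (x 1 ^ 3 * (2 * x 0)) = 0 := by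
      simpa [loop35, pderiv_X] using hx 0
    have h1 : x 0 * (5 * x 1 ^ 4) + x 0 ^ 3 + μ * (x 0 ^ 2 * (3 * x 1 ^ 2)) = 0 := by
      simpa [loop35, pderiv_X] using hx 1
    by_cases hx1 : x 1 = 0
    · have hx0 : x 0 = 0 := by simpa [hx1] using h1
      ext i
      fin_cases i
      exacts [hx0, hx1]
    · exfalso
      have hx0 : x 0 ≠ 0 := by
        intro h
        exact hx1 (by simpa [h] using h0)
      have h2 : x 1 ^ 4 + 3 * x 0 ^ 2 + 2 * μ * x 0 * x 1 ^ 2 = 0 := by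
        refine mul_left_cancel₀ hx1 ?_
        linear_combination h0
      have h3 : 5 * x 1 ^ 4 + x 0 ^ 2 + 3 * μ * x 0 * x 1 ^ 2 = 0 := by
        refine mul_left_cancel₀ hx0 ?_
        linear_combination h1
      have h4 : μ * x 0 = -2 * x 1 ^ 2 := by
        refine mul_left_cancel₀ (pow_ne_zero 2 hx1) ?_
        linear_combination (3 * h3 - h2) / 7
      have h5 : x 0 ^ 2 = x 1 ^ 4 := by
        linear_combination (h2 - 2 * x 1 ^ 2 * h4) / 3
      apply hμ
      refine mul_right_cancel₀ (pow_ne_zero 4 hx1) ?_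
      linear_combination (μ * x 0 - 2 * x 1 ^ 2) * h4 - μ ^ 2 * h5

/-- The substitution is `x₁ = a (y₁ + μ₂/3 y₂²)`, `x₂ = c y₂`, with `a = -1 / (μ c⁵)` and `c⁷`
determined by the vanishing of the coefficient of `y₂⁷`. -/
lemma orbifoldEquivalent_singE19T_loop35 {μ μ₁ μ₂ : ℂ} (h4 : μ₂ ^ 2 ≠ 4)
    (h₁ : μ₁ = μ * (μ₂ ^ 2 / 3 - 1)) (h : μ ^ 3 * (μ₂ * (2 / 9 * μ₂ ^ 2 - 1)) ^ 2 = -9) :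
    OrbifoldEquivalent (singE19T μ₁) (loop35 μ₂) := by
  have hμ : μ ≠ 0 := by
    rintro rfl
    norm_num at h
  have hB : μ₂ * (2 / 9 * μ₂ ^ 2 - 1) ≠ 0 := by
    intro h0
    rw [h0] at h
    norm_num at h
  obtain ⟨c, hc0, hc⟩ := exists_ne_zero_pow_eq (c := μ₂ * (2 / 9 * μ₂ ^ 2 - 1) / 3)
    (div_ne_zero hB (by norm_num)) (n := 7) (by norm_num)
  obtain ⟨a, ha⟩ : ∃ a : ℂ, a * (μ * c ^ 5) = -1 :=
    ⟨-(μ * c ^ 5)⁻¹, by rw [neg_mul, inv_mul_cancel₀ (by positivity)]⟩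
  have ha0 : a ≠ 0 := by
    rintro rfl
    simp at ha
  obtain ⟨s, hs⟩ : ∃ s : ℂ, 3 * s = μ₂ := ⟨μ₂ / 3, by ring⟩
  have hμc : μ ^ 3 * c ^ 14 = -1 := by
    rw [show c ^ 14 = (c ^ 7) ^ 2 by ring, hc]
    linear_combination h / 9
  have ha3 : a ^ 3 * c = 1 := by
    have h5 : (a * (μ * c ^ 5)) ^ 3 = -1 := by rw [ha]; norm_num
    linear_combination -h5 + a ^ 3 * c * hμc
  have hlin : 3 * s ^ 2 + μ₁ * a * c ^ 5 = 1 := by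
    rw [h₁, ← hs]
    linear_combination (3 * s ^ 2 - 1) * ha
  have hconst : s ^ 3 + c ^ 7 + s * (1 - 3 * s ^ 2) = 0 := by
    rw [hc, ← hs]
    ring
  have hdet : IsUnit (!![a, 0; 0, c] : Matrix (Fin 2) (Fin 2) ℂ).det := by
    simp [Matrix.det_fin_two, ha0, hc0]
  have hp : ∀ q, aeval (Function.update X 0 q) (C s * X 1 ^ 2) =
      (C s * X 1 ^ 2 : MvPolynomial (Fin 2) ℂ) := by
    intro q
    simp [algebraMap_eq]
  have hφ : IsGradedAut ![4 / 7, 2 / 7] ![4 / 7, 2 / 7]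
      ((linearAut _ hdet).trans (shear 0 _ hp)) := by
    refine (isGradedAut_linearAut hdet ?_).trans (isGradedAut_shear hp ?_)
    · intro i j
      fin_cases i <;> fin_cases j <;> simp
    · refine IsWeightedHomogeneous.C_mul ?_ s
      simpa using isWeightedHomogeneous_two 0 2 (by norm_num)
  have hV := isPotential_loop35 h4
  refine hV.orbifoldEquivalent_left hV.weight_pos hφ.symm ?_
  rw [AlgEquiv.symm_apply_eq]
  have e1 : (C a ^ 3 * C c : MvPolynomial (Fin 2) ℂ) = 1 := by
    rw [← C_pow, ← C_mul, ha3, C_1]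
  have e2 : (3 * C s : MvPolynomial (Fin 2) ℂ) = C μ₂ := by
    rw [← hs, C_mul, map_ofNat]
  have e3 : (3 * C s ^ 2 + C μ₁ * C a * C c ^ 5 : MvPolynomial (Fin 2) ℂ) = 1 := by
    simpa [map_ofNat C 3] using congrArg (C : ℂ →+* MvPolynomial (Fin 2) ℂ) hlin
  have e4 : (C s ^ 3 + C c ^ 7 + C s * (1 - 3 * C s ^ 2) : MvPolynomial (Fin 2) ℂ) = 0 := by
    simpa [map_ofNat C 3] using congrArg (C : ℂ →+* MvPolynomial (Fin 2) ℂ) hconst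
  simp [singE19T, loop35, linearAut_X, shear_X, AlgEquiv.trans_apply, aut_C]
  linear_combination (-(X 0 + C s * X 1 ^ 2) ^ 3 * X 1) * e1 - X 0 ^ 2 * X 1 ^ 3 * e2 -
    (X 0 * X 1 ^ 5 + C s * X 1 ^ 7) * e3 - X 1 ^ 7 * e4

end Marginal

/-! ### Elliptic curves -/

section Elliptic

/-- A critical point with `x₃ ≠ 0` has `x₂ = 0`, and its `x₁ / x₃` is a multiple root of
`t (t - 1) (t - λ)`. -/
lemma isPotential_ellipticLegendre {l : ℂ} (h0 : l ≠ 0) (h1 : l ≠ 1) :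
    IsPotential ![2 / 3, 2 / 3, 2 / 3] (ellipticLegendre l) := by
  have hX : ∀ i : Fin 3, IsWeightedHomogeneous (![2 / 3, 2 / 3, 2 / 3] : Fin 3 → ℚ)
      (X i : MvPolynomial (Fin 3) ℂ) (2 / 3) := by
    intro i
    refine (isWeightedHomogeneous_X ℂ ![2 / 3, 2 / 3, 2 / 3] i).weight_congr ?_
    fin_cases i <;> rfl
  refine isPotential_of_zeros (by intro i; fin_cases i <;> norm_num)
    (by intro i; fin_cases i <;> norm_num) ?_ fun x hx => ?_
  · refine IsWeightedHomogeneous.add ?_ ?_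
    · exact ((((hX 1).pow 2).mul (hX 2)).neg).weight_congr (by norm_num)
    · exact (((hX 0).mul ((hX 0).sub (hX 2))).mul ((hX 0).sub ((hX 2).C_mul l))).weight_congr
        (by norm_num)
  · have hz : x 0 * (x 0 - x 2) + (x 0 - l * x 2) * (x 0 + (x 0 - x 2)) = 0 := by
      simpa [ellipticLegendre, pderiv_X] using hx 0
    have hy : x 2 = 0 ∨ x 1 = 0 := by
      simpa [ellipticLegendre, pderiv_X] using hx 1
    have hw := hx 2
    simp [ellipticLegendre, pderiv_X] at hw
    have key : x 2 = 0 := by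
      by_contra h2
      have hy1 : x 1 = 0 := hy.resolve_left h2
      have e1 : x 0 * ((1 + l) * x 0 - 2 * l * x 2) = 0 := by
        rw [hy1] at hw
        linear_combination -hw
      rcases mul_eq_zero.mp e1 with e | e
      · rw [e] at hz
        apply h0
        refine mul_right_cancel₀ (pow_ne_zero 2 h2) ?_
        linear_combination hz
      · have e2 : x 0 ^ 2 = l * x 2 ^ 2 := by
          linear_combination (hz + 2 * x 2 * e) / 3
        have e3 : (l - 1) ^ 2 * (l * x 2 ^ 2) = 0 := by
          linear_combination ((1 + l) * x 0 + 2 * l * x 2) * e - (1 + l) ^ 2 * e2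
        simp [h0, h2, sub_eq_zero, h1] at e3
    have hx0 : x 0 = 0 := by
      rw [key] at hz
      have : x 0 ^ 2 = 0 := by linear_combination hz / 3
      simpa using this
    have hx1 : x 1 = 0 := by simpa [key, hx0] using hw
    ext i
    fin_cases i
    exacts [hx0, hx1, key]

/-- The substitution is `x₁ = y₁ - e₁ y₃`, `x₂ = b y₂`, `x₃ = (e₂ - e₁) y₃`. -/
lemma orbifoldEquivalent_ellipticLegendre_ellipticWeierstrass {e₁ e₂ e₃ : ℂ} (h₁₂ : e₁ ≠ e₂)
    (h₁₃ : e₁ ≠ e₃) (h₂₃ : e₂ ≠ e₃) :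
    OrbifoldEquivalent (ellipticLegendre ((e₃ - e₁) / (e₂ - e₁)))
      (ellipticWeierstrass e₁ e₂ e₃) := by
  have hd : e₂ - e₁ ≠ 0 := sub_ne_zero.mpr h₁₂.symm
  obtain ⟨l, hl⟩ : ∃ l, l = (e₃ - e₁) / (e₂ - e₁) := ⟨_, rfl⟩
  rw [← hl]
  have hl' : l * (e₂ - e₁) = e₃ - e₁ := by rw [hl, div_mul_cancel₀ _ hd]
  have hl0 : l ≠ 0 := by
    rintro rfl
    exact h₁₃ (by linear_combination hl')
  have hl1 : l ≠ 1 := by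
    rintro rfl
    exact h₂₃ (by linear_combination hl')
  obtain ⟨b, hb0, hb⟩ := exists_ne_zero_pow_eq (inv_ne_zero hd) (n := 2) (by norm_num)
  have hdet : IsUnit (!![1, 0, -e₁; 0, b, 0; 0, 0, e₂ - e₁] : Matrix (Fin 3) (Fin 3) ℂ).det := by
    simp [Matrix.det_fin_three, hb0, hd]
  refine (isPotential_ellipticLegendre hl0 hl1).orbifoldEquivalent_right
    (φ := linearAut _ hdet) (isGradedAut_linearAut hdet ?_) ?_
  · intro i j _
    fin_cases i <;> fin_cases j <;> rfl
  · have e1 : (C b ^ 2 * (C e₂ - C e₁) : MvPolynomial (Fin 3) ℂ) = 1 := by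
      rw [← C_pow, hb, ← C_sub, ← C_mul, inv_mul_cancel₀ hd, C_1]
    have e2 : (C l * (C e₂ - C e₁) : MvPolynomial (Fin 3) ℂ) = C e₃ - C e₁ := by
      rw [← C_sub, ← C_mul, hl', C_sub]
    simp [ellipticLegendre, ellipticWeierstrass, linearAut_X, Fin.sum_univ_three, aut_C]
    linear_combination -X 1 ^ 2 * X 2 * e1 -
      (X 0 - C e₁ * X 2) * (X 0 - C e₂ * X 2) * X 2 * e2

/-- `V_λ` is the Weierstrass form for the roots `0, 1, λ`, in any order. -/
lemma orbifoldEquivalent_ellipticLegendre {l l' : ℂ} (h0 : l ≠ 0) (h1 : l ≠ 1)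
    (h : l' ∈ ({l, 1 - l, 1 / l, 1 / (1 - l), (l - 1) / l, l / (l - 1)} : Set ℂ)) :
    OrbifoldEquivalent (ellipticLegendre l') (ellipticLegendre l) := by
  have key : ∀ e₁ e₂ e₃ : ℂ, e₁ ≠ e₂ → e₁ ≠ e₃ → e₂ ≠ e₃ →
      ellipticWeierstrass e₁ e₂ e₃ = ellipticLegendre l → (e₃ - e₁) / (e₂ - e₁) = l' →
      OrbifoldEquivalent (ellipticLegendre l') (ellipticLegendre l) := by
    intro e₁ e₂ e₃ h₁₂ h₁₃ h₂₃ h h'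
    rw [← h, ← h']
    exact orbifoldEquivalent_ellipticLegendre_ellipticWeierstrass h₁₂ h₁₃ h₂₃
  rcases h with rfl | rfl | rfl | rfl | rfl | rfl
  · refine key 0 1 l' zero_ne_one h0.symm h1.symm ?_ (by simp)
    simp [ellipticWeierstrass, ellipticLegendre]
  · refine key 1 0 l one_ne_zero h1.symm h0.symm ?_ (by ring)
    simp only [ellipticWeierstrass, ellipticLegendre, map_zero, map_one]
    ring
  · refine key 0 l 1 h0.symm zero_ne_one h1 ?_ (by simp)
    simp only [ellipticWeierstrass, ellipticLegendre, map_zero, map_one]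
    ring
  · refine key 1 l 0 h1.symm one_ne_zero h0 ?_ (by rw [← neg_div_neg_eq]; simp)
    simp only [ellipticWeierstrass, ellipticLegendre, map_zero, map_one]
    ring
  · refine key l 0 1 h0 h1 zero_ne_one ?_ (by rw [← neg_div_neg_eq]; simp)
    simp only [ellipticWeierstrass, ellipticLegendre, map_zero, map_one]
    ring
  · refine key l 1 0 h1 h0 one_ne_zero ?_ (by rw [← neg_div_neg_eq]; simp)
    simp only [ellipticWeierstrass, ellipticLegendre, map_zero, map_one]
    ring

end Elliptic

end LG

end

theorem lemma4p2 :
    -- The transformation of variables in an orbifold equivalence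
    (∀ (n m N : ℕ) (wx : Fin n → ℚ) (wy : Fin m → ℚ)
      (V₁ : MvPolynomial (Fin n) ℂ) (V₂ : MvPolynomial (Fin m) ℂ) (Q : LG.MatXY n m N)
      (φ : MvPolynomial (Fin m) ℂ ≃ₐ[ℂ] MvPolynomial (Fin m) ℂ),
      LG.IsOrbifoldEquivalence wx wy V₁ V₂ Q →
      LG.IsWeightPreserving wy φ →
      (Function.Injective wy ∨ V₂ ∈ idealOfVars (Fin m) ℂ ^ 3) →
      (LG.linearPart φ).det ≠ 0 ∧
      -- `Q` and `V₂`, written in the new coordinates `y' = φ(y)`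
      (LG.IsOrbifoldEquivalence wx wy V₁ (φ.symm V₂) (LG.substY φ.symm Q) ∧
        LG.qR (φ.symm V₂) (LG.substY φ.symm Q) = C (LG.linearPart φ).det * LG.qR V₂ Q ∧
        LG.qL V₁ (LG.substY φ.symm Q) = C ((LG.linearPart φ).det⁻¹) * LG.qL V₁ Q ∧
        (LG.NoConstantEntries Q → LG.NoConstantEntries (LG.substY φ.symm Q))) ∧
      -- `φ(y)` substituted for `y` in `Q` and `V₂`
      (LG.IsOrbifoldEquivalence wx wy V₁ (φ V₂) (LG.substY φ Q) ∧
        LG.qR (φ V₂) (LG.substY φ Q) = C ((LG.linearPart φ).det⁻¹) * LG.qR V₂ Q ∧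
        LG.qL V₁ (LG.substY φ Q) = C (LG.linearPart φ).det * LG.qL V₁ Q ∧
        (LG.NoConstantEntries Q → LG.NoConstantEntries (LG.substY φ Q)))) ∧
    -- Auto-equivalences
    (LG.OrbifoldEquivalent LG.U12a LG.U12b ∧ LG.OrbifoldEquivalent LG.U12a LG.U12c ∧
      LG.OrbifoldEquivalent LG.U12b LG.U12c ∧ LG.OrbifoldEquivalent LG.Q12a LG.Q12b ∧
      LG.OrbifoldEquivalent LG.W12a LG.W12b ∧ LG.OrbifoldEquivalent LG.W13a LG.W13b ∧
      LG.OrbifoldEquivalent LG.Z13a LG.Z13b ∧ LG.OrbifoldEquivalent LG.E14a LG.E14b ∧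
      LG.OrbifoldEquivalent LG.Q17Ta LG.Q17Tb) ∧
    -- `A`-`Dᵀ`, `L`-`D` and `C`-`D`
    (∀ n : ℕ, 2 ≤ n →
      LG.OrbifoldEquivalent (LG.singAOdd n) (LG.singDT n) ∧
      LG.OrbifoldEquivalent (LG.singL n) (LG.singDEven n) ∧
      LG.OrbifoldEquivalent (LG.singC n) (LG.singDOdd n)) ∧
    -- Marginal deformations
    (∀ μ₂ : ℂ, μ₂ ^ 2 = 3 → LG.OrbifoldEquivalent LG.singA8A2 (LG.singZ13T μ₂)) ∧
    (∀ μ μ₁ μ₂ : ℂ, μ₂ ^ 2 ≠ 4 → μ₁ = μ * (μ₂ ^ 2 / 3 - 1) →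
      μ ^ 3 * (μ₂ * (2 / 9 * μ₂ ^ 2 - 1)) ^ 2 = -9 →
      LG.OrbifoldEquivalent (LG.singE19T μ₁) (LG.loop35 μ₂)) ∧
    -- Elliptic curves
    (∀ e₁ e₂ e₃ : ℂ, e₁ ≠ e₂ → e₁ ≠ e₃ → e₂ ≠ e₃ →
      LG.OrbifoldEquivalent (LG.ellipticLegendre ((e₃ - e₁) / (e₂ - e₁)))
        (LG.ellipticWeierstrass e₁ e₂ e₃)) ∧
    (∀ l l' : ℂ, l ≠ 0 → l ≠ 1 →
      l' ∈ ({l, 1 - l, 1 / l, 1 / (1 - l), (l - 1) / l, l / (l - 1)} : Set ℂ) →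
      LG.OrbifoldEquivalent (LG.ellipticLegendre l') (LG.ellipticLegendre l)) := by
  refine ⟨?_, ⟨?_, ?_, ?_, ?_, ?_, ?_, ?_, ?_, ?_⟩, ?_, ?_, ?_, ?_, ?_⟩
  · intro n m N wx wy V₁ V₂ Q φ hQ hφ h
    have h₁ := hQ.substY (LG.IsGradedAut.symm hφ) h
    rw [LG.linearPart_symm_det, inv_inv] at h₁
    exact ⟨LG.linearPart_det_ne_zero φ, h₁, hQ.substY hφ h⟩
  · obtain ⟨φ, hφ, h⟩ := LG.exists_U12b
    exact LG.isPotential_U12a.orbifoldEquivalent_right hφ h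
  · obtain ⟨φ, hφ, h⟩ := LG.exists_U12c
    exact LG.isPotential_U12a.orbifoldEquivalent_right hφ h
  · obtain ⟨φ, hφ, h⟩ := LG.exists_U12b
    obtain ⟨ψ, hψ, h'⟩ := LG.exists_U12c
    exact LG.isPotential_U12a.orbifoldEquivalent_of_apply_eq LG.isPotential_U12a.weight_pos
      hφ hψ h h'
  · exact LG.orbifoldEquivalent_Q12a_Q12b
  · exact LG.orbifoldEquivalent_W12a_W12b
  · exact LG.orbifoldEquivalent_W13a_W13b
  · exact LG.orbifoldEquivalent_Z13a_Z13b
  · exact LG.orbifoldEquivalent_E14a_E14b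
  · exact LG.orbifoldEquivalent_Q17Tb_Q17Ta
  · exact fun n hn => ⟨LG.orbifoldEquivalent_singAOdd_singDT hn,
      LG.orbifoldEquivalent_singL_singDEven hn, LG.orbifoldEquivalent_singC_singDOdd hn⟩
  · exact fun μ₂ h => LG.orbifoldEquivalent_singA8A2_singZ13T h
  · exact fun μ μ₁ μ₂ h₄ h₁ h => LG.orbifoldEquivalent_singE19T_loop35 h₄ h₁ h
  · exact fun e₁ e₂ e₃ h₁₂ h₁₃ h₂₃ =>
      LG.orbifoldEquivalent_ellipticLegendre_ellipticWeierstrass h₁₂ h₁₃ h₂₃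
  · exact fun l l' h₀ h₁ h => LG.orbifoldEquivalent_ellipticLegendre h₀ h₁ h
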